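/- **Theorem 3.1.** Let $0<\alpha<\beta<1$, $m\in\mathbb N=\{0,1,2,\dots\}$ and $n\in\mathbb N_{>0}$. Let $\Omega\subset\mathbb R$ be a bounded open interval of length $|\Omega|$, $0<T<\infty$, $\kappa_1,\kappa_2>0$, $u_0\in H_0^1(\Omega)$ and $f\in L^1(0,T;H^{-1}(\Omega))$. Here $H_0^1(\Omega)$ carries the inner product $(v,w)_{H_0^1(\Omega)}=\int_\Omega\partial_xv\,\partial_xw$ and $H^{-1}(\Omega)$ is its dual with the dual norm. *Discretization.* Let $\mathcal K_h$ be a partition of $\Omega$ into finitely many open intervals, and for $J\in\mathbb N_{>0}$ and $\sigma\ge1$ put $t_j=(j/J)^\sigma T$ $(0\le j\le J)$ and $I_j=(t_{j-1},t_j)$ $(1\le j\le J)$. Let $$S_h=\{v\in H_0^1(\Omega): v|_K\in P_n(K)\ \ \forall K\in\mathcal K_h\},\qquad W_{h,\tau}=\{V\in L^2(0,T;S_h): V|_{I_j}\in P_m(I_j;S_h),\ 1\le j\le J\},$$ where $P_k$ denotes polynomials of degree at most $k$. For $V\in W_{h,\tau}$ let $V_j^+=\lim_{t\to t_j+}V(t)$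 for $0\le j<J$, $V_j=V(t_j)=\lim_{t\to t_j-}V(t)$ for $0<j\le J$, $V_0=0$, and $[V_j]=V_j^+-V_j$ for $0\le j<J$; let $V'$ be the derivative of $V$ taken on each $I_j$ separately. For $0<\gamma<1$ let $D_{0+}^\gamma v$ be the distributional derivative on $(0,T)$ of $$t\mapsto\frac1{\Gamma(1-\gamma)}\int_0^t(t-s)^{-\gamma}v(s)\,ds .$$ Let $R_h:H_0^1(\Omega)\to S_h$ be defined by $\int_\Omega\partial_x(v-R_hv)\,\partial_xv_h=0$ for all $v_h\in S_h$. The scheme for $\partial_tu-(\kappa_1D_{0+}^\alpha+\kappa_2D_{0+}^\beta)\partial_x^2u=f$, $u(\cdot,0)=u_0$, $u=0$ on $\partial\Omega$, is: find $U\in W_{h,\tau}$ such that, for all $V\in W_{h,\tau}$, $$\int_0^T\!\!\int_\Omega U'V\,dx\,dt+\sum_{j=0}^{J-1}\int_\Omega[U_j]\,V_j^+\,dx+\int_0^T\!\!\int_\Omega\big((\kappa_1D_{0+}^\alpha+\kappa_2D_{0+}^\beta)\partial_xU\big)\,\partial_xV\,dx\,dt=\int_\Omega R_hu_0\,V_0^+\,dx+\int_0^T\langle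 f(t),V(t)\rangle\,dt .$$ *Norms.* For a normed space $X$ and $s>0$, $\|v\|_{L^2_\beta(0,s;X)}=\big(\int_0^st^\beta\|v(t)\|_X^2\,dt\big)^{1/2}$, and $L^2_\beta(0,s;X)$ consists of the $v\in L^1(0,s;X)$ for which this is finite. For $0<\gamma<1/2$ and a separable Hilbert space $X$ with an orthonormal basis $(e_i)$, $$|v|_{H^\gamma(0,s;X)}=\Big(\sum_i\int_{\mathbb R}|\xi|^{2\gamma}\big|\mathcal F\big((v,e_i)_X\chi_{(0,s)}\big)(\xi)\big|^2d\xi\Big)^{1/2},\qquad \mathcal Fw(\xi)=\frac1{\sqrt{2\pi}}\int_{\mathbb R}e^{-i\xi t}w(t)\,dt .$$ *Claim.* The scheme has a unique solution $U$. Moreover, there is a constant $C>0$ depending only on $\alpha,\beta,m,n$ such that, if in addition $f\in L^2_\beta(0,T;H^{-1}(\Omega))$, then for each $1\le j\le J$ (and for every choice of the orthonormal basis of $H_0^1(\Omega)$) $$\|U(t_j)\|_{L^2(\Omega)}+\sqrt{\kappa_1}\,|U|_{H^{\alpha/2}(0,t_j;H_0^1(\Omega))}+\sqrt{\kappa_2}\,|U|_{H^{\beta/2}(0,t_j;H_0^1(\Omega))}\le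 C\Big(\max\{1,|\Omega|\}\,\|u_0\|_{H_0^1(\Omega)}+\frac1{\sqrt{\kappa_2}}\|f\|_{L^2_\beta(0,t_j;H^{-1}(\Omega))}\Big).$$ -/

import Mathlib

open Set MeasureTheory Filter Topology
open scoped ENNReal ContDiff

noncomputable section

namespace SubdiffusionDG

/-! ### Sobolev spaces on a bounded interval -/

/-- `L²(Ω)` for `Ω = (a, b)`. -/
abbrev L2 (a b : ℝ) : Type := Lp ℝ 2 (volume.restrict (Ioo a b))

/-- `φ ∈ C_c^∞(a, b)`. -/
structure IsTest (a b : ℝ) (φ : ℝ → ℝ) : Prop where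
  smooth : ContDiff ℝ ∞ φ
  compact : HasCompactSupport φ
  supp : tsupport φ ⊆ Ioo a b

/-- The pairs `(φ, φ')` with `φ ∈ C_c^∞(a, b)`, as a subspace of `L²(Ω) × L²(Ω)`. -/
def testGraph (a b : ℝ) : Submodule ℝ (L2 a b × L2 a b) where
  carrier := {p | ∃ φ, IsTest a b φ ∧ p.1 =ᵐ[volume.restrict (Ioo a b)] φ ∧
    p.2 =ᵐ[volume.restrict (Ioo a b)] deriv φ}
  zero_mem' := by
    refine ⟨fun _ => 0, ⟨contDiff_const, HasCompactSupport.zero, by simp [tsupport]⟩, ?_, ?_⟩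
    · exact Lp.coeFn_zero _ _ _
    · rw [deriv_const']
      exact Lp.coeFn_zero ℝ 2 (volume.restrict (Ioo a b))
  add_mem' := by
    rintro p q ⟨φ, hφ, hp1, hp2⟩ ⟨ψ, hψ, hq1, hq2⟩
    refine ⟨φ + ψ, ⟨hφ.smooth.add hψ.smooth, hφ.compact.add hψ.compact,
      (tsupport_add φ ψ).trans (union_subset hφ.supp hψ.supp)⟩, ?_, ?_⟩
    · filter_upwards [Lp.coeFn_add p.1 q.1, hp1, hq1] with x h h1 h2
      exact h.trans (congrArg₂ (· + ·) h1 h2)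
    · filter_upwards [Lp.coeFn_add p.2 q.2, hp2, hq2] with x h h1 h2
      rw [deriv_add (hφ.smooth.differentiable (by simp) x) (hψ.smooth.differentiable (by simp) x)]
      exact h.trans (congrArg₂ (· + ·) h1 h2)
  smul_mem' := by
    rintro c p ⟨φ, hφ, hp1, hp2⟩
    refine ⟨c • φ, ⟨hφ.smooth.const_smul c, hφ.compact.smul_left (f := fun _ => c),
      (tsupport_smul_subset_right (fun _ => c) φ).trans hφ.supp⟩, ?_, ?_⟩
    · filter_upwards [Lp.coeFn_smul c p.1, hp1] with x h h1
      simp [h, h1]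
    · filter_upwards [Lp.coeFn_smul c p.2, hp2] with x h h1
      rw [deriv_const_smul c (hφ.smooth.differentiable (by simp) x)]
      simp [h, h1]

/-- `H₀¹(Ω)`, the closure of `C_c^∞(Ω)` in `H¹(Ω)`.  An element of `H¹(Ω)` is recorded together
with its weak derivative, as a pair in `L²(Ω) × L²(Ω)`. -/
def H01 (a b : ℝ) : Type := (testGraph a b).topologicalClosure

namespace H01

variable {a b : ℝ}

/-- Poincaré's inequality for test functions. -/
theorem poincare_test (p : L2 a b × L2 a b) (hp : p ∈ testGraph a b) :
    ‖p.1‖ ≤ (volume.restrict (Ioo a b)).real univ * ‖p.2‖ := by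
  obtain ⟨φ, hφ, h1, h2⟩ := hp
  set μ := volume.restrict (Ioo a b) with hμ
  have hd : Continuous (deriv φ) := hφ.smooth.continuous_deriv (by simp)
  have hdi : Integrable (deriv φ) := hd.integrable_of_hasCompactSupport hφ.compact.deriv
  have hbd : ∀ x ∈ Ioo a b, ‖φ x‖ ≤ ∫ y, ‖deriv φ y‖ ∂μ := by
    intro x hx
    have hφa : φ a = 0 := by
      by_contra h
      exact lt_irrefl a (hφ.supp (subset_tsupport φ h)).1
    have hI : ∫ y in a..x, deriv φ y = φ x - φ a :=
      intervalIntegral.integral_deriv_eq_sub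
        (fun y _ => hφ.smooth.differentiable (by simp) y) (hd.intervalIntegrable _ _)
    rw [hφa, sub_zero] at hI
    rw [← hI, intervalIntegral.integral_of_le hx.1.le]
    refine (norm_integral_le_integral_norm _).trans ?_
    rw [hμ]
    refine setIntegral_mono_set hdi.norm.integrableOn (ae_of_all _ fun y => norm_nonneg _) ?_
    exact Eventually.of_forall fun y hy => ⟨hy.1, hy.2.trans_lt hx.2⟩
  have hI2 : ∫ y, ‖deriv φ y‖ ∂μ ≤ μ.real univ ^ (1 / 2 : ℝ) * ‖p.2‖ := by
    have h := eLpNorm_le_eLpNorm_mul_rpow_measure_univ (μ := μ) (p := 1) (q := 2) (f := deriv φ)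
      (by norm_num) hd.aestronglyMeasurable
    have e2 : eLpNorm (deriv φ) 2 μ = eLpNorm p.2 2 μ := eLpNorm_congr_ae h2.symm
    rw [e2] at h
    have hfin : eLpNorm p.2 2 μ * μ univ ^ (1 / (1 : ℝ≥0∞).toReal - 1 / (2 : ℝ≥0∞).toReal) ≠ ⊤ :=
      ENNReal.mul_ne_top (Lp.eLpNorm_ne_top _)
        (ENNReal.rpow_ne_top_of_nonneg (by norm_num) (measure_ne_top _ _))
    have h' := ENNReal.toReal_mono hfin h
    rw [eLpNorm_one_eq_lintegral_enorm, ← integral_norm_eq_lintegral_enorm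
      hd.aestronglyMeasurable, ENNReal.toReal_mul, ← ENNReal.toReal_rpow, ← Lp.norm_def] at h'
    rw [mul_comm]
    have e3 : (1 / (1 : ℝ≥0∞).toReal - 1 / (2 : ℝ≥0∞).toReal) = (1 / 2 : ℝ) := by norm_num
    rw [e3] at h'
    exact h'
  have hae : ∀ᵐ x ∂μ, ‖p.1 x‖ ≤ μ.real univ ^ (1 / 2 : ℝ) * ‖p.2‖ := by
    filter_upwards [h1, ae_restrict_mem measurableSet_Ioo] with x hx hm
    rw [hx]
    exact (hbd x hm).trans hI2
  have h := Lp.norm_le_of_ae_bound (p := 2)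
    (mul_nonneg (Real.rpow_nonneg measureReal_nonneg _) (norm_nonneg _)) hae
  have e4 : μ.real univ ^ (1 / 2 : ℝ) * μ.real univ ^ (1 / 2 : ℝ) = μ.real univ := by
    rw [← Real.sqrt_eq_rpow, Real.mul_self_sqrt measureReal_nonneg]
  have e5 : ((measureUnivNNReal μ : NNReal) : ℝ) = μ.real univ := rfl
  rw [e5, ENNReal.toReal_ofNat, show (2 : ℝ)⁻¹ = 1 / 2 by norm_num, ← mul_assoc, e4] at h
  exact h

/-- The Poincaré inequality in `H₀¹(Ω)`. -/
theorem poincare_aux (v : (testGraph a b).topologicalClosure) :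
    ‖v.1.1‖ ≤ (volume.restrict (Ioo a b)).real univ * ‖v.1.2‖ := by
  have hc : IsClosed {p : L2 a b × L2 a b |
      ‖p.1‖ ≤ (volume.restrict (Ioo a b)).real univ * ‖p.2‖} :=
    isClosed_le (by fun_prop) (by fun_prop)
  exact closure_minimal (fun p hp => poincare_test p hp) hc v.2

theorem eq_zero_aux (v : (testGraph a b).topologicalClosure) (h : v.1.2 = 0) : v = 0 := by
  have h1 : v.1.1 = 0 := by
    have := poincare_aux v
    rw [h, norm_zero, mul_zero] at this
    exact norm_le_zero_iff.1 this
  exact Subtype.ext (Prod.ext h1 h)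

/-- The inner product `(u, v)_{H₀¹} = ∫_Ω ∂ₓu ∂ₓv`. -/
abbrev core (a b : ℝ) :
    InnerProductSpace.Core ℝ (testGraph a b).topologicalClosure where
  inner u v := inner ℝ u.1.2 v.1.2
  conj_inner_symm u v := inner_conj_symm (𝕜 := ℝ) u.1.2 v.1.2
  re_inner_nonneg u := real_inner_self_nonneg (x := u.1.2)
  add_left u v w := inner_add_left u.1.2 v.1.2 w.1.2
  smul_left u v r := inner_smul_left u.1.2 v.1.2 r
  definite u h := eq_zero_aux u (inner_self_eq_zero.1 h)

/-- `H₀¹(Ω)` carries the norm `‖v‖_{H₀¹} = ‖∂ₓv‖_{L²}`. -/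
instance : NormedAddCommGroup (H01 a b) := (core a b).toNormedAddCommGroup

instance : InnerProductSpace ℝ (H01 a b) := InnerProductSpace.ofCore (core a b).toCore

/-- The inclusion `H₀¹(Ω) → L²(Ω)`. -/
def toL2 : H01 a b →ₗ[ℝ] L2 a b where
  toFun v := v.1.1
  map_add' _ _ := rfl
  map_smul' _ _ := rfl

/-- The weak derivative `∂ₓ : H₀¹(Ω) → L²(Ω)`. -/
def dx : H01 a b →ₗ[ℝ] L2 a b where
  toFun v := v.1.2
  map_add' _ _ := rfl
  map_smul' _ _ := rfl

theorem inner_def (u v : H01 a b) : inner ℝ u v = inner ℝ (dx u) (dx v) := rfl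

end H01

/-- `H⁻¹(Ω)`, the dual of `H₀¹(Ω)` with the dual norm. -/
abbrev Hneg1 (a b : ℝ) : Type := StrongDual ℝ (H01 a b)

/-! ### Riemann–Liouville calculus for vector valued functions on `(0, T)` -/

section Fractional

variable {X : Type*} [NormedAddCommGroup X] [NormedSpace ℝ X]

/-- `(I_{0+}^γ v)(t) = Γ(γ)⁻¹ ∫₀ᵗ (t - s)^{γ - 1} v(s) ds`. -/
def rlIntegral (γ : ℝ) (v : ℝ → X) (t : ℝ) : X :=
  (Real.Gamma γ)⁻¹ • ∫ s in Ioo 0 t, (t - s) ^ (γ - 1) • v s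

/-- `g ∈ L¹(0,T;X)` is the distributional derivative of `w ∈ L¹(0,T;X)` on `(0, T)`. -/
def IsWeakDeriv (T : ℝ) (w g : ℝ → X) : Prop :=
  IntegrableOn w (Ioo 0 T) ∧ IntegrableOn g (Ioo 0 T) ∧
    ∀ φ : ℝ → ℝ, IsTest 0 T φ →
      ∫ t in Ioo 0 T, deriv φ t • w t = -∫ t in Ioo 0 T, φ t • g t

/-- `D_{0+}^γ v = g`, where `D_{0+}^γ = D I_{0+}^{1-γ}` and `D` is the distributional derivative
on `(0, T)`. -/
def IsRLDeriv (γ T : ℝ) (v g : ℝ → X) : Prop :=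
  IsWeakDeriv T (rlIntegral (1 - γ) v) g

/-- The norm of `L²_δ(0,s;X)`, that is `(∫₀ˢ |t|^δ ‖v(t)‖² dt)^{1/2}`. -/
def weightedNorm (δ s : ℝ) (v : ℝ → X) : ℝ≥0∞ :=
  (∫⁻ t in Ioo 0 s, ENNReal.ofReal (|t| ^ δ) * ‖v t‖ₑ ^ 2) ^ (1 / 2 : ℝ)

/-- `v ∈ L²_δ(0,s;X)`. -/
def MemWeighted (δ s : ℝ) (v : ℝ → X) : Prop :=
  IntegrableOn v (Ioo 0 s) ∧ weightedNorm δ s v < ⊤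

/-- The unitary Fourier transform `(2π)^{-1/2} ∫ e^{-iξt} v(t) dt` of `v χ_{(0,s)}`. -/
def fourierOn (s : ℝ) (v : ℝ → ℝ) (ξ : ℝ) : ℂ :=
  ((Real.sqrt (2 * Real.pi))⁻¹ : ℝ) *
    ∫ t in Ioo 0 s, Complex.exp (-(Complex.I * (ξ * t : ℝ))) * (v t : ℂ)

/-- The seminorm of `H^γ(0,s)` for `0 < γ < 1/2`:
`(∫ |ξ|^{2γ} |F(v χ_{(0,s)})(ξ)|² dξ)^{1/2}`. -/
def scalarSeminorm (γ s : ℝ) (v : ℝ → ℝ) : ℝ≥0∞ :=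
  (∫⁻ ξ : ℝ, ENNReal.ofReal (|ξ| ^ (2 * γ)) * ‖fourierOn s v ξ‖ₑ ^ 2) ^ (1 / 2 : ℝ)

end Fractional

/-- The seminorm of `H^γ(0,s;X)` for `0 < γ < 1/2`, computed in the orthonormal basis `e` of the
Hilbert space `X`: `(∑ⱼ |(v, eⱼ)_X|²_{H^γ(0,s)})^{1/2}`. -/
def fracSeminorm {X : Type*} [NormedAddCommGroup X] [InnerProductSpace ℝ X] {ι : Type}
    (e : HilbertBasis ι ℝ X) (γ s : ℝ) (v : ℝ → X) : ℝ≥0∞ :=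
  (∑' j, scalarSeminorm γ s (fun t => inner ℝ (v t) (e j)) ^ 2) ^ (1 / 2 : ℝ)

/-! ### The discretization -/

/-- A partition `a = x₀ < x₁ < ⋯ < x_N = b` of `Ω = (a, b)`; the elements of the partition are the
open intervals `(x_{i}, x_{i+1})`. -/
structure Partition (a b : ℝ) where
  N : ℕ
  x : Fin (N + 1) → ℝ
  strictMono : StrictMono x
  first : x 0 = a
  last : x (Fin.last N) = b

theorem Partition.element_subset {a b : ℝ} (K : Partition a b) (i : Fin K.N) :
    Ioo (K.x i.castSucc) (K.x i.succ) ⊆ Ioo a b :=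
  Ioo_subset_Ioo (K.first.symm.le.trans (K.strictMono.monotone (Fin.zero_le _)))
    ((K.strictMono.monotone (Fin.le_last _)).trans K.last.le)

/-- The finite element space `S_h` of the `v ∈ H₀¹(Ω)` with `v|_K ∈ P_n(K)` for all elements
`K` of the partition. -/
def Sh {a b : ℝ} (K : Partition a b) (n : ℕ) : Submodule ℝ (H01 a b) where
  carrier := {v | ∀ i : Fin K.N, ∃ p : Polynomial ℝ, p.natDegree ≤ n ∧
    ∀ᵐ y ∂volume.restrict (Ioo (K.x i.castSucc) (K.x i.succ)),
      (H01.toL2 v : ℝ → ℝ) y = p.eval y}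
  zero_mem' := by
    intro i
    refine ⟨0, by simp, ?_⟩
    have hsub := K.element_subset i
    rw [map_zero]
    filter_upwards [ae_restrict_of_ae_restrict_of_subset hsub
      (Lp.coeFn_zero ℝ 2 (volume.restrict (Ioo a b)))] with y hy
    simpa using hy
  add_mem' := by
    intro v w hv hw i
    obtain ⟨p, hp, hvp⟩ := hv i
    obtain ⟨q, hq, hwq⟩ := hw i
    refine ⟨p + q, (Polynomial.natDegree_add_le _ _).trans (max_le hp hq), ?_⟩
    have hsub := K.element_subset i
    rw [map_add]
    filter_upwards [ae_restrict_of_ae_restrict_of_subset hsub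
      (Lp.coeFn_add (H01.toL2 v) (H01.toL2 w)), hvp, hwq] with y h h1 h2
    rw [Polynomial.eval_add, ← h1, ← h2]
    exact h
  smul_mem' := by
    intro c v hv i
    obtain ⟨p, hp, hvp⟩ := hv i
    refine ⟨c • p, (Polynomial.natDegree_smul_le _ _).trans hp, ?_⟩
    have hsub := K.element_subset i
    rw [map_smul]
    filter_upwards [ae_restrict_of_ae_restrict_of_subset hsub
      (Lp.coeFn_smul c (H01.toL2 v)), hvp] with y h h1
    simp [h, h1]

/-- `r = R_h v`: `r ∈ S_h` and `∫_Ω ∂ₓ(v - r) ∂ₓ v_h = 0` for all `v_h ∈ S_h`. -/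
def IsRitz {a b : ℝ} (K : Partition a b) (n : ℕ) (v r : H01 a b) : Prop :=
  r ∈ Sh K n ∧ ∀ vh ∈ Sh K n, inner ℝ (H01.dx (v - r)) (H01.dx vh) = 0

/-- The graded grid `t_j = (j / J)^σ T`. -/
def grid (T σ : ℝ) (J j : ℕ) : ℝ := ((j : ℝ) / (J : ℝ)) ^ σ * T

/-- `V ∈ W_{h,τ}`: on each `(t_j, t_{j+1})` with `j < J`, `V` is a polynomial in `t` of degree
at most `m` with coefficients in `S_h`. -/
def MemW {a b : ℝ} (K : Partition a b) (n m : ℕ) (T σ : ℝ) (J : ℕ) (V : ℝ → H01 a b) : Prop :=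
  ∀ j < J, ∃ c : ℕ → H01 a b, (∀ k, c k ∈ Sh K n) ∧
    ∀ t ∈ Ioo (grid T σ J j) (grid T σ J (j + 1)), V t = ∑ k ∈ Finset.range (m + 1), t ^ k • c k

section Traces

variable {a b : ℝ} (T σ : ℝ) (J : ℕ) (V : ℝ → H01 a b) (j : ℕ)

/-- `V_j⁺ = lim_{t → t_j+} V(t)`. -/
def traceR : H01 a b := Function.rightLim V (grid T σ J j)

/-- `V_j = V(t_j) = lim_{t → t_j-} V(t)` for `j > 0`, and `V_0 = 0`. -/
def traceL : H01 a b := if j = 0 then 0 else Function.leftLim V (grid T σ J j)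

/-- The jump `V_j⁺ - V_j`. -/
def jump : H01 a b := traceR T σ J V j - traceL T σ J V j

end Traces

/-- `U` solves the time-stepping discontinuous Galerkin scheme: `U ∈ W_{h,τ}` and
`⟨U', V⟩_{Ω_T} + ∑_{j<J} ⟨[U_j], V_j⁺⟩_Ω + ⟨(κ₁ D^α + κ₂ D^β) ∂ₓU, ∂ₓV⟩_{Ω_T}
  = ⟨R_h u₀, V_0⁺⟩_Ω + ⟨f, V⟩` for all `V ∈ W_{h,τ}`, where `U'` is taken on each time interval
separately.  Here `r = R_h u₀`, `gα = D_{0+}^α ∂ₓU` and `gβ = D_{0+}^β ∂ₓU`. -/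
def Solves {a b : ℝ} (K : Partition a b) (n m : ℕ) (T σ : ℝ) (J : ℕ) (α β κ₁ κ₂ : ℝ)
    (u₀ : H01 a b) (f : ℝ → Hneg1 a b) (U : ℝ → H01 a b) : Prop :=
  MemW K n m T σ J U ∧
  ∃ (r : H01 a b) (gα gβ : ℝ → L2 a b), IsRitz K n u₀ r ∧
    IsRLDeriv α T (fun t => H01.dx (U t)) gα ∧
    IsRLDeriv β T (fun t => H01.dx (U t)) gβ ∧
    ∀ V : ℝ → H01 a b, MemW K n m T σ J V →
      (∑ j ∈ Finset.range J, ∫ t in Ioo (grid T σ J j) (grid T σ J (j + 1)),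
          inner ℝ (H01.toL2 (deriv U t)) (H01.toL2 (V t)))
        + (∑ j ∈ Finset.range J,
          inner ℝ (H01.toL2 (jump T σ J U j)) (H01.toL2 (traceR T σ J V j)))
        + (∫ t in Ioo 0 T, inner ℝ (κ₁ • gα t + κ₂ • gβ t) (H01.dx (V t)))
      = inner ℝ (H01.toL2 r) (H01.toL2 (traceR T σ J V 0)) + ∫ t in Ioo 0 T, f t (V t)

end SubdiffusionDG

end

noncomputable section

namespace SubdiffusionDG

/-! ### Plancherel's theorem for integrable square integrable functions -/

section Plancherel

open FourierTransform SchwartzMap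

/-! The scheme is coercive, and coercivity yields everything. Testing with the solution cut off at
`t_j` localizes the equation to `(0, t_j)`. There the time derivative and the jumps telescope to
half the squared final trace plus half of every squared jump (`energy_identity`). The jump at `0` is
the whole initial trace and absorbs the term with the initial datum.

The fractional terms rest on one identity. A piecewise polynomial `w`, extended by zero, satisfies
`∫ ‖w t - w (t - h)‖ dt ≤ C h` (`LipInMean`). This is enough to write its Riemann–Liouville
derivative as the Marchaud integral `Γ(1-γ)⁻¹ (t^(-γ) w(t) + γ ∫₀ᵗ h^(-1-γ) (w(t) - w(t-h)) dh)`
(`integral_marchaud`, `LipInMean.isRLDeriv_marchaud`). Pairing with `w(t)` and using `2⟨x - y, x⟩ =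
|x|² - |y|² + |x - y|²` gives (`integral_marchaud_inner`) `Γ(1-γ) ∫₀ˢ ⟨D^γ w, w⟩ = ½ ∫₀ˢ t^(-γ)
|w(t)|² + ½ ∫₀ˢ t^(-γ) |w(s-t)|² + (γ/2) ∬ h^(-1-γ) |w(τ) - w(τ-h)|²`, a sum of nonnegative terms.

The first term controls `U` in the weight dual to that of the load, so the load is handled by
Cauchy–Schwarz and Young (`integral_apply_le`, `Solves.energy_estimate`). The first and last terms
together control the Gagliardo energy over all translates (`translateEnergy_le`), which by
Plancherel dominates the Fourier seminorm, in every orthonormal basis (`scalarSeminorm_sq_le`,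
`fracSeminorm_sq_le`).

Coercivity also shows that the form has trivial kernel. The discrete space is finite dimensional
once values off the time intervals are normalized to zero, so injectivity gives existence
(`exists_solves`); applied to a difference of solutions it gives uniqueness (`Solves.eqOn`). -/

theorem fourier_toLp_ae_eq {f : ℝ → ℂ} (h1 : Integrable f) (h2 : MemLp f 2) :
    (𝓕 (h2.toLp f) : Lp ℂ 2 (volume : Measure ℝ)) =ᵐ[volume] 𝓕 f := by
  have hc : Continuous (𝓕 f) :=
    VectorFourier.fourierIntegral_continuous Real.continuous_fourierChar
      (by exact continuous_inner) h1
  -- The `L²` transform and the integral transform are compared as distributions: paired with a bump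
  -- function, each moves onto the bump, where there is only one Fourier transform.
  refine ae_eq_of_integral_contDiff_smul_eq
    ((Lp.memLp (𝓕 (h2.toLp f))).locallyIntegrable (by norm_num))
    hc.locallyIntegrable ?_
  intro g hg hgc
  have hg₁ : HasCompactSupport (Complex.ofRealCLM ∘ g) := hgc.comp_left rfl
  have hg₂ : ContDiff ℝ ∞ (Complex.ofRealCLM ∘ g) := by fun_prop
  set φ : 𝓢(ℝ, ℂ) := hg₁.toSchwartzMap hg₂ with hφ
  have hφa : ∀ x, φ x = (g x : ℂ) := fun x => rfl
  have e1 : ∫ x, g x • (𝓕 (h2.toLp f) : Lp ℂ 2 (volume : Measure ℝ)) x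
      = (Lp.toTemperedDistribution (𝓕 (h2.toLp f) : Lp ℂ 2 (volume : Measure ℝ))) φ := by
    rw [Lp.toTemperedDistribution_apply]
    rfl
  have e2 : (Lp.toTemperedDistribution (h2.toLp f)) (𝓕 φ) = ∫ x, (𝓕 φ) x • f x := by
    rw [Lp.toTemperedDistribution_apply]
    refine integral_congr_ae ?_
    filter_upwards [h2.coeFn_toLp] with x hx
    rw [hx]
  have e3 : ∫ x, (𝓕 (φ : ℝ → ℂ)) x • f x = ∫ x, φ x • (𝓕 f) x := by
    have := VectorFourier.integral_fourierIntegral_smul_eq_flip (μ := (volume : Measure ℝ))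
      (ν := (volume : Measure ℝ)) (L := innerₗ ℝ) (f := (φ : ℝ → ℂ)) (g := f)
      Real.continuous_fourierChar (by exact continuous_inner) φ.integrable h1
    simpa using! this
  rw [e1, ← Lp.fourier_toTemperedDistribution_eq, TemperedDistribution.fourier_apply, e2,
    SchwartzMap.fourier_coe, e3]
  rfl

theorem lintegral_fourier_sq {f : ℝ → ℂ} (h1 : Integrable f) (h2 : MemLp f 2) :
    ∫⁻ ξ, ‖𝓕 f ξ‖ₑ ^ 2 = ∫⁻ t, ‖f t‖ₑ ^ 2 := by
  have key : eLpNorm (𝓕 f) 2 volume = eLpNorm f 2 volume := by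
    rw [← eLpNorm_congr_ae (fourier_toLp_ae_eq h1 h2), ← eLpNorm_congr_ae h2.coeFn_toLp,
      ← ENNReal.toReal_eq_toReal_iff' (Lp.eLpNorm_ne_top _) (Lp.eLpNorm_ne_top _),
      ← Lp.norm_def, ← Lp.norm_def]
    exact Lp.norm_fourier_eq _
  rw [eLpNorm_eq_lintegral_rpow_enorm_toReal (by norm_num) (by norm_num),
    eLpNorm_eq_lintegral_rpow_enorm_toReal (by norm_num) (by norm_num)] at key
  have := ENNReal.rpow_left_injective (x := 1 / (2 : ℝ≥0∞).toReal) (by norm_num) key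
  simpa using this

end Plancherel

/-! ### The Fourier seminorm is controlled by differences -/

section Gagliardo

open FourierTransform

theorem fourier_sub_translate {f : ℝ → ℂ} (h1 : Integrable f) (h η : ℝ) :
    𝓕 (fun t => f t - f (t - h)) η
      = (1 - Complex.exp (↑(-2 * Real.pi * h * η) * Complex.I)) * 𝓕 f η := by
  simp only [Real.fourier_real_eq_integral_exp_smul]
  have hi : ∀ g : ℝ → ℂ, Integrable g →
      Integrable fun v : ℝ => Complex.exp (↑(-2 * Real.pi * v * η) * Complex.I) • g v := by
    intro g hg
    refine hg.bdd_mul (c := 1) (Continuous.aestronglyMeasurable (by fun_prop)) ?_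
    exact ae_of_all _ fun v => by rw [Complex.norm_exp_ofReal_mul_I]
  simp only [smul_sub]
  rw [integral_sub (hi f h1) (hi _ (h1.comp_sub_right h))]
  rw [← integral_add_right_eq_self
    (fun v : ℝ => Complex.exp (↑(-2 * Real.pi * v * η) * Complex.I) • f (v - h)) h]
  have : ∀ v : ℝ, Complex.exp (↑(-2 * Real.pi * (v + h) * η) * Complex.I) • f (v + h - h)
      = Complex.exp (↑(-2 * Real.pi * h * η) * Complex.I) *
        (Complex.exp (↑(-2 * Real.pi * v * η) * Complex.I) • f v) := by
    intro v
    rw [add_sub_cancel_right, smul_eq_mul, smul_eq_mul, ← mul_assoc, ← Complex.exp_add]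
    congr 2
    push_cast
    ring
  simp only [this]
  rw [integral_const_mul]
  ring

/-- The square equals `2 - 2 cos x`, and the cosine is nonpositive in this range. -/
theorem two_le_norm_one_sub_exp_sq {x : ℝ} (h1 : Real.pi / 2 ≤ |x|) (h2 : |x| ≤ Real.pi) :
    2 ≤ ‖1 - Complex.exp (↑x * Complex.I)‖ ^ 2 := by
  have hc : Real.cos x ≤ 0 := by
    rw [← Real.cos_abs]
    exact Real.cos_nonpos_of_pi_div_two_le_of_le h1 (by linarith [Real.pi_pos])
  rw [← Complex.normSq_eq_norm_sq, Complex.normSq_apply]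
  simp only [Complex.sub_re, Complex.one_re, Complex.exp_ofReal_mul_I_re, Complex.sub_im,
    Complex.one_im, Complex.exp_ofReal_mul_I_im]
  nlinarith [Real.sin_sq_add_cos_sq x]

/-- The integral on the right is the symbol of the translate energy, and scales like `|η|^γ`. Only a
lower bound is needed, so a single dyadic window of `h` suffices. -/
theorem rpow_le_lintegral_symbol {γ : ℝ} (h0 : 0 < γ) (η : ℝ) :
    ENNReal.ofReal (|η| ^ γ) ≤ ∫⁻ h in Ioi (0 : ℝ), ENNReal.ofReal (h ^ (-1 - γ)) *
      ‖1 - Complex.exp (↑(-2 * Real.pi * h * η) * Complex.I)‖ₑ ^ 2 := by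
  rcases eq_or_ne η 0 with rfl | hη
  · simp [Real.zero_rpow h0.ne']
  have ha : 0 < |η| := abs_pos.2 hη
  -- For `h` between `a` and `2 a` the phase `2 π h |η|` runs from `π / 2` to `π`. The window
  -- contributes at least `(2 a)^(-1-γ) * 2 * a = 2^γ |η|^γ`.
  set a := 1 / (4 * |η|) with ha'
  have hapos : 0 < a := by positivity
  have hab : Ioo a (2 * a) ⊆ Ioi 0 := fun x hx => hapos.trans hx.1
  calc ENNReal.ofReal (|η| ^ γ)
      ≤ ENNReal.ofReal ((2 * a) ^ (-1 - γ) * 2) * volume (Ioo a (2 * a)) := by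
        rw [Real.volume_Ioo, ← ENNReal.ofReal_mul (by positivity)]
        apply ENNReal.ofReal_le_ofReal
        have e1 : (2 * a) = (2 * |η|)⁻¹ := by rw [ha']; field_simp; norm_num
        have e2 : (2 * a) ^ (-1 - γ) = (2 * |η|) * (2 ^ γ * |η| ^ γ) := by
          rw [e1, Real.inv_rpow (by positivity), ← Real.rpow_neg (by positivity),
            show -(-1 - γ) = 1 + γ by ring, Real.rpow_add (by positivity), Real.rpow_one,
            Real.mul_rpow (by norm_num) ha.le]
        have e3 : 2 * |η| * (2 ^ γ * |η| ^ γ) * 2 * (2 * a - a) = 2 ^ γ * |η| ^ γ := by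
          rw [ha']; field_simp; norm_num
        rw [e2, e3]
        have : (1 : ℝ) ≤ 2 ^ γ := Real.one_le_rpow (by norm_num) h0.le
        exact le_mul_of_one_le_left (by positivity) this
    _ = ∫⁻ h in Ioo a (2 * a), ENNReal.ofReal ((2 * a) ^ (-1 - γ) * 2) := by
        rw [setLIntegral_const]
    _ ≤ ∫⁻ h in Ioo a (2 * a), ENNReal.ofReal (h ^ (-1 - γ)) *
      ‖1 - Complex.exp (↑(-2 * Real.pi * h * η) * Complex.I)‖ₑ ^ 2 := by
        refine setLIntegral_mono' measurableSet_Ioo fun h hh => ?_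
        have hp : 0 < h := hab hh
        rw [ENNReal.ofReal_mul (by positivity)]
        refine mul_le_mul' (ENNReal.ofReal_le_ofReal ?_) ?_
        · exact Real.rpow_le_rpow_of_nonpos hp hh.2.le (by linarith)
        · rw [← ofReal_norm, ← ENNReal.ofReal_pow (norm_nonneg _)]
          apply ENNReal.ofReal_le_ofReal
          have habs : |-2 * Real.pi * h * η| = 2 * Real.pi * h * |η| := by
            rw [abs_mul, abs_mul, abs_mul, abs_neg, abs_of_pos hp, abs_of_pos Real.pi_pos]
            norm_num
          have hle : ∀ c : ℝ, 2 * Real.pi * (c * a) * |η| = c * Real.pi / 2 := by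
            intro c
            rw [ha']; field_simp; norm_num [mul_comm]
          have k1 := hle 1
          have k2 := hle 2
          apply two_le_norm_one_sub_exp_sq
          · rw [habs]
            calc Real.pi / 2 = 2 * Real.pi * (1 * a) * |η| := by rw [k1]; ring
              _ ≤ _ := by
                gcongr
                linarith [hh.1]
          · rw [habs]
            calc 2 * Real.pi * h * |η| ≤ 2 * Real.pi * (2 * a) * |η| := by
                  gcongr
                  exact hh.2.le
              _ = Real.pi := by rw [k2]; ring
    _ ≤ _ := lintegral_mono_set hab

theorem fourierOn_eq (s : ℝ) (v : ℝ → ℝ) (ξ : ℝ) :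
    fourierOn s v ξ = ((Real.sqrt (2 * Real.pi))⁻¹ : ℝ) *
      𝓕 (fun t => ((indicator (Ioo 0 s) v t : ℝ) : ℂ)) ((2 * Real.pi)⁻¹ * ξ) := by
  rw [fourierOn, Real.fourier_real_eq_integral_exp_smul, ← integral_indicator measurableSet_Ioo]
  congr 2
  ext t
  by_cases ht : t ∈ Ioo 0 s
  · rw [indicator_of_mem ht, indicator_of_mem ht, smul_eq_mul]
    congr 2
    have : (Real.pi : ℂ) ≠ 0 := by exact_mod_cast Real.pi_ne_zero
    push_cast
    field_simp
  · rw [indicator_of_notMem ht, indicator_of_notMem ht]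
    simp

theorem lintegral_comp_mul_left_eq {c : ℝ} (hc : 0 < c) {F : ℝ → ℝ≥0∞} (hF : Measurable F) :
    ∫⁻ ξ, F (c * ξ) = ENNReal.ofReal c⁻¹ * ∫⁻ ξ, F ξ := by
  have h := Real.map_volume_mul_left hc.ne'
  rw [abs_of_pos (inv_pos.2 hc)] at h
  rw [← lintegral_map hF (measurable_const_mul c), h, lintegral_smul_measure, smul_eq_mul]

/-- The weight is bounded by the symbol integral, Tonelli exchanges `h` and the frequency, and
Plancherel applied to each `f - f(· - h)` returns to the time side. -/
theorem scalarSeminorm_sq_le {γ : ℝ} (h0 : 0 < γ) (s : ℝ) {v : ℝ → ℝ}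
    (h1 : Integrable (indicator (Ioo 0 s) v)) (h2 : MemLp (indicator (Ioo 0 s) v) 2) :
    scalarSeminorm (γ / 2) s v ^ 2 ≤ ENNReal.ofReal ((2 * Real.pi) ^ γ) *
      ∫⁻ h in Ioi (0 : ℝ), ENNReal.ofReal (h ^ (-1 - γ)) *
        ∫⁻ t, ‖indicator (Ioo 0 s) v t - indicator (Ioo 0 s) v (t - h)‖ₑ ^ 2 := by
  set f : ℝ → ℂ := fun t => ((indicator (Ioo 0 s) v t : ℝ) : ℂ) with hf
  have hf1 : Integrable f := h1.ofReal
  have hf2 : MemLp f 2 := h2.ofReal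
  have hcont : Continuous (𝓕 f) :=
    VectorFourier.fourierIntegral_continuous Real.continuous_fourierChar
      (by exact continuous_inner) hf1
  have hpi : 0 < 2 * Real.pi := by positivity
  -- With `ξ = 2 π η` the weight produces `(2 π)^γ`, while the factor `2 π` from `dξ` cancels the
  -- squared normalization.
  have step1 : scalarSeminorm (γ / 2) s v ^ 2
      = ENNReal.ofReal ((2 * Real.pi) ^ γ) * ∫⁻ η, ENNReal.ofReal (|η| ^ γ) * ‖𝓕 f η‖ₑ ^ 2 := by
    have hm : Measurable fun η : ℝ => ENNReal.ofReal (|η| ^ γ) * ‖𝓕 f η‖ₑ ^ 2 := by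
      have := hcont.measurable
      fun_prop
    have hsc := lintegral_comp_mul_left_eq (inv_pos.2 hpi) hm
    rw [inv_inv] at hsc
    rw [scalarSeminorm, ← ENNReal.rpow_natCast, ← ENNReal.rpow_mul]
    norm_num only [one_div, Nat.cast_ofNat, ENNReal.rpow_one, inv_mul_cancel₀]
    have hpt : ∀ ξ : ℝ, ENNReal.ofReal (|ξ| ^ (2 * (γ / 2))) * ‖fourierOn s v ξ‖ₑ ^ 2
        = ENNReal.ofReal ((2 * Real.pi) ^ γ * (2 * Real.pi)⁻¹) *
          (ENNReal.ofReal (|(2 * Real.pi)⁻¹ * ξ| ^ γ) * ‖𝓕 f ((2 * Real.pi)⁻¹ * ξ)‖ₑ ^ 2) := by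
      intro ξ
      rw [fourierOn_eq, enorm_mul, mul_pow, ← mul_assoc, ← mul_assoc]
      congr 1
      rw [← ofReal_norm, ← ENNReal.ofReal_pow (norm_nonneg _), Complex.norm_real, norm_inv,
        Real.norm_of_nonneg (Real.sqrt_nonneg _), inv_pow, Real.sq_sqrt hpi.le,
        ← ENNReal.ofReal_mul (by positivity), ← ENNReal.ofReal_mul (by positivity)]
      congr 1
      rw [abs_mul, abs_of_pos (inv_pos.2 hpi),
        Real.mul_rpow (inv_pos.2 hpi).le (abs_nonneg _), Real.inv_rpow hpi.le]
      have := (Real.rpow_pos_of_pos hpi γ).ne'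
      rw [show 2 * (γ / 2) = γ by ring]
      field_simp
    calc _ = ∫⁻ ξ : ℝ, ENNReal.ofReal (|ξ| ^ (2 * (γ / 2))) * ‖fourierOn s v ξ‖ₑ ^ 2 := by
          norm_num
      _ = _ := by
        simp only [hpt]
        rw [lintegral_const_mul' _ _ ENNReal.ofReal_ne_top, hsc, ← mul_assoc,
          ← ENNReal.ofReal_mul (by positivity)]
        congr 2
        field_simp
  rw [step1]
  refine mul_le_mul_right ?_ _
  have step2 : ∀ h : ℝ,
      ∫⁻ t, ‖indicator (Ioo 0 s) v t - indicator (Ioo 0 s) v (t - h)‖ₑ ^ 2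
      = ∫⁻ η, ‖1 - Complex.exp (↑(-2 * Real.pi * h * η) * Complex.I)‖ₑ ^ 2 * ‖𝓕 f η‖ₑ ^ 2 := by
    intro h
    have g1 : Integrable (fun t => f t - f (t - h)) := hf1.sub (hf1.comp_sub_right h)
    have g2 : MemLp (fun t => f t - f (t - h)) 2 :=
      hf2.sub (hf2.comp_measurePreserving (measurePreserving_sub_right volume h))
    have := lintegral_fourier_sq g1 g2
    simp only [fourier_sub_translate hf1, enorm_mul, mul_pow] at this
    rw [this]
    refine lintegral_congr fun t => ?_
    rw [hf, ← Complex.ofReal_sub, ← ofReal_norm, ← ofReal_norm, Complex.norm_real]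
  simp only [step2]
  calc ∫⁻ η, ENNReal.ofReal (|η| ^ γ) * ‖𝓕 f η‖ₑ ^ 2
      ≤ ∫⁻ η, (∫⁻ h in Ioi (0 : ℝ), ENNReal.ofReal (h ^ (-1 - γ)) *
        ‖1 - Complex.exp (↑(-2 * Real.pi * h * η) * Complex.I)‖ₑ ^ 2) * ‖𝓕 f η‖ₑ ^ 2 :=
        lintegral_mono fun η => mul_le_mul_left (rpow_le_lintegral_symbol h0 η) _
    _ = ∫⁻ η, ∫⁻ h in Ioi (0 : ℝ), ENNReal.ofReal (h ^ (-1 - γ)) *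
        ‖1 - Complex.exp (↑(-2 * Real.pi * h * η) * Complex.I)‖ₑ ^ 2 * ‖𝓕 f η‖ₑ ^ 2 := by
        refine lintegral_congr fun η => ?_
        rw [lintegral_mul_const]
        fun_prop
    _ = ∫⁻ h in Ioi (0 : ℝ), ∫⁻ η, ENNReal.ofReal (h ^ (-1 - γ)) *
        ‖1 - Complex.exp (↑(-2 * Real.pi * h * η) * Complex.I)‖ₑ ^ 2 * ‖𝓕 f η‖ₑ ^ 2 := by
        rw [lintegral_lintegral_swap]
        have := hcont.measurable
        fun_prop
    _ = _ := by
        refine lintegral_congr fun h => ?_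
        rw [← lintegral_const_mul]
        · simp only [mul_assoc]
        · have := hcont.measurable
          fun_prop

end Gagliardo

/-! ### The Marchaud form of the Riemann–Liouville derivative -/

section Marchaud

variable {E : Type*} [NormedAddCommGroup E]

/-- Bounded measurable functions whose translates differ by `O(h)` in `L¹`. -/
structure LipInMean (w : ℝ → E) : Prop where
  sm : StronglyMeasurable w
  bdd : ∃ M, ∀ t, ‖w t‖ ≤ M
  shift : ∃ C : ℝ, ∀ h, 0 < h → ∫⁻ t, ‖w t - w (t - h)‖ₑ ≤ ENNReal.ofReal (C * h)

theorem LipInMean.integrableOn {w : ℝ → E} (hw : LipInMean w) {s : Set ℝ} (hs : volume s ≠ ⊤) :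
    IntegrableOn w s := by
  obtain ⟨M, hM⟩ := hw.bdd
  exact Measure.integrableOn_of_bounded hs hw.sm.aestronglyMeasurable (ae_of_all _ hM)

theorem LipInMean.intervalIntegrable {w : ℝ → E} (hw : LipInMean w) (a b : ℝ) :
    IntervalIntegrable w volume a b := by
  rw [intervalIntegrable_iff]
  exact hw.integrableOn (by simp [uIoc])

/-- Lets the Marchaud integral formulas be applied to the scalar function `‖w‖²`, which appears
after polarization. -/
theorem LipInMean.norm_sq {w : ℝ → E} (hw : LipInMean w) : LipInMean fun t => ‖w t‖ ^ 2 := by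
  obtain ⟨M, hM⟩ := hw.bdd
  obtain ⟨C, hC⟩ := hw.shift
  have hM0 : 0 ≤ M := (norm_nonneg _).trans (hM 0)
  refine ⟨hw.sm.norm.pow 2, ⟨M ^ 2, fun t => ?_⟩, ⟨2 * M * C, fun h hh => ?_⟩⟩
  · rw [norm_pow, norm_norm]
    exact pow_le_pow_left₀ (norm_nonneg _) (hM t) 2
  · calc ∫⁻ t, ‖‖w t‖ ^ 2 - ‖w (t - h)‖ ^ 2‖ₑ
        ≤ ∫⁻ t, ENNReal.ofReal (2 * M) * ‖w t - w (t - h)‖ₑ := by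
          refine lintegral_mono fun t => ?_
          rw [← ofReal_norm, ← ofReal_norm, ← ENNReal.ofReal_mul (by positivity)]
          apply ENNReal.ofReal_le_ofReal
          rw [sq_sub_sq, norm_mul]
          refine mul_le_mul ?_ (abs_norm_sub_norm_le _ _) (norm_nonneg _) (by positivity)
          rw [Real.norm_of_nonneg (by positivity)]
          linarith [hM t, hM (t - h)]
      _ = ENNReal.ofReal (2 * M) * ∫⁻ t, ‖w t - w (t - h)‖ₑ :=
          lintegral_const_mul' _ _ ENNReal.ofReal_ne_top
      _ ≤ ENNReal.ofReal (2 * M) * ENNReal.ofReal (C * h) := mul_le_mul_right (hC h hh) _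
      _ = _ := by rw [← ENNReal.ofReal_mul (by positivity), mul_assoc, mul_assoc, mul_assoc]

theorem integrableOn_rpow_Ioo {γ : ℝ} (h1 : γ < 1) (s : ℝ) :
    IntegrableOn (fun t : ℝ => t ^ (-γ)) (Ioo 0 s) := by
  rcases le_or_gt s 0 with hs | hs
  · simp [Ioo_eq_empty (not_lt.2 hs)]
  · exact (intervalIntegral.integrableOn_Ioo_rpow_iff hs).2 (by linarith)

theorem lintegral_rpow_Ioo_lt_top {γ : ℝ} (h1 : γ < 1) (s : ℝ) :
    ∫⁻ t in Ioo (0 : ℝ) s, ENNReal.ofReal (t ^ (-γ)) < ⊤ :=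
  lt_of_le_of_lt (lintegral_mono fun _ => Real.ofReal_le_enorm _) (integrableOn_rpow_Ioo h1 s).2

variable [NormedSpace ℝ E]

/-- The difference kernel of the Marchaud derivative, on the triangle `0 < h < τ`. -/
def diffKernel (γ : ℝ) (w : ℝ → E) (h τ : ℝ) : E :=
  indicator (Ioo 0 τ) (fun h => h ^ (-1 - γ) • (w τ - w (τ - h))) h

theorem stronglyMeasurable_diffKernel (γ : ℝ) {w : ℝ → E} (hw : StronglyMeasurable w) :
    StronglyMeasurable (Function.uncurry (diffKernel γ w)) := by
  have hm : MeasurableSet {p : ℝ × ℝ | p.1 ∈ Ioo 0 p.2} :=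
    (measurableSet_lt measurable_const measurable_fst).inter
      (measurableSet_lt measurable_fst measurable_snd)
  have h1 : StronglyMeasurable fun p : ℝ × ℝ => p.1 ^ (-1 - γ) • (w p.2 - w (p.2 - p.1)) := by
    refine StronglyMeasurable.smul ?_ ((hw.comp_measurable measurable_snd).sub
      (hw.comp_measurable (measurable_snd.sub measurable_fst)))
    exact (measurable_fst.pow_const _).stronglyMeasurable
  exact h1.indicator hm

/-- Integrating first in `τ`, the bound `C h` on translates turns `h^(-1-γ)` into the integrable
`h^(-γ)`. This is where Lipschitz continuity in mean is needed; the jumps of `w` do no harm. -/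
theorem integrable_diffKernel {γ : ℝ} (h1 : γ < 1) {w : ℝ → E} (hw : LipInMean w) (s : ℝ) :
    Integrable (Function.uncurry (diffKernel γ w))
      ((volume.restrict (Ioo 0 s)).prod (volume.restrict (Ioo 0 s))) := by
  obtain ⟨C, hC⟩ := hw.shift
  refine ⟨(stronglyMeasurable_diffKernel γ hw.sm).aestronglyMeasurable, ?_⟩
  rw [HasFiniteIntegral, lintegral_prod _
    (stronglyMeasurable_diffKernel γ hw.sm).enorm.aemeasurable]
  calc ∫⁻ h in Ioo 0 s, ∫⁻ τ in Ioo 0 s, ‖Function.uncurry (diffKernel γ w) (h, τ)‖ₑ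
      ≤ ∫⁻ h in Ioo 0 s, ENNReal.ofReal C * ENNReal.ofReal (h ^ (-γ)) := by
        refine setLIntegral_mono' measurableSet_Ioo fun h hh => ?_
        have hp : 0 < h := hh.1
        calc ∫⁻ τ in Ioo 0 s, ‖Function.uncurry (diffKernel γ w) (h, τ)‖ₑ
            ≤ ∫⁻ τ, ENNReal.ofReal (h ^ (-1 - γ)) * ‖w τ - w (τ - h)‖ₑ := by
              refine (setLIntegral_le_lintegral _ _).trans (lintegral_mono fun τ => ?_)
              refine (enorm_indicator_le_enorm_self
                (fun h : ℝ => h ^ (-1 - γ) • (w τ - w (τ - h))) h).trans ?_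
              rw [enorm_smul, Real.enorm_of_nonneg (by positivity)]
          _ ≤ ENNReal.ofReal (h ^ (-1 - γ)) * ENNReal.ofReal (C * h) := by
              rw [lintegral_const_mul' _ _ ENNReal.ofReal_ne_top]
              exact mul_le_mul_right (hC h hp) _
          _ = ENNReal.ofReal C * ENNReal.ofReal (h ^ (-γ)) := by
              rw [ENNReal.ofReal_mul' hp.le, mul_left_comm, ← ENNReal.ofReal_mul (by positivity)]
              congr 2
              nth_rw 2 [← Real.rpow_one h]
              rw [← Real.rpow_add hp]
              congr 1
              ring
    _ = ENNReal.ofReal C * ∫⁻ h in Ioo 0 s, ENNReal.ofReal (h ^ (-γ)) :=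
        lintegral_const_mul' _ _ ENNReal.ofReal_ne_top
    _ < ⊤ := ENNReal.mul_lt_top ENNReal.ofReal_lt_top (lintegral_rpow_Ioo_lt_top h1 s)

theorem setIntegral_diffKernel_left (γ : ℝ) (w : ℝ → E) {s τ : ℝ} (hτ : τ ≤ s) :
    ∫ h in Ioo 0 s, diffKernel γ w h τ = ∫ h in Ioo 0 τ, h ^ (-1 - γ) • (w τ - w (τ - h)) := by
  have : ∀ h, diffKernel γ w h τ
    = indicator (Ioo 0 τ) (fun h => h ^ (-1 - γ) • (w τ - w (τ - h))) h := fun _ => rfl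
  simp only [this]
  rw [setIntegral_indicator measurableSet_Ioo,
    inter_eq_self_of_subset_right (Ioo_subset_Ioo_right hτ)]

/-- For fixed `h` the integrals of `w` and of its translate over `(h, s)` overlap, leaving only
windows of length `h` at the two ends of `(0, s)`. -/
theorem setIntegral_diffKernel_right (γ : ℝ) {w : ℝ → E} (hw : LipInMean w) {s h : ℝ}
    (hh : h ∈ Ioo 0 s) :
    ∫ τ in Ioo 0 s, diffKernel γ w h τ = h ^ (-1 - γ) • ∫ x in 0..h, (w (s - x) - w x) := by
  have : ∀ τ, diffKernel γ w h τ
      = indicator (Ioi h) (fun τ => h ^ (-1 - γ) • (w τ - w (τ - h))) τ := by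
    intro τ
    simp only [diffKernel, indicator, mem_Ioo, mem_Ioi, hh.1, true_and]
  simp only [this]
  have hset : Ioo 0 s ∩ Ioi h = Ioo h s := by
    ext x
    simp only [mem_inter_iff, mem_Ioo, mem_Ioi]
    constructor
    · rintro ⟨⟨-, h2⟩, h3⟩
      exact ⟨h3, h2⟩
    · rintro ⟨h2, h3⟩
      exact ⟨⟨hh.1.trans h2, h3⟩, h2⟩
  rw [setIntegral_indicator measurableSet_Ioi, hset, integral_smul, ← integral_Ioc_eq_integral_Ioo,
    ← intervalIntegral.integral_of_le hh.2.le]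
  congr 1
  have hsh : IntervalIntegrable (fun τ => w (τ - h)) volume h s := by
    simpa using (hw.intervalIntegrable (h - h) (s - h)).comp_sub_right h
  have hsr : IntervalIntegrable (fun τ => w (s - τ)) volume 0 h := by
    simpa using (hw.intervalIntegrable (s - 0) (s - h)).comp_sub_left s
  rw [intervalIntegral.integral_sub (hw.intervalIntegrable _ _) hsh,
    intervalIntegral.integral_sub hsr (hw.intervalIntegrable _ _),
    intervalIntegral.integral_comp_sub_right, intervalIntegral.integral_comp_sub_left, sub_self,
    sub_zero]
  rw [sub_eq_sub_iff_add_eq_add, add_comm (∫ x in (s - h)..s, w x),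
    intervalIntegral.integral_add_adjacent_intervals (hw.intervalIntegrable _ _)
      (hw.intervalIntegrable _ _), add_comm,
    intervalIntegral.integral_add_adjacent_intervals (hw.intervalIntegrable _ _)
      (hw.intervalIntegrable _ _)]

theorem LipInMean.integrableOn_rpow_smul {γ : ℝ} (h1 : γ < 1) {w : ℝ → E} (hw : LipInMean w)
    (s : ℝ) : IntegrableOn (fun t : ℝ => t ^ (-γ) • w t) (Ioo 0 s) := by
  obtain ⟨M, hM⟩ := hw.bdd
  exact (integrableOn_rpow_Ioo h1 s).smul_bdd M hw.sm.aestronglyMeasurable (ae_of_all _ hM)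

theorem integrableOn_integral_diff {γ : ℝ} (h1 : γ < 1) {w : ℝ → E} (hw : LipInMean w) (s : ℝ) :
    IntegrableOn (fun τ => ∫ h in Ioo 0 τ, h ^ (-1 - γ) • (w τ - w (τ - h))) (Ioo 0 s) := by
  have := (integrable_diffKernel h1 hw s).integral_prod_right
  refine IntegrableOn.congr_fun this (fun τ hτ => ?_) measurableSet_Ioo
  exact setIntegral_diffKernel_left γ w hτ.2.le

/-- The Marchaud form of the derivative of order `γ`. -/
def marchaud (γ : ℝ) (w : ℝ → E) (t : ℝ) : E :=
  (Real.Gamma (1 - γ))⁻¹ •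
    (t ^ (-γ) • w t + γ • ∫ h in Ioo 0 t, h ^ (-1 - γ) • (w t - w (t - h)))

theorem integrableOn_marchaud {γ : ℝ} (h1 : γ < 1) {w : ℝ → E} (hw : LipInMean w) (s : ℝ) :
    IntegrableOn (marchaud γ w) (Ioo 0 s) :=
  ((hw.integrableOn_rpow_smul h1 s).add ((integrableOn_integral_diff h1 hw s).smul γ)).smul _

variable [CompleteSpace E]

/-- Fubini on the triangle `x < h < s`, with `∫ₓˢ h^(-1-γ) dh = γ⁻¹ (x^(-γ) - s^(-γ))`. -/
theorem integral_rpow_smul_primitive {γ : ℝ} (h0 : 0 < γ) (h1 : γ < 1) {ψ : ℝ → E}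
    (hψ : StronglyMeasurable ψ) {M : ℝ} (hM : ∀ t, ‖ψ t‖ ≤ M) {s : ℝ} (hs : 0 < s) :
    ∫ h in Ioo 0 s, h ^ (-1 - γ) • ∫ x in 0..h, ψ x
      = γ⁻¹ • ((∫ x in Ioo 0 s, x ^ (-γ) • ψ x) - s ^ (-γ) • ∫ x in 0..s, ψ x) := by
  set F : ℝ → ℝ → E := fun h x => indicator (Ioi x) (fun h => h ^ (-1 - γ) • ψ x) h with hF
  have hFm : StronglyMeasurable (Function.uncurry F) := by
    have hm : MeasurableSet {p : ℝ × ℝ | p.1 ∈ Ioi p.2} :=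
      measurableSet_lt measurable_snd measurable_fst
    have : StronglyMeasurable fun p : ℝ × ℝ => p.1 ^ (-1 - γ) • ψ p.2 :=
      StronglyMeasurable.smul (measurable_fst.pow_const _).stronglyMeasurable
        (hψ.comp_measurable measurable_snd)
    exact this.indicator hm
  have hFi : Integrable (Function.uncurry F)
      ((volume.restrict (Ioo 0 s)).prod (volume.restrict (Ioo 0 s))) := by
    refine ⟨hFm.aestronglyMeasurable, ?_⟩
    rw [HasFiniteIntegral, lintegral_prod _ hFm.enorm.aemeasurable]
    calc ∫⁻ h in Ioo 0 s, ∫⁻ x in Ioo 0 s, ‖Function.uncurry F (h, x)‖ₑ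
        ≤ ∫⁻ h in Ioo 0 s, ENNReal.ofReal M * ENNReal.ofReal (h ^ (-γ)) := by
          refine setLIntegral_mono' measurableSet_Ioo fun h hh => ?_
          have hp : 0 < h := hh.1
          calc ∫⁻ x in Ioo 0 s, ‖Function.uncurry F (h, x)‖ₑ
              ≤ ∫⁻ x in Ioo 0 s, indicator (Ioo 0 h)
                  (fun _ => ENNReal.ofReal (h ^ (-1 - γ) * M)) x := by
                refine setLIntegral_mono' measurableSet_Ioo fun x hx => ?_
                by_cases hxh : x < h
                · rw [indicator_of_mem (show x ∈ Ioo 0 h from ⟨hx.1, hxh⟩)]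
                  refine (enorm_indicator_le_enorm_self
                    (fun h : ℝ => h ^ (-1 - γ) • ψ x) h).trans ?_
                  rw [enorm_smul, Real.enorm_of_nonneg (by positivity),
                    ENNReal.ofReal_mul (by positivity), ← ofReal_norm]
                  exact mul_le_mul_right (ENNReal.ofReal_le_ofReal (hM x)) _
                · simp only [hF, Function.uncurry]
                  rw [indicator_of_notMem (show h ∉ Ioi x from hxh)]
                  simp
            _ ≤ ENNReal.ofReal (h ^ (-1 - γ) * M) * ENNReal.ofReal h := by
                refine (setLIntegral_le_lintegral _ _).trans ?_
                rw [lintegral_indicator measurableSet_Ioo, setLIntegral_const, Real.volume_Ioo,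
                  sub_zero]
            _ = ENNReal.ofReal M * ENNReal.ofReal (h ^ (-γ)) := by
                rw [ENNReal.ofReal_mul (by positivity), mul_comm (ENNReal.ofReal (h ^ (-1 - γ))),
                  mul_assoc, ← ENNReal.ofReal_mul (by positivity)]
                congr 2
                nth_rw 2 [← Real.rpow_one h]
                rw [← Real.rpow_add hp]
                congr 1
                ring
      _ = ENNReal.ofReal M * ∫⁻ h in Ioo 0 s, ENNReal.ofReal (h ^ (-γ)) :=
          lintegral_const_mul' _ _ ENNReal.ofReal_ne_top
      _ < ⊤ := ENNReal.mul_lt_top ENNReal.ofReal_lt_top (lintegral_rpow_Ioo_lt_top h1 s)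
  have hψi : IntegrableOn ψ (Ioo 0 s) := Measure.integrableOn_of_bounded
    (by simp) hψ.aestronglyMeasurable (ae_of_all _ hM)
  have e1 : ∫ h in Ioo 0 s, h ^ (-1 - γ) • ∫ x in 0..h, ψ x
      = ∫ h in Ioo 0 s, ∫ x in Ioo 0 s, F h x := by
    refine setIntegral_congr_fun measurableSet_Ioo fun h hh => ?_
    have : ∀ x, F h x = indicator (Iio h) (fun x => h ^ (-1 - γ) • ψ x) x := by
      intro x
      simp only [hF, indicator, mem_Ioi, mem_Iio]
    simp only [this]
    rw [setIntegral_indicator measurableSet_Iio, integral_smul,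
      intervalIntegral.integral_of_le hh.1.le, integral_Ioc_eq_integral_Ioo,
      Ioo_inter_Iio, min_eq_right hh.2.le]
  have e2 : ∀ x ∈ Ioo 0 s, ∫ h in Ioo 0 s, F h x
      = γ⁻¹ • (x ^ (-γ) • ψ x - s ^ (-γ) • ψ x) := by
    intro x hx
    simp only [hF]
    rw [setIntegral_indicator measurableSet_Ioi, Ioo_inter_Ioi, max_eq_right hx.1.le,
      integral_smul_const, ← integral_Ioc_eq_integral_Ioo,
      ← intervalIntegral.integral_of_le hx.2.le, integral_rpow, ← sub_smul, smul_smul]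
    · congr 1
      rw [show -1 - γ + 1 = -γ by ring]
      field_simp
      ring
    · right
      refine ⟨by linarith, ?_⟩
      rw [uIcc_of_le hx.2.le]
      exact fun h => absurd h.1 (not_le.2 hx.1)
  rw [e1, integral_integral_swap hFi, setIntegral_congr_fun measurableSet_Ioo e2, integral_smul,
    integral_sub, integral_smul, intervalIntegral.integral_of_le hs.le,
    integral_Ioc_eq_integral_Ioo]
  · exact (integrableOn_rpow_Ioo h1 s).smul_bdd M hψ.aestronglyMeasurable (ae_of_all _ hM)
  · exact hψi.smul _

/-- Exchanging the order of integration reduces the double integral to the two end windows. It is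
used twice: with `w` itself to identify the derivative, and with `‖w‖²` to compute the energy. -/
theorem integral_integral_diff {γ : ℝ} (h0 : 0 < γ) (h1 : γ < 1) {w : ℝ → E} (hw : LipInMean w)
    {s : ℝ} (hs : 0 < s) :
    ∫ τ in Ioo 0 s, ∫ h in Ioo 0 τ, h ^ (-1 - γ) • (w τ - w (τ - h))
      = γ⁻¹ • ((∫ x in Ioo 0 s, x ^ (-γ) • w (s - x)) - ∫ x in Ioo 0 s, x ^ (-γ) • w x) := by
  obtain ⟨M, hM⟩ := hw.bdd
  have hr : StronglyMeasurable fun x => w (s - x) :=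
    hw.sm.comp_measurable (measurable_const.sub measurable_id)
  rw [setIntegral_congr_fun measurableSet_Ioo
    (fun τ hτ => (setIntegral_diffKernel_left γ w hτ.2.le).symm),
    ← integral_integral_swap (integrable_diffKernel h1 hw s),
    setIntegral_congr_fun measurableSet_Ioo
      (fun h hh => setIntegral_diffKernel_right γ hw hh),
    integral_rpow_smul_primitive (ψ := fun x => w (s - x) - w x) h0 h1 (hr.sub hw.sm) (M := M + M)
      (fun t => (norm_sub_le _ _).trans (add_le_add (hM _) (hM _))) hs]
  congr 1
  -- The boundary term at `h = s` drops out because reflection preserves the integral over `(0, s)`.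
  have hz : ∫ x in 0..s, (w (s - x) - w x) = 0 := by
    have hsr : IntervalIntegrable (fun τ => w (s - τ)) volume 0 s := by
      simpa using (hw.intervalIntegrable (s - 0) (s - s)).comp_sub_left s
    rw [intervalIntegral.integral_sub hsr (hw.intervalIntegrable _ _),
      intervalIntegral.integral_comp_sub_left]
    simp
  rw [hz, smul_zero, sub_zero]
  simp only [smul_sub]
  rw [integral_sub _ (hw.integrableOn_rpow_smul h1 s)]
  exact (integrableOn_rpow_Ioo h1 s).smul_bdd M hr.aestronglyMeasurable
    (ae_of_all _ fun t => hM _)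

/-- The term `t^(-γ) w(t)` cancels the negative part of the double integral; what remains is the
reflected Abel convolution. Hence the Marchaud expression has the fractional integral as its
primitive. -/
theorem integral_marchaud {γ : ℝ} (h0 : 0 < γ) (h1 : γ < 1) {w : ℝ → E} (hw : LipInMean w)
    {s : ℝ} (hs : 0 < s) :
    ∫ t in Ioo 0 s, marchaud γ w t = rlIntegral (1 - γ) w s := by
  simp only [marchaud]
  have hadd := integral_add (hw.integrableOn_rpow_smul h1 s)
    ((integrableOn_integral_diff h1 hw s).smul γ)
  simp only [Pi.smul_apply] at hadd
  rw [integral_smul, hadd, integral_smul,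
    integral_integral_diff h0 h1 hw hs, smul_smul, mul_inv_cancel₀ h0.ne', one_smul,
    add_sub_cancel, rlIntegral]
  congr 1
  rw [← integral_Ioc_eq_integral_Ioo, ← integral_Ioc_eq_integral_Ioo,
    ← intervalIntegral.integral_of_le hs.le, ← intervalIntegral.integral_of_le hs.le]
  have := intervalIntegral.integral_comp_sub_left (a := 0) (b := s)
    (fun x : ℝ => (s - x) ^ (-γ) • w x) s
  simp only [sub_sub_cancel, sub_self, sub_zero] at this
  rw [this]
  congr 1
  ext x
  congr 2
  ring

end Marchaud

/-! ### Coercivity of the Riemann–Liouville derivative -/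

section Coercivity

variable {E : Type*} [NormedAddCommGroup E]

/-- The squared difference kernel, on the triangle `0 < h < τ`. -/
def sqKernel (γ : ℝ) (w : ℝ → E) (h τ : ℝ) : ℝ :=
  indicator (Ioo 0 τ) (fun h => h ^ (-1 - γ) * ‖w τ - w (τ - h)‖ ^ 2) h

theorem sqKernel_nonneg (γ : ℝ) (w : ℝ → E) (h τ : ℝ) : 0 ≤ sqKernel γ w h τ := by
  refine indicator_nonneg (fun h hh => ?_) h
  exact mul_nonneg (Real.rpow_nonneg hh.1.le _) (sq_nonneg _)

theorem integral_sqKernel_left (γ : ℝ) (w : ℝ → E) {s τ : ℝ} (hτ : τ ≤ s) :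
    ∫ h in Ioo 0 s, sqKernel γ w h τ
      = ∫ h in Ioo 0 τ, h ^ (-1 - γ) * ‖w τ - w (τ - h)‖ ^ 2 := by
  have : ∀ h, sqKernel γ w h τ
    = indicator (Ioo 0 τ) (fun h => h ^ (-1 - γ) * ‖w τ - w (τ - h)‖ ^ 2) h := fun _ => rfl
  simp only [this]
  rw [setIntegral_indicator measurableSet_Ioo,
    inter_eq_self_of_subset_right (Ioo_subset_Ioo_right hτ)]

variable [InnerProductSpace ℝ E]

theorem integrable_sqKernel {γ : ℝ} (h1 : γ < 1) {w : ℝ → E} (hw : LipInMean w) (s : ℝ) :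
    Integrable (Function.uncurry (sqKernel γ w))
      ((volume.restrict (Ioo 0 s)).prod (volume.restrict (Ioo 0 s))) := by
  obtain ⟨M, hM⟩ := hw.bdd
  have hm : MeasurableSet {p : ℝ × ℝ | p.1 ∈ Ioo 0 p.2} :=
    (measurableSet_lt measurable_const measurable_fst).inter
      (measurableSet_lt measurable_fst measurable_snd)
  refine ((integrable_diffKernel h1 hw s).norm.const_mul (2 * M)).mono' ?_ (ae_of_all _ ?_)
  · have h1 : StronglyMeasurable fun p : ℝ × ℝ =>
        p.1 ^ (-1 - γ) * ‖w p.2 - w (p.2 - p.1)‖ ^ 2 := by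
      refine StronglyMeasurable.mul ?_ ((((hw.sm.comp_measurable measurable_snd).sub
        (hw.sm.comp_measurable (measurable_snd.sub measurable_fst))).norm).pow 2)
      exact (measurable_fst.pow_const _).stronglyMeasurable
    exact (h1.indicator hm).aestronglyMeasurable
  · rintro ⟨h, τ⟩
    simp only [Function.uncurry, diffKernel, sqKernel]
    by_cases hh : h ∈ Ioo 0 τ
    · rw [indicator_of_mem hh, indicator_of_mem hh, norm_smul, norm_mul, norm_pow, norm_norm]
      have h2 : ‖w τ - w (τ - h)‖ ≤ 2 * M :=
        (norm_sub_le _ _).trans (by linarith [hM τ, hM (τ - h)])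
      calc ‖h ^ (-1 - γ)‖ * ‖w τ - w (τ - h)‖ ^ 2
          = ‖w τ - w (τ - h)‖ * (‖h ^ (-1 - γ)‖ * ‖w τ - w (τ - h)‖) := by ring
        _ ≤ 2 * M * (‖h ^ (-1 - γ)‖ * ‖w τ - w (τ - h)‖) :=
          mul_le_mul_of_nonneg_right h2 (by positivity)
    · rw [indicator_of_notMem hh, indicator_of_notMem hh]
      simp

theorem integrableOn_diff_of_diffKernel {F : Type*} [NormedAddCommGroup F] [NormedSpace ℝ F]
    {γ : ℝ} {w : ℝ → F} {s τ : ℝ} (hτ : τ ≤ s)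
    (h : Integrable (fun h => diffKernel γ w h τ) (volume.restrict (Ioo 0 s))) :
    IntegrableOn (fun h => h ^ (-1 - γ) • (w τ - w (τ - h))) (Ioo 0 τ) := by
  have h2 : IntegrableOn (fun h => diffKernel γ w h τ) (Ioo 0 τ) :=
    IntegrableOn.mono_set h (Ioo_subset_Ioo_right hτ)
  refine h2.congr_fun (fun x hx => ?_) measurableSet_Ioo
  exact indicator_of_mem hx _

/-- Polarization inside the integral, `2⟨x - y, x⟩ = |x|² - |y|² + |x - y|²` with `x = w τ` and `y =
w (τ - h)`. It holds for those `τ` at which the three kernels are integrable in `h`. -/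
theorem LipInMean.marchaud_inner_ae {γ : ℝ} (h1 : γ < 1) {w : ℝ → E}
    (hw : LipInMean w) [CompleteSpace E] (s : ℝ) :
    ∀ᵐ τ ∂volume.restrict (Ioo 0 s), Real.Gamma (1 - γ) * inner ℝ (marchaud γ w τ) (w τ)
      = τ ^ (-γ) * ‖w τ‖ ^ 2
        + γ / 2 * (∫ h in Ioo 0 τ, h ^ (-1 - γ) • (‖w τ‖ ^ 2 - ‖w (τ - h)‖ ^ 2))
        + γ / 2 * ∫ h in Ioo 0 s, sqKernel γ w h τ := by
  have hΓ : Real.Gamma (1 - γ) ≠ 0 := (Real.Gamma_pos_of_pos (by linarith)).ne'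
  filter_upwards [(integrable_diffKernel h1 hw s).prod_left_ae,
    (integrable_diffKernel h1 hw.norm_sq s).prod_left_ae,
    (integrable_sqKernel h1 hw s).prod_left_ae, ae_restrict_mem measurableSet_Ioo]
    with τ k1 k2 k3 hτ
  have i1 := integrableOn_diff_of_diffKernel (w := w) hτ.2.le k1
  have i2 := integrableOn_diff_of_diffKernel (w := fun t => ‖w t‖ ^ 2) hτ.2.le k2
  have i3 : IntegrableOn (fun h => h ^ (-1 - γ) * ‖w τ - w (τ - h)‖ ^ 2) (Ioo 0 τ) := by
    have h2 : IntegrableOn (fun h => sqKernel γ w h τ) (Ioo 0 τ) :=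
      IntegrableOn.mono_set k3 (Ioo_subset_Ioo_right hτ.2.le)
    exact h2.congr_fun (fun x hx => indicator_of_mem hx _) measurableSet_Ioo
  have hin : inner ℝ (∫ h in Ioo 0 τ, h ^ (-1 - γ) • (w τ - w (τ - h))) (w τ)
      = ∫ h in Ioo 0 τ, inner ℝ (w τ) (h ^ (-1 - γ) • (w τ - w (τ - h))) := by
    rw [real_inner_comm, integral_inner i1]
  rw [integral_sqKernel_left γ w hτ.2.le, marchaud, real_inner_smul_left, ← mul_assoc,
    mul_inv_cancel₀ hΓ, one_mul, inner_add_left, real_inner_smul_left, real_inner_smul_left,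
    real_inner_self_eq_norm_sq, hin, add_assoc, ← mul_add,
    ← integral_add i2 i3, div_eq_mul_inv, mul_assoc γ, ← integral_const_mul,
    ← integral_const_mul, ← integral_const_mul]
  congr 1
  refine integral_congr_ae (ae_of_all _ fun h => ?_)
  simp only [smul_eq_mul, inner_smul_right]
  rw [norm_sub_sq_real, inner_sub_right, real_inner_self_eq_norm_sq]
  ring

/-- The sign-indefinite middle term is evaluated by `integral_integral_diff` for `‖w‖²`: it removes
half of the weighted integral and adds half of the reflected one. All remaining terms are
nonnegative. -/
theorem integral_marchaud_inner {γ : ℝ} (h0 : 0 < γ) (h1 : γ < 1) [CompleteSpace E] {w : ℝ → E}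
    (hw : LipInMean w) {s : ℝ} (hs : 0 < s) :
    IntegrableOn (fun t => inner ℝ (marchaud γ w t) (w t)) (Ioo 0 s) ∧
    Real.Gamma (1 - γ) * ∫ t in Ioo 0 s, inner ℝ (marchaud γ w t) (w t)
      = 2⁻¹ * (∫ t in Ioo 0 s, t ^ (-γ) * ‖w t‖ ^ 2)
        + 2⁻¹ * (∫ t in Ioo 0 s, t ^ (-γ) * ‖w (s - t)‖ ^ 2)
        + γ / 2 * ∫ τ in Ioo 0 s, ∫ h in Ioo 0 s, sqKernel γ w h τ := by
  have hΓ : Real.Gamma (1 - γ) ≠ 0 := (Real.Gamma_pos_of_pos (by linarith)).ne'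
  have key := hw.marchaud_inner_ae h1 s
  have j1 : IntegrableOn (fun t => t ^ (-γ) * ‖w t‖ ^ 2) (Ioo 0 s) :=
    hw.norm_sq.integrableOn_rpow_smul h1 s
  have j2 := (integrableOn_integral_diff h1 hw.norm_sq s).const_mul (γ / 2)
  have j3 := (integrable_sqKernel h1 hw s).integral_prod_right.const_mul (γ / 2)
  constructor
  · have : Integrable (fun τ => Real.Gamma (1 - γ) * inner ℝ (marchaud γ w τ) (w τ))
        (volume.restrict (Ioo 0 s)) := ((j1.add j2).add j3).congr (EventuallyEq.symm key)
    have := this.const_mul (Real.Gamma (1 - γ))⁻¹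
    simp only [← mul_assoc, inv_mul_cancel₀ hΓ, one_mul] at this
    exact this
  · rw [← integral_const_mul, integral_congr_ae key]
    have a1 := integral_add (j1.add j2) j3
    have a2 := integral_add j1 j2
    simp only [Pi.add_apply] at a1
    simp only [Function.uncurry] at a1
    rw [a1, a2, integral_const_mul, integral_const_mul,
      integral_integral_diff h0 h1 hw.norm_sq hs]
    simp only [smul_eq_mul]
    field_simp
    ring

theorem integral_marchaud_inner_nonneg {γ : ℝ} (h0 : 0 < γ) (h1 : γ < 1) [CompleteSpace E]
    {w : ℝ → E} (hw : LipInMean w) {s : ℝ} (hs : 0 < s) :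
    0 ≤ ∫ t in Ioo 0 s, inner ℝ (marchaud γ w t) (w t) := by
  have hΓ : 0 < Real.Gamma (1 - γ) := Real.Gamma_pos_of_pos (by linarith)
  refine nonneg_of_mul_nonneg_right ?_ hΓ
  rw [(integral_marchaud_inner h0 h1 hw hs).2]
  have p1 : 0 ≤ ∫ t in Ioo 0 s, t ^ (-γ) * ‖w t‖ ^ 2 := setIntegral_nonneg measurableSet_Ioo
    fun t ht => mul_nonneg (Real.rpow_nonneg ht.1.le _) (sq_nonneg _)
  have p2 : 0 ≤ ∫ t in Ioo 0 s, t ^ (-γ) * ‖w (s - t)‖ ^ 2 :=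
    setIntegral_nonneg measurableSet_Ioo
      fun t ht => mul_nonneg (Real.rpow_nonneg ht.1.le _) (sq_nonneg _)
  have p3 : 0 ≤ ∫ τ in Ioo 0 s, ∫ h in Ioo 0 s, sqKernel γ w h τ :=
    integral_nonneg fun _ => integral_nonneg fun _ => sqKernel_nonneg _ _ _ _
  positivity

theorem integral_rpow_mul_norm_sq_le {γ : ℝ} (h0 : 0 < γ) (h1 : γ < 1) [CompleteSpace E]
    {w : ℝ → E} (hw : LipInMean w) {s : ℝ} (hs : 0 < s) :
    ∫ t in Ioo 0 s, t ^ (-γ) * ‖w t‖ ^ 2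
      ≤ 2 * Real.Gamma (1 - γ) * ∫ t in Ioo 0 s, inner ℝ (marchaud γ w t) (w t) := by
  rw [mul_assoc, (integral_marchaud_inner h0 h1 hw hs).2]
  have p2 : 0 ≤ ∫ t in Ioo 0 s, t ^ (-γ) * ‖w (s - t)‖ ^ 2 :=
    setIntegral_nonneg measurableSet_Ioo
      fun t ht => mul_nonneg (Real.rpow_nonneg ht.1.le _) (sq_nonneg _)
  have p3 : 0 ≤ ∫ τ in Ioo 0 s, ∫ h in Ioo 0 s, sqKernel γ w h τ :=
    integral_nonneg fun _ => integral_nonneg fun _ => sqKernel_nonneg _ _ _ _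
  nlinarith [mul_nonneg h0.le p3]

theorem lintegral_rpow_mul_norm_sq_le {γ : ℝ} (h0 : 0 < γ) (h1 : γ < 1) [CompleteSpace E]
    {w : ℝ → E} (hw : LipInMean w) {s : ℝ} (hs : 0 < s) :
    ∫⁻ t in Ioo 0 s, ENNReal.ofReal (t ^ (-γ)) * ‖w t‖ₑ ^ 2
      ≤ ENNReal.ofReal
        (2 * Real.Gamma (1 - γ) * ∫ t in Ioo 0 s, inner ℝ (marchaud γ w t) (w t)) := by
  refine le_trans (le_of_eq ?_)
    (ENNReal.ofReal_le_ofReal (integral_rpow_mul_norm_sq_le h0 h1 hw hs))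
  rw [ofReal_integral_eq_lintegral_ofReal]
  · refine setLIntegral_congr_fun measurableSet_Ioo fun t ht => ?_
    rw [ENNReal.ofReal_mul (Real.rpow_nonneg ht.1.le _), ENNReal.ofReal_pow (norm_nonneg _),
      ofReal_norm]
  · exact hw.norm_sq.integrableOn_rpow_smul h1 s
  · refine (ae_restrict_iff' measurableSet_Ioo).2 (ae_of_all _ fun t ht => ?_)
    exact mul_nonneg (Real.rpow_nonneg ht.1.le _) (sq_nonneg _)

theorem lintegral_sqKernel_le {γ : ℝ} (h0 : 0 < γ) (h1 : γ < 1) [CompleteSpace E]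
    {w : ℝ → E} (hw : LipInMean w) {s : ℝ} (hs : 0 < s) :
    ∫⁻ τ in Ioo 0 s, ∫⁻ h in Ioo 0 s, ENNReal.ofReal (sqKernel γ w h τ)
      ≤ ENNReal.ofReal
        (2 / γ * Real.Gamma (1 - γ) * ∫ t in Ioo 0 s, inner ℝ (marchaud γ w t) (w t)) := by
  have hle : ∫ τ in Ioo 0 s, ∫ h in Ioo 0 s, sqKernel γ w h τ
      ≤ 2 / γ * Real.Gamma (1 - γ) * ∫ t in Ioo 0 s, inner ℝ (marchaud γ w t) (w t) := by
    rw [mul_assoc, (integral_marchaud_inner h0 h1 hw hs).2]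
    have p1 : 0 ≤ ∫ t in Ioo 0 s, t ^ (-γ) * ‖w t‖ ^ 2 := setIntegral_nonneg measurableSet_Ioo
      fun t ht => mul_nonneg (Real.rpow_nonneg ht.1.le _) (sq_nonneg _)
    have p2 : 0 ≤ ∫ t in Ioo 0 s, t ^ (-γ) * ‖w (s - t)‖ ^ 2 :=
      setIntegral_nonneg measurableSet_Ioo
        fun t ht => mul_nonneg (Real.rpow_nonneg ht.1.le _) (sq_nonneg _)
    rw [mul_add, ← mul_assoc (2 / γ) (γ / 2), show 2 / γ * (γ / 2) = 1 by field_simp, one_mul]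
    have : 0 ≤ 2 / γ * (2⁻¹ * (∫ t in Ioo 0 s, t ^ (-γ) * ‖w t‖ ^ 2)
        + 2⁻¹ * ∫ t in Ioo 0 s, t ^ (-γ) * ‖w (s - t)‖ ^ 2) := by positivity
    linarith
  refine le_trans (le_of_eq ?_) (ENNReal.ofReal_le_ofReal hle)
  have hi := integrable_sqKernel h1 hw s
  have hir : Integrable (fun τ => ∫ h in Ioo 0 s, sqKernel γ w h τ)
      (volume.restrict (Ioo 0 s)) := hi.integral_prod_right
  rw [ofReal_integral_eq_lintegral_ofReal hir
    (ae_of_all _ fun _ => integral_nonneg fun _ => sqKernel_nonneg _ _ _ _)]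
  refine lintegral_congr_ae ?_
  filter_upwards [hi.prod_left_ae] with τ hτ
  exact (ofReal_integral_eq_lintegral_ofReal hτ
    (ae_of_all _ fun _ => sqKernel_nonneg _ _ _ _)).symm

end Coercivity

/-! ### Control of the Gagliardo energy on the whole line and of the Fourier seminorm -/

section GagliardoCoercivity

theorem lintegral_Ici_rpow {γ : ℝ} (h0 : 0 < γ) {t : ℝ} (ht : 0 < t) :
    ∫⁻ h in Ici t, ENNReal.ofReal (h ^ (-1 - γ)) = ENNReal.ofReal (γ⁻¹ * t ^ (-γ)) := by
  rw [setLIntegral_congr Ioi_ae_eq_Ici.symm, ← ofReal_integral_eq_lintegral_ofReal,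
    integral_Ioi_rpow_of_lt (by linarith) ht]
  · congr 1
    rw [show -1 - γ + 1 = -γ by ring]
    field_simp
  · exact integrableOn_Ioi_rpow_of_lt (by linarith) ht
  · refine (ae_restrict_iff' measurableSet_Ioi).2 (ae_of_all _ fun h hh => ?_)
    exact Real.rpow_nonneg (ht.trans hh).le _

/-- The squared Gagliardo seminorm of order `γ / 2`, as an integral over translates. -/
def translateEnergy {X : Type*} [NormedAddCommGroup X] (γ : ℝ) (w : ℝ → X) : ℝ≥0∞ :=
  ∫⁻ h in Ioi (0 : ℝ), ENNReal.ofReal (h ^ (-1 - γ)) * ∫⁻ t, ‖w t - w (t - h)‖ₑ ^ 2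

theorem measurable_translate_sq {X : Type*} [NormedAddCommGroup X] {w : ℝ → X}
    (hw : StronglyMeasurable w) : Measurable fun p : ℝ × ℝ => ‖w p.2 - w (p.2 - p.1)‖ₑ ^ 2 :=
  (((hw.comp_measurable measurable_snd).sub
      (hw.comp_measurable (measurable_snd.sub measurable_fst))).enorm).pow_const 2

theorem measurable_rpow_translate_sq {X : Type*} [NormedAddCommGroup X] (γ : ℝ) {w : ℝ → X}
    (hw : StronglyMeasurable w) : Measurable fun p : ℝ × ℝ =>
      ENNReal.ofReal (p.1 ^ (-1 - γ)) * ‖w p.2 - w (p.2 - p.1)‖ₑ ^ 2 :=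
  (measurable_fst.pow_const _).ennreal_ofReal.mul (measurable_translate_sq hw)

variable {E : Type*} [NormedAddCommGroup E] [InnerProductSpace ℝ E] [CompleteSpace E]

/-- Differences with `t ≥ s` and `t - h < s` still count although `w t = 0`. They are captured by
the coercivity identity on `(0, s + n)`: its left-hand side does not depend on `n`, since `w`
vanishes beyond `s`, and monotone convergence lets `n` tend to infinity. -/
theorem lintegral_triangle_le {γ : ℝ} (h0 : 0 < γ) (h1 : γ < 1)
    {w : ℝ → E} (hw : LipInMean w) {s : ℝ} (hs : 0 < s) (hsupp : ∀ t, t ∉ Ioo 0 s → w t = 0) :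
    ∫⁻ t in Ioi (0 : ℝ), ∫⁻ h in Ioo 0 t,
        ENNReal.ofReal (h ^ (-1 - γ)) * ‖w t - w (t - h)‖ₑ ^ 2
      ≤ ENNReal.ofReal
        (2 / γ * Real.Gamma (1 - γ) * ∫ t in Ioo 0 s, inner ℝ (marchaud γ w t) (w t)) := by
  have hU : Ioi (0 : ℝ) = ⋃ n : ℕ, Ioo 0 (s + n) := by
    ext t
    simp only [mem_Ioi, mem_iUnion, mem_Ioo]
    constructor
    · intro ht
      obtain ⟨n, hn⟩ := exists_nat_gt t
      exact ⟨n, ht, by linarith⟩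
    · rintro ⟨n, hn, -⟩
      exact hn
  have hdir : Directed (· ⊆ ·) fun n : ℕ => Ioo (0 : ℝ) (s + n) := by
    apply Monotone.directed_le
    intro m n hmn
    have : (m : ℝ) ≤ n := by exact_mod_cast hmn
    exact Ioo_subset_Ioo_right (by linarith)
  rw [hU, setLIntegral_iUnion_of_directed _ hdir]
  refine iSup_le fun n => ?_
  have hn : 0 < s + n := by positivity
  have hint : ∫ t in Ioo 0 (s + n), inner ℝ (marchaud γ w t) (w t)
      = ∫ t in Ioo 0 s, inner ℝ (marchaud γ w t) (w t) := by
    refine (setIntegral_eq_of_subset_of_forall_sdiff_eq_zero measurableSet_Ioo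
      (Ioo_subset_Ioo_right (by simp)) fun t ht => ?_)
    rw [hsupp t ht.2, inner_zero_right]
  rw [← hint]
  refine le_trans ?_ (lintegral_sqKernel_le h0 h1 hw hn)
  refine setLIntegral_mono' measurableSet_Ioo fun t ht => ?_
  refine le_trans (le_of_eq ?_) (lintegral_mono_set (Ioo_subset_Ioo_right ht.2.le))
  refine setLIntegral_congr_fun measurableSet_Ioo fun h hh => ?_
  simp only [sqKernel]
  rw [indicator_of_mem hh, ENNReal.ofReal_mul (Real.rpow_nonneg hh.1.le _),
    ENNReal.ofReal_pow (norm_nonneg _), ofReal_norm]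

/-- The `h`-integral is split at `h = t`. Below, it is the triangle already bounded; above, `w (t -
h) = 0` and the tail integral yields `γ⁻¹ t^(-γ) ‖w t‖²`, bounded by the weighted coercivity. Each
half contributes `2 / γ`. -/
theorem translateEnergy_le {γ : ℝ} (h0 : 0 < γ) (h1 : γ < 1)
    {w : ℝ → E} (hw : LipInMean w) {s : ℝ} (hs : 0 < s) (hsupp : ∀ t, t ∉ Ioo 0 s → w t = 0) :
    translateEnergy γ w ≤ ENNReal.ofReal
        (4 / γ * Real.Gamma (1 - γ) * ∫ t in Ioo 0 s, inner ℝ (marchaud γ w t) (w t)) := by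
  have hΓ : 0 < Real.Gamma (1 - γ) := Real.Gamma_pos_of_pos (by linarith)
  have hn := integral_marchaud_inner_nonneg h0 h1 hw hs
  have hm := measurable_rpow_translate_sq γ hw.sm
  have e1 : translateEnergy γ w = ∫⁻ t, ∫⁻ h in Ioi (0 : ℝ),
      ENNReal.ofReal (h ^ (-1 - γ)) * ‖w t - w (t - h)‖ₑ ^ 2 := by
    rw [translateEnergy, lintegral_lintegral_swap
      (f := fun t h => ENNReal.ofReal (h ^ (-1 - γ)) * ‖w t - w (t - h)‖ₑ ^ 2)
      (hm.comp measurable_swap).aemeasurable]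
    simp only [lintegral_const_mul' _ _ ENNReal.ofReal_ne_top]
  have e2 : ∀ t, ∫⁻ h in Ioi (0 : ℝ), ENNReal.ofReal (h ^ (-1 - γ)) * ‖w t - w (t - h)‖ₑ ^ 2
      ≤ indicator (Ioi 0) (fun t => ∫⁻ h in Ioo 0 t,
          ENNReal.ofReal (h ^ (-1 - γ)) * ‖w t - w (t - h)‖ₑ ^ 2) t
        + indicator (Ioo 0 s) (fun t => ENNReal.ofReal γ⁻¹ *
          (ENNReal.ofReal (t ^ (-γ)) * ‖w t‖ₑ ^ 2)) t := by
    intro t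
    rcases le_or_gt t 0 with ht | ht
    · have hz : ∀ h ∈ Ioi (0 : ℝ),
          ENNReal.ofReal (h ^ (-1 - γ)) * ‖w t - w (t - h)‖ₑ ^ 2 = 0 := by
        intro h hh
        rw [hsupp t (fun h => absurd h.1 (not_lt.2 ht)),
          hsupp (t - h) (fun h2 => by linarith [h2.1, mem_Ioi.1 hh])]
        simp
      rw [setLIntegral_congr_fun measurableSet_Ioi hz]
      simp
    · rw [indicator_of_mem (mem_Ioi.2 ht), ← Ioo_union_Ici_eq_Ioi ht]
      refine (lintegral_union_le _ _ _).trans (add_le_add le_rfl ?_)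
      have hz : ∀ h ∈ Ici t, ENNReal.ofReal (h ^ (-1 - γ)) * ‖w t - w (t - h)‖ₑ ^ 2
          = ENNReal.ofReal (h ^ (-1 - γ)) * ‖w t‖ₑ ^ 2 := by
        intro h hh
        rw [hsupp (t - h) (fun h2 => by linarith [h2.1, mem_Ici.1 hh]), sub_zero]
      rw [setLIntegral_congr_fun measurableSet_Ici hz,
        lintegral_mul_const' _ _ (by simp), lintegral_Ici_rpow h0 ht,
        ENNReal.ofReal_mul (by positivity), mul_assoc]
      by_cases hts : t ∈ Ioo 0 s
      · rw [indicator_of_mem hts]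
      · rw [indicator_of_notMem hts, hsupp t hts]
        simp
  rw [e1]
  have hm2 : Measurable fun t => indicator (Ioo 0 s) (fun t => ENNReal.ofReal γ⁻¹ *
          (ENNReal.ofReal (t ^ (-γ)) * ‖w t‖ₑ ^ 2)) t := by
    refine Measurable.indicator ?_ measurableSet_Ioo
    exact (((measurable_id.pow_const _).ennreal_ofReal).mul (hw.sm.enorm.pow_const 2)).const_mul _
  refine (lintegral_mono e2).trans ?_
  rw [lintegral_add_right _ hm2, lintegral_indicator measurableSet_Ioi,
    lintegral_indicator measurableSet_Ioo, lintegral_const_mul' _ _ ENNReal.ofReal_ne_top]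
  refine (add_le_add (lintegral_triangle_le h0 h1 hw hs hsupp)
    (mul_le_mul_right (lintegral_rpow_mul_norm_sq_le h0 h1 hw hs) _)).trans (le_of_eq ?_)
  rw [← ENNReal.ofReal_mul (by positivity), ← ENNReal.ofReal_add (by positivity) (by positivity)]
  congr 1
  field_simp
  ring

variable {X : Type*} [NormedAddCommGroup X] [InnerProductSpace ℝ X]

theorem tsum_enorm_inner_sq {ι : Type} (e : HilbertBasis ι ℝ X) (x : X) :
    ∑' j, ‖inner ℝ x (e j)‖ₑ ^ 2 = ‖x‖ₑ ^ 2 := by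
  have h := e.hasSum_inner_mul_inner x x
  have h2 : ∀ j, inner ℝ x (e j) * inner ℝ (e j) x = inner ℝ x (e j) ^ 2 := by
    intro j
    rw [real_inner_comm, sq]
  simp only [h2] at h
  rw [← ofReal_norm, ← ENNReal.ofReal_pow (norm_nonneg _), ← real_inner_self_eq_norm_sq,
    ← h.tsum_eq, ENNReal.ofReal_tsum_of_nonneg (fun _ => sq_nonneg _) h.summable]
  refine tsum_congr fun j => ?_
  rw [← ofReal_norm, ← ENNReal.ofReal_pow (norm_nonneg _), Real.norm_eq_abs, sq_abs]

/-- The energy may be computed from a bounded measurable representative: translates of null sets are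
null. -/
theorem scalarSeminorm_sq_le_of_ae {γ : ℝ} (h0 : 0 < γ) {s : ℝ} {v w : ℝ → ℝ}
    (hw : StronglyMeasurable w) {M : ℝ} (hM : ∀ t, ‖w t‖ ≤ M)
    (hvw : indicator (Ioo 0 s) v =ᵐ[volume] w) :
    scalarSeminorm (γ / 2) s v ^ 2
      ≤ ENNReal.ofReal ((2 * Real.pi) ^ γ) * translateEnergy γ w := by
  have hon : MemLp w ⊤ (volume.restrict (Ioo 0 s)) :=
    memLp_top_of_bound hw.aestronglyMeasurable M (ae_of_all _ hM)
  have hLp : ∀ p : ℝ≥0∞, MemLp (indicator (Ioo 0 s) v) p := by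
    intro p
    refine ((memLp_indicator_iff_restrict measurableSet_Ioo).2
      (hon.mono_exponent (p := p) le_top)).ae_eq ?_
    filter_upwards [hvw] with t ht
    by_cases hts : t ∈ Ioo 0 s
    · rw [indicator_of_mem hts, ← ht]
    · rw [indicator_of_notMem hts, indicator_of_notMem hts]
  refine (scalarSeminorm_sq_le h0 s (memLp_one_iff_integrable.1 (hLp 1)) (hLp 2)).trans
    (mul_le_mul_right (le_of_eq ?_) _)
  refine lintegral_congr fun h => ?_
  congr 1
  refine lintegral_congr_ae ?_
  filter_upwards [hvw, (measurePreserving_sub_right volume h).quasiMeasurePreserving.ae hvw]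
    with t h1 h2
  rw [h1, h2]

/-- Parseval applied to each difference, with countability used to exchange sum and integrals. It
removes any dependence of the final bound on the basis. -/
theorem tsum_translateEnergy_inner (γ : ℝ) {ι : Type} [Countable ι] (e : HilbertBasis ι ℝ X)
    {w : ℝ → X} (hw : StronglyMeasurable w) :
    ∑' j, translateEnergy γ (fun t => inner ℝ (w t) (e j)) = translateEnergy γ w := by
  have hmj : ∀ j, Measurable fun p : ℝ × ℝ =>
      ‖inner ℝ (w p.2) (e j) - inner ℝ (w (p.2 - p.1)) (e j)‖ₑ ^ 2 :=
    fun j => measurable_translate_sq (w := fun t => inner ℝ (w t) (e j))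
      (hw.inner stronglyMeasurable_const)
  simp only [translateEnergy]
  rw [← lintegral_tsum]
  · refine lintegral_congr fun h => ?_
    rw [ENNReal.tsum_mul_left, ← lintegral_tsum]
    · congr 1
      refine lintegral_congr fun t => ?_
      simp only [← inner_sub_left]
      exact tsum_enorm_inner_sq e _
    · exact fun j => ((hmj j).comp measurable_prodMk_left).aemeasurable
  · intro j
    exact ((measurable_id.pow_const _).ennreal_ofReal.mul
      (hmj j).lintegral_prod_right').aemeasurable

theorem fracSeminorm_sq_le {γ : ℝ} (h0 : 0 < γ) {ι : Type} [Countable ι]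
    (e : HilbertBasis ι ℝ X) {s : ℝ} {v w : ℝ → X} (hw : StronglyMeasurable w)
    {M : ℝ} (hM : ∀ t, ‖w t‖ ≤ M) (hvw : indicator (Ioo 0 s) v =ᵐ[volume] w) :
    fracSeminorm e (γ / 2) s v ^ 2
      ≤ ENNReal.ofReal ((2 * Real.pi) ^ γ) * translateEnergy γ w := by
  have hsc : ∀ j, scalarSeminorm (γ / 2) s (fun t => inner ℝ (v t) (e j)) ^ 2
      ≤ ENNReal.ofReal ((2 * Real.pi) ^ γ) * translateEnergy γ fun t => inner ℝ (w t) (e j) := by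
    intro j
    refine scalarSeminorm_sq_le_of_ae h0 (M := M) (hw.inner stronglyMeasurable_const)
      (fun t => (norm_inner_le_norm _ _).trans (by rw [e.orthonormal.1 j, mul_one]; exact hM t)) ?_
    filter_upwards [hvw] with t ht
    rw [← ht]
    by_cases hts : t ∈ Ioo 0 s
    · rw [indicator_of_mem hts, indicator_of_mem hts]
    · rw [indicator_of_notMem hts, indicator_of_notMem hts, inner_zero_left]
  have hsq : fracSeminorm e (γ / 2) s v ^ 2
      = ∑' j, scalarSeminorm (γ / 2) s (fun t => inner ℝ (v t) (e j)) ^ 2 := by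
    rw [fracSeminorm, ← ENNReal.rpow_natCast, ← ENNReal.rpow_mul]
    norm_num
  rw [hsq, ← tsum_translateEnergy_inner γ e hw, ← ENNReal.tsum_mul_left]
  exact ENNReal.tsum_le_tsum hsc

end GagliardoCoercivity

/-! ### Weak derivatives in time -/

section WeakDeriv

variable {E : Type*} [NormedAddCommGroup E] [NormedSpace ℝ E]

theorem IsTest.continuous {a b : ℝ} {φ : ℝ → ℝ} (hφ : IsTest a b φ) : Continuous φ :=
  hφ.smooth.continuous

theorem IsTest.continuous_deriv {a b : ℝ} {φ : ℝ → ℝ} (hφ : IsTest a b φ) :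
    Continuous (deriv φ) :=
  hφ.smooth.continuous_deriv (by simp)

theorem IsTest.eq_zero {a b : ℝ} {φ : ℝ → ℝ} (hφ : IsTest a b φ) {t : ℝ} (ht : t ∉ Ioo a b) :
    φ t = 0 := by
  by_contra h
  exact ht (hφ.supp (subset_tsupport φ h))

theorem IsTest.exists_bound {a b : ℝ} {φ : ℝ → ℝ} (hφ : IsTest a b φ) : ∃ C, ∀ t, ‖φ t‖ ≤ C :=
  hφ.compact.exists_bound_of_continuous hφ.continuous

theorem IsTest.exists_bound_deriv {a b : ℝ} {φ : ℝ → ℝ} (hφ : IsTest a b φ) :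
    ∃ C, ∀ t, ‖deriv φ t‖ ≤ C :=
  hφ.compact.deriv.exists_bound_of_continuous hφ.continuous_deriv

theorem IsTest.integrableOn_smul {a b : ℝ} {φ : ℝ → ℝ} (hφ : IsTest a b φ) {g : ℝ → E} {s : Set ℝ}
    (hg : IntegrableOn g s) : IntegrableOn (fun t => φ t • g t) s := by
  obtain ⟨C, hC⟩ := hφ.exists_bound
  exact Integrable.bdd_smul hg C hφ.continuous.aestronglyMeasurable (ae_of_all _ hC)

theorem IsTest.integrableOn_deriv_smul {a b : ℝ} {φ : ℝ → ℝ} (hφ : IsTest a b φ) {g : ℝ → E}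
    {s : Set ℝ} (hg : IntegrableOn g s) : IntegrableOn (fun t => deriv φ t • g t) s := by
  obtain ⟨C, hC⟩ := hφ.exists_bound_deriv
  exact Integrable.bdd_smul hg C hφ.continuous_deriv.aestronglyMeasurable (ae_of_all _ hC)

theorem IsWeakDeriv.add {T : ℝ} {w w' g g' : ℝ → E} (h : IsWeakDeriv T w g)
    (h' : IsWeakDeriv T w' g') : IsWeakDeriv T (fun t => w t + w' t) (fun t => g t + g' t) := by
  refine ⟨h.1.add h'.1, h.2.1.add h'.2.1, fun φ hφ => ?_⟩
  simp only [smul_add]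
  rw [integral_add (hφ.integrableOn_deriv_smul h.1) (hφ.integrableOn_deriv_smul h'.1),
    integral_add (hφ.integrableOn_smul h.2.1) (hφ.integrableOn_smul h'.2.1), h.2.2 φ hφ,
    h'.2.2 φ hφ, neg_add]

theorem IsWeakDeriv.const_smul {T : ℝ} {w g : ℝ → E} (h : IsWeakDeriv T w g) (c : ℝ) :
    IsWeakDeriv T (fun t => c • w t) (fun t => c • g t) := by
  refine ⟨h.1.smul c, h.2.1.smul c, fun φ hφ => ?_⟩
  simp only [smul_comm _ c]
  rw [integral_smul, integral_smul, h.2.2 φ hφ, smul_neg]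

theorem IsWeakDeriv.congr_left {T : ℝ} {w w' g : ℝ → E} (h : IsWeakDeriv T w g)
    (hw : EqOn w w' (Ioo 0 T)) : IsWeakDeriv T w' g := by
  refine ⟨h.1.congr_fun hw measurableSet_Ioo, h.2.1, fun φ hφ => ?_⟩
  rw [← h.2.2 φ hφ]
  refine setIntegral_congr_fun measurableSet_Ioo fun t ht => ?_
  simp only [hw ht]

theorem ae_eq_zero_of_integral_test_smul [CompleteSpace E] {a b : ℝ} {g : ℝ → E}
    (hg : IntegrableOn g (Ioo a b))
    (h : ∀ φ : ℝ → ℝ, IsTest a b φ → ∫ t in Ioo a b, φ t • g t = 0) :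
    g =ᵐ[volume.restrict (Ioo a b)] 0 := by
  have := isOpen_Ioo.ae_eq_zero_of_integral_contDiff_smul_eq_zero (μ := (volume : Measure ℝ))
    hg.locallyIntegrableOn ?_
  · exact (ae_restrict_iff' measurableSet_Ioo).2 this
  · intro φ h1 h2 h3
    have hφ : IsTest a b φ := ⟨h1, h2, h3⟩
    rw [← h φ hφ]
    symm
    refine setIntegral_eq_integral_of_forall_compl_eq_zero fun t ht => ?_
    rw [hφ.eq_zero ht, zero_smul]

/-- Permits replacing any fractional derivative supplied by the scheme with the Marchaud expression.
-/
theorem IsWeakDeriv.ae_eq [CompleteSpace E] {T : ℝ} {w g g' : ℝ → E} (h : IsWeakDeriv T w g)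
    (h' : IsWeakDeriv T w g') : g =ᵐ[volume.restrict (Ioo 0 T)] g' := by
  have := ae_eq_zero_of_integral_test_smul (h.2.1.sub h'.2.1) fun φ hφ => by
    simp only [Pi.sub_apply, smul_sub]
    rw [integral_sub (hφ.integrableOn_smul h.2.1) (hφ.integrableOn_smul h'.2.1)]
    have := (h.2.2 φ hφ).symm.trans (h'.2.2 φ hφ)
    rw [neg_inj.1 this, sub_self]
  filter_upwards [this] with t ht
  exact sub_eq_zero.1 ht

/-- Fubini on `r < t < T`: the inner integral of `φ'` over `(r, T)` is `-φ(r)`, because `φ(T) = 0`.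
-/
theorem isWeakDeriv_of_integral [CompleteSpace E] {T : ℝ} {G g : ℝ → E}
    (hg : IntegrableOn g (Ioo 0 T))
    (hG : ∀ t ∈ Ioo 0 T, G t = ∫ r in Ioo 0 t, g r) : IsWeakDeriv T G g := by
  set μ := volume.restrict (Ioo (0 : ℝ) T) with hμ
  set H : ℝ × ℝ → E := indicator {p : ℝ × ℝ | p.2 < p.1} (fun p => g p.2) with hH
  have hHi : Integrable H (μ.prod μ) :=
    (hg.comp_snd μ).indicator (measurableSet_lt measurable_snd measurable_fst)
  have hHl : ∀ t ∈ Ioo 0 T, ∫ r, H (t, r) ∂μ = G t := by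
    intro t ht
    rw [hG t ht]
    have : ∀ r, H (t, r) = indicator (Iio t) g r := fun r => by
      simp only [hH, indicator, mem_ofPred_eq, mem_Iio]
    simp only [this]
    rw [hμ, setIntegral_indicator measurableSet_Iio, Ioo_inter_Iio, min_eq_right ht.2.le]
  refine ⟨?_, hg, fun φ hφ => ?_⟩
  · exact IntegrableOn.congr_fun hHi.integral_prod_left hHl measurableSet_Ioo
  · obtain ⟨C, hC⟩ := hφ.exists_bound_deriv
    have hKi : Integrable (fun p : ℝ × ℝ => deriv φ p.1 • H p) (μ.prod μ) :=
      Integrable.bdd_smul hHi C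
        (hφ.continuous_deriv.comp continuous_fst).aestronglyMeasurable (ae_of_all _ fun p => hC p.1)
    have e1 : ∫ t in Ioo 0 T, deriv φ t • G t = ∫ t, ∫ r, deriv φ t • H (t, r) ∂μ ∂μ := by
      refine setIntegral_congr_fun measurableSet_Ioo fun t ht => ?_
      rw [integral_smul, hHl t ht]
    rw [e1, integral_integral_swap (f := fun t r => deriv φ t • H (t, r)) hKi, ← integral_neg]
    refine setIntegral_congr_fun measurableSet_Ioo fun r hr => ?_
    have : ∀ t, deriv φ t • H (t, r) = indicator (Ioi r) (fun t => deriv φ t • g r) t := fun t => by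
      by_cases htr : r < t
      · rw [indicator_of_mem (mem_Ioi.2 htr), hH, indicator_of_mem (by exact htr)]
      · rw [indicator_of_notMem (show t ∉ Ioi r from htr), hH, indicator_of_notMem (by exact htr), smul_zero]
    simp only [this]
    rw [hμ, setIntegral_indicator measurableSet_Ioi, Ioo_inter_Ioi, max_eq_right hr.1.le,
      integral_smul_const, ← integral_Ioc_eq_integral_Ioo, ← intervalIntegral.integral_of_le hr.2.le,
      intervalIntegral.integral_deriv_eq_sub
        (fun y _ => hφ.smooth.differentiable (by simp) y)
        (hφ.continuous_deriv.intervalIntegrable _ _),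
      hφ.eq_zero (fun h => lt_irrefl _ h.2), zero_sub, neg_smul]

theorem rlIntegral_congr {γ T : ℝ} {v w : ℝ → E}
    (h : v =ᵐ[volume.restrict (Ioo 0 T)] w) {t : ℝ} (ht : t ≤ T) :
    rlIntegral γ v t = rlIntegral γ w t := by
  rw [rlIntegral, rlIntegral]
  congr 1
  refine integral_congr_ae ?_
  filter_upwards [ae_restrict_of_ae_restrict_of_subset (Ioo_subset_Ioo_right ht) h] with s hs
  rw [hs]

theorem IsRLDeriv.congr {γ T : ℝ} {v w g : ℝ → E} (h : IsRLDeriv γ T v g)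
    (hvw : v =ᵐ[volume.restrict (Ioo 0 T)] w) : IsRLDeriv γ T w g :=
  IsWeakDeriv.congr_left h fun _ ht => rlIntegral_congr hvw ht.2.le

theorem LipInMean.integrableOn_sub_rpow_smul {γ : ℝ} (h1 : γ < 1) {w : ℝ → E} (hw : LipInMean w)
    (t : ℝ) : IntegrableOn (fun s : ℝ => (t - s) ^ (1 - γ - 1) • w s) (Ioo 0 t) := by
  obtain ⟨M, hM⟩ := hw.bdd
  refine Integrable.smul_bdd ?_ M hw.sm.aestronglyMeasurable (ae_of_all _ hM)
  rcases le_or_gt t 0 with ht | ht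
  · simp [Ioo_eq_empty (not_lt.2 ht)]
  change IntegrableOn (fun s : ℝ => (t - s) ^ (1 - γ - 1)) (Ioo 0 t)
  rw [← integrableOn_Ioc_iff_integrableOn_Ioo, ← intervalIntegrable_iff_integrableOn_Ioc_of_le ht.le]
  have := (intervalIntegral.intervalIntegrable_rpow' (a := t - 0) (b := t - t) (r := 1 - γ - 1)
    (by linarith)).comp_sub_left t
  simpa using this

/-- Additivity of the singular integrals needs integrability, which the bounded representatives `w`
and `w'` provide. -/
theorem IsRLDeriv.add {γ T : ℝ} (h1 : γ < 1) {v v' w w' g g' : ℝ → E}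
    (hv : v =ᵐ[volume.restrict (Ioo 0 T)] w) (hv' : v' =ᵐ[volume.restrict (Ioo 0 T)] w')
    (hw : LipInMean w) (hw' : LipInMean w')
    (h : IsRLDeriv γ T v g) (h' : IsRLDeriv γ T v' g') :
    IsRLDeriv γ T (fun t => v t + v' t) (fun t => g t + g' t) := by
  refine IsWeakDeriv.congr_left (IsWeakDeriv.add h h') fun t ht => ?_
  have hvv : (fun t => v t + v' t) =ᵐ[volume.restrict (Ioo 0 T)] fun t => w t + w' t := hv.add hv'
  rw [rlIntegral_congr hv ht.2.le, rlIntegral_congr hv' ht.2.le, rlIntegral_congr hvv ht.2.le, rlIntegral, rlIntegral,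
    rlIntegral, ← smul_add, ← integral_add (hw.integrableOn_sub_rpow_smul h1 t)
      (hw'.integrableOn_sub_rpow_smul h1 t)]
  simp only [smul_add]

theorem IsRLDeriv.const_smul {γ T : ℝ} {v g : ℝ → E} (h : IsRLDeriv γ T v g) (c : ℝ) :
    IsRLDeriv γ T (fun t => c • v t) (fun t => c • g t) := by
  refine IsWeakDeriv.congr_left (IsWeakDeriv.const_smul h c) fun t _ => ?_
  simp only [rlIntegral, smul_comm _ c]
  rw [integral_smul, smul_comm]

theorem LipInMean.isRLDeriv_marchaud [CompleteSpace E] {γ : ℝ} (h0 : 0 < γ) (h1 : γ < 1)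
    {w : ℝ → E} (hw : LipInMean w) (T : ℝ) : IsRLDeriv γ T w (marchaud γ w) :=
  isWeakDeriv_of_integral (integrableOn_marchaud h1 hw T)
    fun _ ht => (integral_marchaud h0 h1 hw ht.1).symm

end WeakDeriv

/-! ### The space `H₀¹(Ω)` and its finite element subspaces -/

section FiniteElements

variable {a b : ℝ}

namespace H01

theorem norm_dx (v : H01 a b) : ‖dx v‖ = ‖v‖ := by
  rw [← sq_eq_sq₀ (norm_nonneg _) (norm_nonneg _), ← real_inner_self_eq_norm_sq,
    ← real_inner_self_eq_norm_sq, inner_def]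

theorem norm_toL2_le (hab : a ≤ b) (v : H01 a b) : ‖toL2 v‖ ≤ (b - a) * ‖v‖ := by
  rw [← norm_dx]
  have h := poincare_aux v
  rw [measureReal_restrict_apply_univ, Real.volume_real_Ioo_of_le hab] at h
  exact h

variable (a b) in
/-- The weak derivative as a linear isometry. -/
def dxₗᵢ : H01 a b →ₗᵢ[ℝ] L2 a b := ⟨dx, norm_dx⟩

variable (a b) in
/-- The inclusion `H₀¹(Ω) → L²(Ω)` as a continuous linear map. -/
def toL2L : H01 a b →L[ℝ] L2 a b :=
  LinearMap.mkContinuous toL2 ((volume.restrict (Ioo a b)).real univ) fun v => by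
    rw [← norm_dx]
    exact poincare_aux v

theorem toL2L_apply (v : H01 a b) : toL2L a b v = toL2 v := rfl

theorem memLp_of_continuous_compact {ψ : ℝ → ℝ} (hc : Continuous ψ) (hs : HasCompactSupport ψ) :
    MemLp ψ 2 (volume.restrict (Ioo a b)) :=
  (hc.memLp_of_hasCompactSupport hs).restrict _

theorem inner_toLp {ψ : ℝ → ℝ} (hψ : MemLp ψ 2 (volume.restrict (Ioo a b))) (p : L2 a b) :
    inner ℝ (hψ.toLp ψ) p = ∫ x in Ioo a b, ψ x * p x := by
  rw [L2.inner_def]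
  refine integral_congr_ae ?_
  filter_upwards [hψ.coeFn_toLp] with x hx
  rw [hx, real_inner_eq_re_inner ℝ]
  simp [mul_comm]

theorem integral_test_graph {ψ : ℝ → ℝ} (hψ : IsTest a b ψ) (p : L2 a b × L2 a b)
    (hp : p ∈ testGraph a b) :
    inner ℝ ((memLp_of_continuous_compact hψ.continuous hψ.compact).toLp ψ) p.2
      = -inner ℝ ((memLp_of_continuous_compact hψ.continuous_deriv
          hψ.compact.deriv).toLp (deriv ψ)) p.1 := by
  obtain ⟨φ, hφ, h1, h2⟩ := hp
  rw [inner_toLp, inner_toLp]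
  have e1 : ∫ x in Ioo a b, ψ x * p.2 x = ∫ x, ψ x * deriv φ x := by
    rw [← setIntegral_eq_integral_of_forall_compl_eq_zero (s := Ioo a b)
      (f := fun x => ψ x * deriv φ x) fun t ht => by rw [hψ.eq_zero ht, zero_mul]]
    refine integral_congr_ae ?_
    filter_upwards [h2] with x hx
    rw [hx]
  have e2 : ∫ x in Ioo a b, deriv ψ x * p.1 x = ∫ x, deriv ψ x * φ x := by
    rw [← setIntegral_eq_integral_of_forall_compl_eq_zero (s := Ioo a b)
      (f := fun x => deriv ψ x * φ x) fun t ht => by rw [hφ.eq_zero ht, mul_zero]]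
    refine integral_congr_ae ?_
    filter_upwards [h1] with x hx
    rw [hx]
  rw [e1, e2]
  refine integral_mul_deriv_eq_deriv_mul_of_integrable
    (fun x _ => (hψ.smooth.differentiable (by simp) x).hasDerivAt)
    (fun x _ => (hφ.smooth.differentiable (by simp) x).hasDerivAt) ?_ ?_ ?_
  · exact (hψ.continuous.mul hφ.continuous_deriv).integrable_of_hasCompactSupport
      hψ.compact.mul_right
  · exact (hψ.continuous_deriv.mul hφ.continuous).integrable_of_hasCompactSupport
      hψ.compact.deriv.mul_right
  · exact (hψ.continuous.mul hφ.continuous).integrable_of_hasCompactSupport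
      hψ.compact.mul_right

/-- Integration by parts against a fixed test function is a closed condition on pairs, so it passes
from the test graph to its closure. -/
theorem integral_test_dx {ψ : ℝ → ℝ} (hψ : IsTest a b ψ) (v : H01 a b) :
    inner ℝ ((memLp_of_continuous_compact hψ.continuous hψ.compact).toLp ψ) (dx v)
      = -inner ℝ ((memLp_of_continuous_compact hψ.continuous_deriv
          hψ.compact.deriv).toLp (deriv ψ)) (toL2 v) := by
  have hc : IsClosed {p : L2 a b × L2 a b |
      inner ℝ ((memLp_of_continuous_compact hψ.continuous hψ.compact).toLp ψ) p.2
      = -inner ℝ ((memLp_of_continuous_compact hψ.continuous_deriv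
          hψ.compact.deriv).toLp (deriv ψ)) p.1} :=
    isClosed_eq (by fun_prop) (by fun_prop)
  exact closure_minimal (fun p hp => integral_test_graph hψ p hp) hc v.2

/-- The function determines its weak derivative. This allows finite dimensionality of `Sh` to be
read off from the function components alone. -/
theorem toL2_injective : Function.Injective (toL2 : H01 a b → L2 a b) := by
  rw [← LinearMap.ker_eq_bot, LinearMap.ker_eq_bot']
  intro v hv
  have hd : dx v = 0 := by
    rw [Lp.eq_zero_iff_ae_eq_zero]
    refine ae_eq_zero_of_integral_test_smul
      ((Lp.memLp (dx v)).integrable (by norm_num)) fun ψ hψ => ?_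
    have := integral_test_dx hψ v
    rw [hv, inner_zero_right, neg_zero, inner_toLp] at this
    exact this
  exact norm_eq_zero.1 (by rw [← norm_dx, hd, norm_zero])

end H01

theorem Partition.ae_mem_element (K : Partition a b) :
    ∀ᵐ y ∂volume.restrict (Ioo a b), ∃ i : Fin K.N, y ∈ Ioo (K.x i.castSucc) (K.x i.succ) := by
  have hfin : (range K.x).Finite := finite_range _
  have hne : ∀ᵐ y ∂volume.restrict (Ioo a b), y ∉ range K.x :=
    ae_restrict_of_ae (measure_eq_zero_iff_ae_notMem.1 (hfin.measure_zero _))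
  filter_upwards [hne, ae_restrict_mem measurableSet_Ioo] with y hy hab
  by_contra hcon
  push Not at hcon
  -- A point lying in no element and at no node would have every node to its left, including the
  -- last one, `b`.
  have key : ∀ i : Fin (K.N + 1), K.x i < y := by
    intro i
    induction i using Fin.induction with
    | zero => rw [K.first]; exact hab.1
    | succ i ih =>
      by_contra hle
      rcases lt_or_eq_of_le (not_lt.1 hle) with h | h
      · exact hcon i ⟨ih, h⟩
      · exact hy ⟨_, h.symm⟩
  have := key (Fin.last _)
  rw [K.last] at this
  exact lt_asymm this hab.2

theorem memLp_indicator_pow (c d : ℝ) (k : ℕ) :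
    MemLp (indicator (Ioo c d) fun y : ℝ => y ^ k) 2 (volume.restrict (Ioo a b)) := by
  have h : MemLp (indicator (Ioo c d) fun y : ℝ => y ^ k) 2 volume := by
    rw [memLp_indicator_iff_restrict measurableSet_Ioo]
    have hc : MemLp (fun y : ℝ => y ^ k) ⊤ (volume.restrict (Ioo c d)) := by
      refine memLp_top_of_bound (Continuous.aestronglyMeasurable (by fun_prop))
        ((|c| + |d|) ^ k) ((ae_restrict_iff' measurableSet_Ioo).2 (ae_of_all _ fun y hy => ?_))
      rw [norm_pow, Real.norm_eq_abs]
      refine pow_le_pow_left₀ (abs_nonneg _) (abs_le.2 ⟨?_, ?_⟩) k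
      · linarith [neg_abs_le c, abs_nonneg d, hy.1]
      · linarith [le_abs_self d, abs_nonneg c, hy.2]
    exact hc.mono_exponent le_top
  exact h.restrict _

/-- The truncated monomials spanning the piecewise polynomials of degree at most `n`. -/
def elementMonomial (K : Partition a b) (n : ℕ) (p : Fin K.N × Fin (n + 1)) : L2 a b :=
  (memLp_indicator_pow (K.x p.1.castSucc) (K.x p.1.succ) (p.2 : ℕ)).toLp _

theorem toL2_mem_span (K : Partition a b) (n : ℕ) {v : H01 a b} (hv : v ∈ Sh K n) :
    H01.toL2 v ∈ Submodule.span ℝ (range (elementMonomial K n)) := by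
  choose p hp hvp using hv
  have : H01.toL2 v = ∑ q : Fin K.N × Fin (n + 1),
      (p q.1).coeff q.2 • elementMonomial K n q := by
    refine Lp.ext ?_
    have hae : ∀ᵐ y ∂volume.restrict (Ioo a b), ∀ i : Fin K.N,
        y ∈ Ioo (K.x i.castSucc) (K.x i.succ) →
        (H01.toL2 v : ℝ → ℝ) y = (p i).eval y := by
      rw [ae_all_iff]
      intro i
      exact ae_restrict_of_ae ((ae_restrict_iff' measurableSet_Ioo).1 (hvp i))
    have hmon : ∀ᵐ y ∂volume.restrict (Ioo a b), ∀ q : Fin K.N × Fin (n + 1),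
        (((p q.1).coeff q.2 • elementMonomial K n q : L2 a b) : ℝ → ℝ) y
          = (p q.1).coeff q.2 *
            indicator (Ioo (K.x q.1.castSucc) (K.x q.1.succ)) (fun y : ℝ => y ^ (q.2 : ℕ)) y := by
      rw [ae_all_iff]
      intro q
      filter_upwards [Lp.coeFn_smul ((p q.1).coeff q.2) (elementMonomial K n q),
        (memLp_indicator_pow (a := a) (b := b) (K.x q.1.castSucc) (K.x q.1.succ)
          (q.2 : ℕ)).coeFn_toLp] with y h1 h2
      rw [h1, Pi.smul_apply, smul_eq_mul, elementMonomial, h2]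
    filter_upwards [hae, hmon, K.ae_mem_element,
      Lp.coeFn_finsetSum Finset.univ fun q : Fin K.N × Fin (n + 1) =>
        (p q.1).coeff q.2 • elementMonomial K n q] with y h1 h2 h3 h4
    obtain ⟨i, hi⟩ := h3
    rw [h4, Finset.sum_apply, h1 i hi]
    simp only [h2]
    rw [Fintype.sum_prod_type, Finset.sum_eq_single i]
    · simp only [indicator_of_mem hi]
      rw [Polynomial.eval_eq_sum_range' (Nat.lt_succ_of_le (hp i)), Finset.sum_range]
    · intro i' _ hne
      refine Finset.sum_eq_zero fun k _ => ?_
      rw [indicator_of_notMem, mul_zero]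
      intro hi'
      rcases lt_or_gt_of_ne hne with h | h
      · have : K.x i'.succ ≤ K.x i.castSucc := K.strictMono.monotone (by
          rw [Fin.le_iff_val_le_val]; simpa using h)
        linarith [hi.1, hi'.2]
      · have : K.x i.succ ≤ K.x i'.castSucc := K.strictMono.monotone (by
          rw [Fin.le_iff_val_le_val]; simpa using h)
        linarith [hi.2, hi'.1]
    · simp
  rw [this]
  exact Submodule.sum_mem _ fun q _ =>
    Submodule.smul_mem _ _ (Submodule.subset_span (mem_range_self q))

instance finiteDimensional_Sh (K : Partition a b) (n : ℕ) : FiniteDimensional ℝ (Sh K n) := by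
  have : FiniteDimensional ℝ (Submodule.span ℝ (range (elementMonomial K n))) :=
    FiniteDimensional.span_of_finite ℝ (finite_range _)
  refine FiniteDimensional.of_injective
    ((H01.toL2.comp (Sh K n).subtype).codRestrict
      (Submodule.span ℝ (range (elementMonomial K n))) fun v => toL2_mem_span K n v.2) ?_
  intro v w hvw
  have : H01.toL2 (v : H01 a b) = H01.toL2 (w : H01 a b) := congrArg Subtype.val hvw
  exact Subtype.ext (H01.toL2_injective this)

/-- The Ritz projection is the orthogonal projection for the inner product of `H01`, hence a
contraction. -/
theorem exists_isRitz (K : Partition a b) (n : ℕ) (u : H01 a b) :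
    ∃ r, IsRitz K n u r ∧ ‖r‖ ≤ ‖u‖ := by
  refine ⟨(Sh K n).starProjection u, ⟨Submodule.starProjection_apply_mem _ _, ?_⟩,
    Submodule.norm_starProjection_apply_le _ _⟩
  intro vh hvh
  rw [← H01.inner_def]
  exact Submodule.starProjection_inner_eq_zero _ _ hvh

theorem IsRitz.unique {K : Partition a b} {n : ℕ} {u r r' : H01 a b} (h : IsRitz K n u r)
    (h' : IsRitz K n u r') : r = r' := by
  have hm : r - r' ∈ Sh K n := (Sh K n).sub_mem h.1 h'.1
  have h1 := h.2 _ hm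
  have h2 := h'.2 _ hm
  rw [← H01.inner_def] at h1 h2
  have : inner ℝ (r - r') (r - r') = 0 := by
    have e : r - r' = (u - r') - (u - r) := by abel
    nth_rw 1 [e]
    rw [inner_sub_left, h1, h2, sub_zero]
  exact sub_eq_zero.1 (inner_self_eq_zero.1 this)

end FiniteElements

/-! ### Piecewise polynomial functions of time -/

section LipInMeanClosure

variable {E : Type*} [NormedAddCommGroup E]

theorem LipInMean.zero : LipInMean (fun _ => 0 : ℝ → E) :=
  ⟨stronglyMeasurable_const, ⟨0, by simp⟩, ⟨0, by simp⟩⟩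

theorem LipInMean.add {w w' : ℝ → E} (hw : LipInMean w) (hw' : LipInMean w') :
    LipInMean fun t => w t + w' t := by
  obtain ⟨M, hM⟩ := hw.bdd
  obtain ⟨M', hM'⟩ := hw'.bdd
  obtain ⟨C, hC⟩ := hw.shift
  obtain ⟨C', hC'⟩ := hw'.shift
  -- The shift constants are not assumed nonnegative, so positive parts are taken before adding
  -- under `ENNReal.ofReal`.
  refine ⟨hw.sm.add hw'.sm, ⟨M + M', fun t => norm_add_le_of_le (hM t) (hM' t)⟩,
    ⟨max C 0 + max C' 0, fun h hh => ?_⟩⟩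
  have hm : Measurable fun t => ‖w t - w (t - h)‖ₑ :=
    (hw.sm.sub (hw.sm.comp_measurable (measurable_id.sub_const h))).enorm
  calc ∫⁻ t, ‖w t + w' t - (w (t - h) + w' (t - h))‖ₑ
      ≤ ∫⁻ t, (‖w t - w (t - h)‖ₑ + ‖w' t - w' (t - h)‖ₑ) := by
        refine lintegral_mono fun t => ?_
        rw [add_sub_add_comm]
        exact enorm_add_le _ _
    _ = (∫⁻ t, ‖w t - w (t - h)‖ₑ) + ∫⁻ t, ‖w' t - w' (t - h)‖ₑ := lintegral_add_left hm _
    _ ≤ ENNReal.ofReal (max C 0 * h) + ENNReal.ofReal (max C' 0 * h) := by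
        refine add_le_add ((hC h hh).trans ?_) ((hC' h hh).trans ?_)
        · exact ENNReal.ofReal_le_ofReal (mul_le_mul_of_nonneg_right (le_max_left _ _) hh.le)
        · exact ENNReal.ofReal_le_ofReal (mul_le_mul_of_nonneg_right (le_max_left _ _) hh.le)
    _ = ENNReal.ofReal ((max C 0 + max C' 0) * h) := by
        rw [← ENNReal.ofReal_add (by positivity) (by positivity), add_mul]

theorem LipInMean.sum {ι : Type*} (s : Finset ι) {w : ι → ℝ → E}
    (hw : ∀ i ∈ s, LipInMean (w i)) : LipInMean fun t => ∑ i ∈ s, w i t := by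
  classical
  induction s using Finset.induction_on with
  | empty => simpa using LipInMean.zero
  | insert i s his ih =>
    simp only [Finset.sum_insert his]
    exact (hw i (Finset.mem_insert_self _ _)).add
      (ih fun j hj => hw j (Finset.mem_insert_of_mem hj))

/-- If `t` and `t - h` both lie in the interval, the Lipschitz bound applies. If just one does, then
`t` is within `h` to the right of an endpoint, and the sup bound `M` is integrated over a set of
length `h`. -/
theorem LipInMean.indicator_Ioo {q : ℝ → E} (hq : Continuous q) {c d M L : ℝ} (hcd : c < d)
    (hM : ∀ x ∈ Ioo c d, ‖q x‖ ≤ M)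
    (hL : ∀ x ∈ Ioo c d, ∀ y ∈ Ioo c d, ‖q x - q y‖ ≤ L * |x - y|) :
    LipInMean (indicator (Ioo c d) q) := by
  obtain ⟨z, hz⟩ := nonempty_Ioo.2 hcd
  have hM0 : 0 ≤ M := (norm_nonneg _).trans (hM z hz)
  have hL0 : 0 ≤ L := by
    obtain ⟨y, hy⟩ := nonempty_Ioo.2 hz.1
    have h := (norm_nonneg _).trans (hL z hz y ⟨hy.1, hy.2.trans hz.2⟩)
    exact nonneg_of_mul_nonneg_left h (abs_pos.2 (sub_ne_zero.2 hy.2.ne'))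
  have hbd : ∀ t, ‖indicator (Ioo c d) q t‖ ≤ M := by
    intro t
    by_cases ht : t ∈ Ioo c d
    · rw [indicator_of_mem ht]; exact hM t ht
    · rw [indicator_of_notMem ht, norm_zero]; exact hM0
  refine ⟨hq.stronglyMeasurable.indicator measurableSet_Ioo, ⟨M, hbd⟩,
    ⟨L * (d - c) + M + M, fun h hh => ?_⟩⟩
  have hpt : ∀ t, ‖indicator (Ioo c d) q t - indicator (Ioo c d) q (t - h)‖ₑ
      ≤ indicator (Ioo c d) (fun _ => ENNReal.ofReal (L * h)) t
        + indicator (Icc c (c + h)) (fun _ => ENNReal.ofReal M) t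
        + indicator (Icc d (d + h)) (fun _ => ENNReal.ofReal M) t := by
    intro t
    by_cases h1 : t ∈ Ioo c d <;> by_cases h2 : t - h ∈ Ioo c d
    · rw [indicator_of_mem h1, indicator_of_mem h2, indicator_of_mem h1, add_assoc]
      refine le_add_right ?_
      rw [← ofReal_norm]
      refine ENNReal.ofReal_le_ofReal ((hL t h1 _ h2).trans (le_of_eq ?_))
      rw [sub_sub_cancel, abs_of_pos hh]
    · have h3 : t ∈ Icc c (c + h) := by
        refine ⟨h1.1.le, ?_⟩
        by_contra hcon
        exact h2 ⟨by linarith, by linarith [h1.2]⟩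
      rw [indicator_of_notMem h2, sub_zero, indicator_of_mem h3]
      refine le_add_right (le_add_left ?_)
      rw [← ofReal_norm]
      exact ENNReal.ofReal_le_ofReal (hbd t)
    · have h3 : t ∈ Icc d (d + h) := by
        refine ⟨?_, by linarith [h2.2]⟩
        by_contra hcon
        exact h1 ⟨by linarith [h2.1], by linarith⟩
      rw [indicator_of_notMem h1, zero_sub, enorm_neg, indicator_of_mem h3]
      refine le_add_left ?_
      rw [← ofReal_norm]
      exact ENNReal.ofReal_le_ofReal (hbd _)
    · rw [indicator_of_notMem h1, indicator_of_notMem h2, sub_zero, enorm_zero]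
      exact zero_le
  refine (lintegral_mono hpt).trans (le_of_eq ?_)
  rw [lintegral_add_right _ (measurable_const.indicator measurableSet_Icc),
    lintegral_add_right _ (measurable_const.indicator measurableSet_Icc),
    lintegral_indicator measurableSet_Ioo, lintegral_indicator measurableSet_Icc,
    lintegral_indicator measurableSet_Icc, setLIntegral_const, setLIntegral_const,
    setLIntegral_const, Real.volume_Ioo, Real.volume_Icc, Real.volume_Icc, add_sub_cancel_left,
    add_sub_cancel_left]
  have hdc : 0 ≤ d - c := by linarith
  rw [← ENNReal.ofReal_mul (by positivity), ← ENNReal.ofReal_mul (by positivity),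
    ← ENNReal.ofReal_add (by positivity) (by positivity),
    ← ENNReal.ofReal_add (by positivity) (by positivity)]
  congr 1
  ring

end LipInMeanClosure

/-! ### Vector-valued polynomials in time -/

section TimePoly

variable {E : Type*} [NormedAddCommGroup E] [NormedSpace ℝ E]

/-- The polynomial in time with coefficients `c`. -/
def timePoly (m : ℕ) (c : ℕ → E) (t : ℝ) : E := ∑ k ∈ Finset.range (m + 1), t ^ k • c k

/-- The derivative of `timePoly`. -/
def timePolyDeriv (m : ℕ) (c : ℕ → E) (t : ℝ) : E :=
  ∑ k ∈ Finset.range (m + 1), ((k : ℝ) * t ^ (k - 1)) • c k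

theorem hasDerivAt_timePoly (m : ℕ) (c : ℕ → E) (t : ℝ) :
    HasDerivAt (timePoly m c) (timePolyDeriv m c t) t := by
  refine HasDerivAt.fun_sum fun k _ => ?_
  exact (hasDerivAt_pow k t).smul_const (c k)

theorem continuous_timePoly (m : ℕ) (c : ℕ → E) : Continuous (timePoly m c) := by
  unfold timePoly
  fun_prop

theorem continuous_timePolyDeriv (m : ℕ) (c : ℕ → E) : Continuous (timePolyDeriv m c) := by
  unfold timePolyDeriv
  fun_prop

theorem lipInMean_indicator_timePoly (m : ℕ) (c : ℕ → E) {x y : ℝ} (hxy : x < y) :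
    LipInMean (indicator (Ioo x y) (timePoly m c)) := by
  obtain ⟨M, hM⟩ := isCompact_Icc.exists_bound_of_continuousOn
    (continuous_timePoly m c).continuousOn (s := Icc x y)
  obtain ⟨L, hL⟩ := isCompact_Icc.exists_bound_of_continuousOn
    (continuous_timePolyDeriv m c).continuousOn (s := Icc x y)
  refine LipInMean.indicator_Ioo (continuous_timePoly m c) hxy (M := M) (L := L)
    (fun t ht => hM t (Ioo_subset_Icc_self ht)) fun s hs t ht => ?_
  exact (convex_Ioo x y).norm_image_sub_le_of_norm_hasDerivWithin_le
    (fun r _ => (hasDerivAt_timePoly m c r).hasDerivWithinAt)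
    (fun r hr => hL r (Ioo_subset_Icc_self hr)) ht hs

end TimePoly

/-! ### The graded time grid and truncation in time -/

section Grid

/-- Admissible parameters of the graded grid. -/
structure GridData (T σ : ℝ) (J : ℕ) : Prop where
  T_pos : 0 < T
  one_le : 1 ≤ σ
  J_pos : 0 < J

variable {T σ : ℝ} {J : ℕ}

theorem GridData.grid_zero (G : GridData T σ J) : grid T σ J 0 = 0 := by
  rw [grid, Nat.cast_zero, zero_div, Real.zero_rpow (by linarith [G.one_le]), zero_mul]

theorem GridData.grid_last (G : GridData T σ J) : grid T σ J J = T := by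
  have : (J : ℝ) ≠ 0 := by exact_mod_cast G.J_pos.ne'
  rw [grid, div_self this, Real.one_rpow, one_mul]

theorem GridData.strictMono (G : GridData T σ J) : StrictMono (grid T σ J) := by
  intro i j hij
  have hJ : (0 : ℝ) < J := by exact_mod_cast G.J_pos
  have : (i : ℝ) < j := by exact_mod_cast hij
  refine mul_lt_mul_of_pos_right ?_ G.T_pos
  exact Real.rpow_lt_rpow (by positivity) (by gcongr) (by linarith [G.one_le])

theorem GridData.slab_nonempty (G : GridData T σ J) (j : ℕ) :
    grid T σ J j < grid T σ J (j + 1) := G.strictMono (Nat.lt_succ_self j)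

theorem GridData.grid_nonneg (G : GridData T σ J) (j : ℕ) : 0 ≤ grid T σ J j := by
  rw [← G.grid_zero]
  exact G.strictMono.monotone (Nat.zero_le j)

theorem GridData.grid_pos (G : GridData T σ J) {j : ℕ} (hj : 1 ≤ j) : 0 < grid T σ J j := by
  rw [← G.grid_zero]
  exact G.strictMono hj

theorem GridData.grid_le (G : GridData T σ J) {j : ℕ} (hj : j ≤ J) : grid T σ J j ≤ T :=
  (G.strictMono.monotone hj).trans G.grid_last.le

variable (T σ J) in
/-- The `j`-th time interval. -/
abbrev slab (j : ℕ) : Set ℝ := Ioo (grid T σ J j) (grid T σ J (j + 1))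

theorem GridData.slab_disjoint (G : GridData T σ J) {i j : ℕ} {t : ℝ} (hi : t ∈ slab T σ J i)
    (hj : t ∈ slab T σ J j) : i = j := by
  by_contra hne
  rcases lt_or_gt_of_ne hne with h | h
  · have := G.strictMono.monotone (Nat.succ_le_of_lt h)
    exact absurd (hi.2.trans_le this) (not_lt.2 hj.1.le)
  · have := G.strictMono.monotone (Nat.succ_le_of_lt h)
    exact absurd (hj.2.trans_le this) (not_lt.2 hi.1.le)

theorem GridData.slab_subset (G : GridData T σ J) {i j : ℕ} (hij : i < j) :
    slab T σ J i ⊆ Ioo 0 (grid T σ J j) :=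
  Ioo_subset_Ioo (G.grid_nonneg i) (G.strictMono.monotone hij)

theorem GridData.exists_slab (G : GridData T σ J) (j : ℕ) {t : ℝ}
    (ht : t ∈ Ioo 0 (grid T σ J j)) (hne : t ∉ range (grid T σ J)) :
    ∃ i < j, t ∈ slab T σ J i := by
  induction j with
  | zero =>
    rw [G.grid_zero] at ht
    exact absurd (ht.1.trans ht.2) (lt_irrefl _)
  | succ j ih =>
    rcases lt_trichotomy t (grid T σ J j) with h | h | h
    · obtain ⟨i, hi, hti⟩ := ih ⟨ht.1, h⟩
      exact ⟨i, hi.trans (Nat.lt_succ_self j), hti⟩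
    · exact absurd ⟨j, h.symm⟩ hne
    · exact ⟨j, Nat.lt_succ_self j, h, ht.2⟩

theorem GridData.ae_exists_slab (G : GridData T σ J) (j : ℕ) :
    ∀ᵐ t ∂volume.restrict (Ioo 0 (grid T σ J j)), ∃ i < j, t ∈ slab T σ J i := by
  have hne : ∀ᵐ t : ℝ, t ∉ range (grid T σ J) :=
    measure_eq_zero_iff_ae_notMem.1 ((countable_range _).measure_zero _)
  filter_upwards [ae_restrict_of_ae hne, ae_restrict_mem measurableSet_Ioo] with t h1 h2
  exact G.exists_slab j h2 h1

variable {X : Type*} [AddCommMonoid X]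

variable (T σ J) in
/-- The restriction of `V` to the first `i` time intervals, extended by zero. -/
def cutoff (i : ℕ) (V : ℝ → X) (t : ℝ) : X :=
  ∑ j ∈ Finset.range i, indicator (slab T σ J j) V t

theorem GridData.cutoff_of_mem (G : GridData T σ J) {i j : ℕ} (hij : j < i) (V : ℝ → X) {t : ℝ}
    (ht : t ∈ slab T σ J j) : cutoff T σ J i V t = V t := by
  rw [cutoff, Finset.sum_eq_single j, indicator_of_mem ht]
  · intro k _ hk
    exact indicator_of_notMem (fun h => hk (G.slab_disjoint h ht)) _
  · intro h
    exact absurd (Finset.mem_range.2 hij) h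

theorem GridData.cutoff_of_le (G : GridData T σ J) {i j : ℕ} (hij : i ≤ j) (V : ℝ → X) {t : ℝ}
    (ht : t ∈ slab T σ J j) : cutoff T σ J i V t = 0 := by
  refine Finset.sum_eq_zero fun k hk => ?_
  refine indicator_of_notMem (fun h => ?_) _
  have := G.slab_disjoint h ht
  have := Finset.mem_range.1 hk
  omega

theorem GridData.cutoff_of_notMem (G : GridData T σ J) {i : ℕ} (V : ℝ → X) {t : ℝ}
    (ht : t ∉ Ioo 0 (grid T σ J i)) : cutoff T σ J i V t = 0 := by
  refine Finset.sum_eq_zero fun k hk => ?_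
  exact indicator_of_notMem (fun h => ht (G.slab_subset (Finset.mem_range.1 hk) h)) _

theorem GridData.cutoff_eq_cutoff (G : GridData T σ J) {i i' : ℕ} (hi : i ≤ i') (V : ℝ → X) :
    EqOn (cutoff T σ J i' V) (cutoff T σ J i V) (Ioo 0 (grid T σ J i)) := by
  intro t ht
  rw [cutoff, cutoff]
  symm
  refine Finset.sum_subset (Finset.range_mono hi) fun k _ hk => ?_
  refine indicator_of_notMem (fun h => ?_) _
  have := G.strictMono.monotone (not_lt.1 (fun h => hk (Finset.mem_range.2 h)) : i ≤ k)
  exact absurd (h.1.trans ht.2) (not_lt.2 this)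

/-- Values at grid points are unconstrained by the discrete space; the cutoff is a representative
that vanishes there. -/
theorem GridData.cutoff_ae_eq (G : GridData T σ J) (i : ℕ) (V : ℝ → X) :
    V =ᵐ[volume.restrict (Ioo 0 (grid T σ J i))] cutoff T σ J i V := by
  filter_upwards [G.ae_exists_slab i] with t ht
  obtain ⟨j, hj, htj⟩ := ht
  exact (G.cutoff_of_mem hj V htj).symm

theorem GridData.indicator_ae_eq_cutoff (G : GridData T σ J) (i : ℕ) (V : ℝ → X) :
    indicator (Ioo 0 (grid T σ J i)) V =ᵐ[volume] cutoff T σ J i V := by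
  filter_upwards [(ae_restrict_iff' measurableSet_Ioo).1 (G.cutoff_ae_eq i V)] with t ht
  by_cases hti : t ∈ Ioo 0 (grid T σ J i)
  · rw [indicator_of_mem hti, ht hti]
  · rw [indicator_of_notMem hti, G.cutoff_of_notMem V hti]

end Grid

/-! ### The discrete space in time and space -/

section DiscreteSpace

variable {a b : ℝ} {K : Partition a b} {n m : ℕ} {T σ : ℝ} {J : ℕ} {U V V' : ℝ → H01 a b}

theorem MemW.exists_timePoly (hV : MemW K n m T σ J V) {j : ℕ} (hj : j < J) :
    ∃ c : ℕ → H01 a b, (∀ k, c k ∈ Sh K n) ∧ EqOn V (timePoly m c) (slab T σ J j) := hV j hj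

theorem MemW.add (hV : MemW K n m T σ J V) (hV' : MemW K n m T σ J V') :
    MemW K n m T σ J (V + V') := by
  intro j hj
  obtain ⟨c, hc, h⟩ := hV j hj
  obtain ⟨c', hc', h'⟩ := hV' j hj
  refine ⟨c + c', fun k => (Sh K n).add_mem (hc k) (hc' k), fun t ht => ?_⟩
  simp only [Pi.add_apply, h t ht, h' t ht, smul_add, Finset.sum_add_distrib]

theorem MemW.const_smul (hV : MemW K n m T σ J V) (r : ℝ) : MemW K n m T σ J (r • V) := by
  intro j hj
  obtain ⟨c, hc, h⟩ := hV j hj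
  refine ⟨r • c, fun k => (Sh K n).smul_mem r (hc k), fun t ht => ?_⟩
  simp only [Pi.smul_apply, h t ht, Finset.smul_sum]
  exact Finset.sum_congr rfl fun k _ => smul_comm _ _ _

theorem MemW.cutoff (hV : MemW K n m T σ J V) (G : GridData T σ J) (i : ℕ) :
    MemW K n m T σ J (cutoff T σ J i V) := by
  intro j hj
  rcases lt_or_ge j i with hji | hji
  · obtain ⟨c, hc, h⟩ := hV j hj
    exact ⟨c, hc, fun t ht => by rw [G.cutoff_of_mem hji V ht, h t ht]⟩
  · exact ⟨0, fun k => (Sh K n).zero_mem, fun t ht => by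
      rw [G.cutoff_of_le hji V ht]
      simp⟩

theorem traceR_eq_of_eqOn (G : GridData T σ J) {j : ℕ} {c : ℕ → H01 a b}
    (h : EqOn V (timePoly m c) (slab T σ J j)) :
    traceR T σ J V j = timePoly m c (grid T σ J j) := by
  have hlim : Tendsto V (𝓝[>] grid T σ J j) (𝓝 (timePoly m c (grid T σ J j))) := by
    refine Tendsto.congr' ?_ ((continuous_timePoly m c).continuousWithinAt)
    filter_upwards [Ioo_mem_nhdsGT (G.slab_nonempty j)] with t ht
    exact (h ht).symm
  exact rightLim_eq_of_tendsto hlim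

theorem traceL_succ_eq_of_eqOn (G : GridData T σ J) {j : ℕ} {c : ℕ → H01 a b}
    (h : EqOn V (timePoly m c) (slab T σ J j)) :
    traceL T σ J V (j + 1) = timePoly m c (grid T σ J (j + 1)) := by
  have hlim : Tendsto V (𝓝[<] grid T σ J (j + 1)) (𝓝 (timePoly m c (grid T σ J (j + 1)))) := by
    refine Tendsto.congr' ?_ ((continuous_timePoly m c).continuousWithinAt)
    filter_upwards [Ioo_mem_nhdsLT (G.slab_nonempty j)] with t ht
    exact (h ht).symm
  rw [traceL, if_neg (Nat.succ_ne_zero j)]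
  exact leftLim_eq_of_tendsto hlim

theorem traceL_zero : traceL T σ J V 0 = 0 := if_pos rfl

theorem deriv_eq_of_eqOn {j : ℕ} {c : ℕ → H01 a b}
    (h : EqOn V (timePoly m c) (slab T σ J j)) {t : ℝ} (ht : t ∈ slab T σ J j) :
    deriv V t = timePolyDeriv m c t := by
  rw [(h.eventuallyEq_of_mem (isOpen_Ioo.mem_nhds ht)).deriv_eq]
  exact (hasDerivAt_timePoly m c t).deriv

theorem timePoly_add (c c' : ℕ → H01 a b) (t : ℝ) :
    timePoly m (c + c') t = timePoly m c t + timePoly m c' t := by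
  simp [timePoly, Finset.sum_add_distrib]

theorem timePoly_smul (r : ℝ) (c : ℕ → H01 a b) (t : ℝ) :
    timePoly m (r • c) t = r • timePoly m c t := by
  simp only [timePoly, Finset.smul_sum, Pi.smul_apply]
  exact Finset.sum_congr rfl fun k _ => smul_comm _ _ _

theorem timePolyDeriv_add (c c' : ℕ → H01 a b) (t : ℝ) :
    timePolyDeriv m (c + c') t = timePolyDeriv m c t + timePolyDeriv m c' t := by
  simp [timePolyDeriv, Finset.sum_add_distrib]

theorem timePolyDeriv_smul (r : ℝ) (c : ℕ → H01 a b) (t : ℝ) :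
    timePolyDeriv m (r • c) t = r • timePolyDeriv m c t := by
  simp only [timePolyDeriv, Finset.smul_sum, Pi.smul_apply]
  exact Finset.sum_congr rfl fun k _ => smul_comm _ _ _

theorem eqOn_add {s : Set ℝ} {c c' : ℕ → H01 a b} (h : EqOn V (timePoly m c) s)
    (h' : EqOn V' (timePoly m c') s) : EqOn (V + V') (timePoly m (c + c')) s := by
  intro t ht
  rw [timePoly_add, ← h ht, ← h' ht, Pi.add_apply]

theorem eqOn_smul {s : Set ℝ} {c : ℕ → H01 a b} (h : EqOn V (timePoly m c) s) (r : ℝ) :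
    EqOn (r • V) (timePoly m (r • c)) s := by
  intro t ht
  rw [timePoly_smul, ← h ht, Pi.smul_apply]

theorem traceR_add (G : GridData T σ J) (hV : MemW K n m T σ J V) (hV' : MemW K n m T σ J V')
    {j : ℕ} (hj : j < J) :
    traceR T σ J (V + V') j = traceR T σ J V j + traceR T σ J V' j := by
  obtain ⟨c, -, h⟩ := hV.exists_timePoly hj
  obtain ⟨c', -, h'⟩ := hV'.exists_timePoly hj
  rw [traceR_eq_of_eqOn G h, traceR_eq_of_eqOn G h', traceR_eq_of_eqOn G (eqOn_add h h'),
    timePoly_add]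

theorem traceR_smul (G : GridData T σ J) (hV : MemW K n m T σ J V) (r : ℝ)
    {j : ℕ} (hj : j < J) : traceR T σ J (r • V) j = r • traceR T σ J V j := by
  obtain ⟨c, -, h⟩ := hV.exists_timePoly hj
  rw [traceR_eq_of_eqOn G h, traceR_eq_of_eqOn G (eqOn_smul h r), timePoly_smul]

theorem traceL_add (G : GridData T σ J) (hV : MemW K n m T σ J V) (hV' : MemW K n m T σ J V')
    {j : ℕ} (hj : j ≤ J) :
    traceL T σ J (V + V') j = traceL T σ J V j + traceL T σ J V' j := by
  cases j with
  | zero => simp [traceL_zero]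
  | succ j =>
    obtain ⟨c, -, h⟩ := hV.exists_timePoly hj
    obtain ⟨c', -, h'⟩ := hV'.exists_timePoly hj
    rw [traceL_succ_eq_of_eqOn G h, traceL_succ_eq_of_eqOn G h',
      traceL_succ_eq_of_eqOn G (eqOn_add h h'), timePoly_add]

theorem traceL_smul (G : GridData T σ J) (hV : MemW K n m T σ J V) (r : ℝ)
    {j : ℕ} (hj : j ≤ J) : traceL T σ J (r • V) j = r • traceL T σ J V j := by
  cases j with
  | zero => simp [traceL_zero]
  | succ j =>
    obtain ⟨c, -, h⟩ := hV.exists_timePoly hj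
    rw [traceL_succ_eq_of_eqOn G h, traceL_succ_eq_of_eqOn G (eqOn_smul h r), timePoly_smul]

theorem jump_add (G : GridData T σ J) (hV : MemW K n m T σ J V) (hV' : MemW K n m T σ J V')
    {j : ℕ} (hj : j < J) : jump T σ J (V + V') j = jump T σ J V j + jump T σ J V' j := by
  rw [jump, jump, jump, traceR_add G hV hV' hj, traceL_add G hV hV' hj.le]
  abel

theorem jump_smul (G : GridData T σ J) (hV : MemW K n m T σ J V) (r : ℝ)
    {j : ℕ} (hj : j < J) : jump T σ J (r • V) j = r • jump T σ J V j := by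
  rw [jump, jump, traceR_smul G hV r hj, traceL_smul G hV r hj.le, smul_sub]

theorem deriv_add_of_memW (hV : MemW K n m T σ J V) (hV' : MemW K n m T σ J V')
    {j : ℕ} (hj : j < J) {t : ℝ} (ht : t ∈ slab T σ J j) :
    deriv (V + V') t = deriv V t + deriv V' t := by
  obtain ⟨c, -, h⟩ := hV.exists_timePoly hj
  obtain ⟨c', -, h'⟩ := hV'.exists_timePoly hj
  rw [deriv_eq_of_eqOn h ht, deriv_eq_of_eqOn h' ht, deriv_eq_of_eqOn (eqOn_add h h') ht,
    timePolyDeriv_add]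

theorem deriv_smul_of_memW (hV : MemW K n m T σ J V) (r : ℝ)
    {j : ℕ} (hj : j < J) {t : ℝ} (ht : t ∈ slab T σ J j) :
    deriv (r • V) t = r • deriv V t := by
  obtain ⟨c, -, h⟩ := hV.exists_timePoly hj
  rw [deriv_eq_of_eqOn h ht, deriv_eq_of_eqOn (eqOn_smul h r) ht, timePolyDeriv_smul]

/-- Gives every discrete function the regularity required by the Marchaud theory. -/
theorem MemW.lipInMean_cutoff (hV : MemW K n m T σ J V) (G : GridData T σ J) {i : ℕ}
    (hi : i ≤ J) : LipInMean (SubdiffusionDG.cutoff T σ J i V) := by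
  refine LipInMean.sum _ fun j hj => ?_
  obtain ⟨c, -, h⟩ := hV.exists_timePoly ((Finset.mem_range.1 hj).trans_le hi)
  have : indicator (slab T σ J j) V = indicator (slab T σ J j) (timePoly m c) :=
    indicator_congr h
  rw [this]
  exact lipInMean_indicator_timePoly m c (G.slab_nonempty j)

theorem LipInMean.dx {w : ℝ → H01 a b} (hw : LipInMean w) :
    LipInMean fun t => H01.dx (w t) := by
  obtain ⟨M, hM⟩ := hw.bdd
  obtain ⟨C, hC⟩ := hw.shift
  refine ⟨(H01.dxₗᵢ a b).continuous.comp_stronglyMeasurable hw.sm,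
    ⟨M, fun t => by rw [H01.norm_dx]; exact hM t⟩, ⟨C, fun h hh => ?_⟩⟩
  refine le_trans (le_of_eq (lintegral_congr fun t => ?_)) (hC h hh)
  rw [← map_sub, ← ofReal_norm, H01.norm_dx, ofReal_norm]

theorem MemW.integrableOn_inner (hU : MemW K n m T σ J U) (hV : MemW K n m T σ J V)
    {j : ℕ} (hj : j < J) :
    IntegrableOn (fun t => inner ℝ (H01.toL2 (deriv U t)) (H01.toL2 (V t))) (slab T σ J j) := by
  obtain ⟨c, -, h⟩ := hU.exists_timePoly hj
  obtain ⟨d, -, h'⟩ := hV.exists_timePoly hj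
  have hc : Continuous fun t =>
      inner ℝ (H01.toL2L a b (timePolyDeriv m c t)) (H01.toL2L a b (timePoly m d t)) :=
    ((H01.toL2L a b).continuous.comp (continuous_timePolyDeriv m c)).inner
      ((H01.toL2L a b).continuous.comp (continuous_timePoly m d))
  refine (hc.continuousOn.integrableOn_Icc.mono_set Ioo_subset_Icc_self).congr_fun
    (fun t ht => ?_) measurableSet_Ioo
  simp only [H01.toL2L_apply]
  rw [deriv_eq_of_eqOn h ht, h' ht]

theorem MemW.integrableOn_inner_dx (hV : MemW K n m T σ J V) (G : GridData T σ J)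
    {g : ℝ → L2 a b} (hg : IntegrableOn g (Ioo 0 T)) :
    IntegrableOn (fun t => inner ℝ (g t) (H01.dx (V t))) (Ioo 0 T) := by
  have hw := (hV.lipInMean_cutoff G le_rfl).dx
  obtain ⟨M, hM⟩ := hw.bdd
  have hae := G.cutoff_ae_eq J V
  rw [G.grid_last] at hae
  have : IntegrableOn (fun t => inner ℝ (g t) (H01.dx (SubdiffusionDG.cutoff T σ J J V t)))
      (Ioo 0 T) := by
    refine (hg.norm.mul_const M).mono' (hg.1.inner hw.sm.aestronglyMeasurable)
      (ae_of_all _ fun t => ?_)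
    exact (norm_inner_le_norm _ _).trans (mul_le_mul_of_nonneg_left (hM t) (norm_nonneg _))
  refine Integrable.congr this ?_
  filter_upwards [hae] with t ht
  rw [ht]

theorem MemW.integrableOn_apply (hV : MemW K n m T σ J V) (G : GridData T σ J)
    {f : ℝ → Hneg1 a b} (hf : IntegrableOn f (Ioo 0 T)) :
    IntegrableOn (fun t => f t (V t)) (Ioo 0 T) := by
  have hw := hV.lipInMean_cutoff G le_rfl
  obtain ⟨M, hM⟩ := hw.bdd
  have hae := G.cutoff_ae_eq J V
  rw [G.grid_last] at hae
  have : IntegrableOn (fun t => f t (SubdiffusionDG.cutoff T σ J J V t)) (Ioo 0 T) := by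
    refine (hf.norm.mul_const M).mono' ?_ (ae_of_all _ fun t => ?_)
    · exact (ContinuousLinearMap.id ℝ (Hneg1 a b)).aestronglyMeasurable_comp₂ hf.1
        hw.sm.aestronglyMeasurable
    · exact ((f t).le_opNorm _).trans (mul_le_mul_of_nonneg_left (hM t) (norm_nonneg _))
  refine Integrable.congr this ?_
  filter_upwards [hae] with t ht
  rw [ht]

end DiscreteSpace

/-! ### The bilinear form of the scheme and its coercivity -/

section Form

variable {a b : ℝ} {K : Partition a b} {n m : ℕ} {T σ : ℝ} {J : ℕ}
  {U U' V V' : ℝ → H01 a b} {g g' : ℝ → L2 a b}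

variable (T σ J) in
/-- The left-hand side of the scheme, with `g = (κ₁ D^α + κ₂ D^β) ∂ₓU`. -/
def dgForm (U : ℝ → H01 a b) (g : ℝ → L2 a b) (V : ℝ → H01 a b) : ℝ :=
  (∑ j ∈ Finset.range J, ∫ t in slab T σ J j,
      inner ℝ (H01.toL2 (deriv U t)) (H01.toL2 (V t)))
    + (∑ j ∈ Finset.range J,
      inner ℝ (H01.toL2 (jump T σ J U j)) (H01.toL2 (traceR T σ J V j)))
    + (∫ t in Ioo 0 T, inner ℝ (g t) (H01.dx (V t)))

theorem dgForm_congr (h : g =ᵐ[volume.restrict (Ioo 0 T)] g') :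
    dgForm T σ J U g V = dgForm T σ J U g' V := by
  unfold dgForm
  congr 1
  refine integral_congr_ae ?_
  filter_upwards [h] with t ht
  rw [ht]

theorem dgForm_add_left (G : GridData T σ J) (hU : MemW K n m T σ J U)
    (hU' : MemW K n m T σ J U') (hV : MemW K n m T σ J V) (hg : IntegrableOn g (Ioo 0 T))
    (hg' : IntegrableOn g' (Ioo 0 T)) :
    dgForm T σ J (U + U') (fun t => g t + g' t) V
      = dgForm T σ J U g V + dgForm T σ J U' g' V := by
  have e1 : ∑ j ∈ Finset.range J, ∫ t in slab T σ J j,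
      inner ℝ (H01.toL2 (deriv (U + U') t)) (H01.toL2 (V t))
      = (∑ j ∈ Finset.range J, ∫ t in slab T σ J j,
          inner ℝ (H01.toL2 (deriv U t)) (H01.toL2 (V t)))
        + ∑ j ∈ Finset.range J, ∫ t in slab T σ J j,
          inner ℝ (H01.toL2 (deriv U' t)) (H01.toL2 (V t)) := by
    rw [← Finset.sum_add_distrib]
    refine Finset.sum_congr rfl fun j hj => ?_
    have hj' := Finset.mem_range.1 hj
    rw [← integral_add (hU.integrableOn_inner hV hj') (hU'.integrableOn_inner hV hj')]
    refine setIntegral_congr_fun measurableSet_Ioo fun t ht => ?_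
    simp only [deriv_add_of_memW hU hU' hj' ht, map_add, inner_add_left]
  have e2 : ∑ j ∈ Finset.range J,
      inner ℝ (H01.toL2 (jump T σ J (U + U') j)) (H01.toL2 (traceR T σ J V j))
      = (∑ j ∈ Finset.range J,
          inner ℝ (H01.toL2 (jump T σ J U j)) (H01.toL2 (traceR T σ J V j)))
        + ∑ j ∈ Finset.range J,
          inner ℝ (H01.toL2 (jump T σ J U' j)) (H01.toL2 (traceR T σ J V j)) := by
    rw [← Finset.sum_add_distrib]
    refine Finset.sum_congr rfl fun j hj => ?_
    rw [jump_add G hU hU' (Finset.mem_range.1 hj), map_add, inner_add_left]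
  have e3 : ∫ t in Ioo 0 T, inner ℝ (g t + g' t) (H01.dx (V t))
      = (∫ t in Ioo 0 T, inner ℝ (g t) (H01.dx (V t)))
        + ∫ t in Ioo 0 T, inner ℝ (g' t) (H01.dx (V t)) := by
    rw [← integral_add (hV.integrableOn_inner_dx G hg) (hV.integrableOn_inner_dx G hg')]
    simp only [inner_add_left]
  rw [dgForm, dgForm, dgForm, e1, e2, e3]
  ring

theorem dgForm_smul_left (G : GridData T σ J) (hU : MemW K n m T σ J U) (r : ℝ) :
    dgForm T σ J (r • U) (fun t => r • g t) V = r * dgForm T σ J U g V := by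
  rw [dgForm, dgForm, mul_add, mul_add, Finset.mul_sum, Finset.mul_sum]
  congr 1
  · congr 1
    · refine Finset.sum_congr rfl fun j hj => ?_
      rw [← integral_const_mul]
      refine setIntegral_congr_fun measurableSet_Ioo fun t ht => ?_
      simp only [deriv_smul_of_memW hU r (Finset.mem_range.1 hj) ht, map_smul,
        real_inner_smul_left]
    · refine Finset.sum_congr rfl fun j hj => ?_
      rw [jump_smul G hU r (Finset.mem_range.1 hj), map_smul, real_inner_smul_left]
  · rw [← integral_const_mul]
    simp only [real_inner_smul_left]

theorem dgForm_add_right (G : GridData T σ J) (hU : MemW K n m T σ J U)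
    (hV : MemW K n m T σ J V) (hV' : MemW K n m T σ J V') (hg : IntegrableOn g (Ioo 0 T)) :
    dgForm T σ J U g (V + V') = dgForm T σ J U g V + dgForm T σ J U g V' := by
  have e1 : ∑ j ∈ Finset.range J, ∫ t in slab T σ J j,
      inner ℝ (H01.toL2 (deriv U t)) (H01.toL2 ((V + V') t))
      = (∑ j ∈ Finset.range J, ∫ t in slab T σ J j,
          inner ℝ (H01.toL2 (deriv U t)) (H01.toL2 (V t)))
        + ∑ j ∈ Finset.range J, ∫ t in slab T σ J j,
          inner ℝ (H01.toL2 (deriv U t)) (H01.toL2 (V' t)) := by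
    rw [← Finset.sum_add_distrib]
    refine Finset.sum_congr rfl fun j hj => ?_
    have hj' := Finset.mem_range.1 hj
    rw [← integral_add (hU.integrableOn_inner hV hj') (hU.integrableOn_inner hV' hj')]
    simp only [Pi.add_apply, map_add, inner_add_right]
  have e2 : ∑ j ∈ Finset.range J,
      inner ℝ (H01.toL2 (jump T σ J U j)) (H01.toL2 (traceR T σ J (V + V') j))
      = (∑ j ∈ Finset.range J,
          inner ℝ (H01.toL2 (jump T σ J U j)) (H01.toL2 (traceR T σ J V j)))
        + ∑ j ∈ Finset.range J,
          inner ℝ (H01.toL2 (jump T σ J U j)) (H01.toL2 (traceR T σ J V' j)) := by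
    rw [← Finset.sum_add_distrib]
    refine Finset.sum_congr rfl fun j hj => ?_
    rw [traceR_add G hV hV' (Finset.mem_range.1 hj), map_add, inner_add_right]
  have e3 : ∫ t in Ioo 0 T, inner ℝ (g t) (H01.dx ((V + V') t))
      = (∫ t in Ioo 0 T, inner ℝ (g t) (H01.dx (V t)))
        + ∫ t in Ioo 0 T, inner ℝ (g t) (H01.dx (V' t)) := by
    rw [← integral_add (hV.integrableOn_inner_dx G hg) (hV'.integrableOn_inner_dx G hg)]
    simp only [Pi.add_apply, map_add, inner_add_right]
  rw [dgForm, dgForm, dgForm, e1, e2, e3]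
  ring

theorem dgForm_smul_right (G : GridData T σ J) (hV : MemW K n m T σ J V) (r : ℝ) :
    dgForm T σ J U g (r • V) = r * dgForm T σ J U g V := by
  rw [dgForm, dgForm, mul_add, mul_add, Finset.mul_sum, Finset.mul_sum]
  congr 1
  · congr 1
    · refine Finset.sum_congr rfl fun j hj => ?_
      rw [← integral_const_mul]
      simp only [Pi.smul_apply, map_smul, real_inner_smul_right]
    · refine Finset.sum_congr rfl fun j hj => ?_
      rw [traceR_smul G hV r (Finset.mem_range.1 hj), map_smul, real_inner_smul_right]
  · rw [← integral_const_mul]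
    simp only [Pi.smul_apply, map_smul, real_inner_smul_right]

/-- The integrand is the derivative of `½ ‖U‖²`, and `U` extends to the closed interval as a
polynomial. -/
theorem integral_slab_inner_deriv (G : GridData T σ J) (hU : MemW K n m T σ J U) {j : ℕ}
    (hj : j < J) :
    ∫ t in slab T σ J j, inner ℝ (H01.toL2 (deriv U t)) (H01.toL2 (U t))
      = 2⁻¹ * ‖H01.toL2 (traceL T σ J U (j + 1))‖ ^ 2
        - 2⁻¹ * ‖H01.toL2 (traceR T σ J U j)‖ ^ 2 := by
  obtain ⟨c, -, h⟩ := hU.exists_timePoly hj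
  rw [traceR_eq_of_eqOn G h, traceL_succ_eq_of_eqOn G h]
  set P : ℝ → L2 a b := fun t => H01.toL2L a b (timePoly m c t) with hP
  set P' : ℝ → L2 a b := fun t => H01.toL2L a b (timePolyDeriv m c t) with hP'
  have hd : ∀ t, HasDerivAt P (P' t) t := fun t =>
    (H01.toL2L a b).hasFDerivAt.comp_hasDerivAt t (hasDerivAt_timePoly m c t)
  have hP'c : Continuous P' := (H01.toL2L a b).continuous.comp (continuous_timePolyDeriv m c)
  have hPc : Continuous P := (H01.toL2L a b).continuous.comp (continuous_timePoly m c)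
  have hsq : ∀ t, HasDerivAt (fun t => 2⁻¹ * ‖P t‖ ^ 2) (inner ℝ (P' t) (P t)) t := by
    intro t
    have := (hd t).norm_sq.const_mul (2⁻¹ : ℝ)
    rwa [← mul_assoc, inv_mul_cancel₀ two_ne_zero, one_mul, real_inner_comm] at this
  have hcongr : ∫ t in slab T σ J j, inner ℝ (H01.toL2 (deriv U t)) (H01.toL2 (U t))
      = ∫ t in slab T σ J j, inner ℝ (P' t) (P t) := by
    refine setIntegral_congr_fun measurableSet_Ioo fun t ht => ?_
    simp only [hP, hP', H01.toL2L_apply]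
    rw [deriv_eq_of_eqOn h ht, h ht]
  rw [hcongr, ← integral_Ioc_eq_integral_Ioo,
    ← intervalIntegral.integral_of_le (G.slab_nonempty j).le,
    intervalIntegral.integral_eq_sub_of_hasDerivAt (fun t _ => hsq t)
      ((hP'c.inner hPc).intervalIntegrable _ _)]
  rfl

theorem energy_identity (G : GridData T σ J) (hU : MemW K n m T σ J U) {i : ℕ} (hi : i ≤ J) :
    (∑ j ∈ Finset.range i, ∫ t in slab T σ J j,
      inner ℝ (H01.toL2 (deriv U t)) (H01.toL2 (U t)))
    + (∑ j ∈ Finset.range i,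
      inner ℝ (H01.toL2 (jump T σ J U j)) (H01.toL2 (traceR T σ J U j)))
    = 2⁻¹ * ‖H01.toL2 (traceL T σ J U i)‖ ^ 2
      + ∑ j ∈ Finset.range i, 2⁻¹ * ‖H01.toL2 (jump T σ J U j)‖ ^ 2 := by
  induction i with
  | zero => simp [traceL_zero]
  | succ i ih =>
    have h := ih (Nat.le_of_succ_le hi)
    rw [Finset.sum_range_succ, Finset.sum_range_succ, Finset.sum_range_succ,
      integral_slab_inner_deriv G hU hi]
    -- The left trace is the right trace minus the jump; expanding the square makes consecutive
    -- intervals telescope.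
    have e : ‖H01.toL2 (traceL T σ J U i)‖ ^ 2 = ‖H01.toL2 (traceR T σ J U i)‖ ^ 2
        - 2 * inner ℝ (H01.toL2 (jump T σ J U i)) (H01.toL2 (traceR T σ J U i))
        + ‖H01.toL2 (jump T σ J U i)‖ ^ 2 := by
      have : traceL T σ J U i = traceR T σ J U i - jump T σ J U i := by rw [jump]; abel
      rw [this, map_sub, norm_sub_sq_real, real_inner_comm]
    rw [e] at h
    linarith

/-- Of the jump terms only the one at `0` is kept: as the left trace there is zero, it is the full
initial trace. -/
theorem energy_lower_bound (G : GridData T σ J) (hU : MemW K n m T σ J U) {i : ℕ}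
    (h1 : 1 ≤ i) (hi : i ≤ J) :
    2⁻¹ * ‖H01.toL2 (traceL T σ J U i)‖ ^ 2 + 2⁻¹ * ‖H01.toL2 (traceR T σ J U 0)‖ ^ 2
    ≤ (∑ j ∈ Finset.range i, ∫ t in slab T σ J j,
      inner ℝ (H01.toL2 (deriv U t)) (H01.toL2 (U t)))
    + (∑ j ∈ Finset.range i,
      inner ℝ (H01.toL2 (jump T σ J U j)) (H01.toL2 (traceR T σ J U j))) := by
  rw [energy_identity G hU hi]
  have h0 : traceR T σ J U 0 = jump T σ J U 0 := by rw [jump, traceL_zero, sub_zero]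
  rw [h0]
  gcongr
  exact Finset.single_le_sum (f := fun j => 2⁻¹ * ‖H01.toL2 (jump T σ J U j)‖ ^ 2)
    (fun j _ => by positivity) (Finset.mem_range.2 h1)

theorem traceR_cutoff_of_lt (G : GridData T σ J) (hU : MemW K n m T σ J U) {i j : ℕ}
    (hji : j < i) (hj : j < J) : traceR T σ J (cutoff T σ J i U) j = traceR T σ J U j := by
  obtain ⟨c, -, h⟩ := hU.exists_timePoly hj
  rw [traceR_eq_of_eqOn G h]
  exact traceR_eq_of_eqOn G fun t ht => by rw [G.cutoff_of_mem hji U ht, h ht]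

theorem traceR_cutoff_of_le (G : GridData T σ J) (U : ℝ → H01 a b) {i j : ℕ} (hij : i ≤ j) :
    traceR T σ J (cutoff T σ J i U) j = 0 := by
  have : EqOn (cutoff T σ J i U) (timePoly 0 0) (slab T σ J j) := fun t ht => by
    rw [G.cutoff_of_le hij U ht]
    simp [timePoly]
  rw [traceR_eq_of_eqOn G this]
  simp [timePoly]

theorem integral_Ioo_cutoff {E : Type*} [NormedAddCommGroup E] [NormedSpace ℝ E]
    (G : GridData T σ J) (F : ℝ → H01 a b → E) (hF : ∀ t, F t 0 = 0) {i : ℕ} (hi : i ≤ J)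
    (U : ℝ → H01 a b) :
    ∫ t in Ioo 0 T, F t (cutoff T σ J i U t) = ∫ t in Ioo 0 (grid T σ J i), F t (U t) := by
  rw [setIntegral_eq_of_subset_of_forall_sdiff_eq_zero measurableSet_Ioo
    (Ioo_subset_Ioo_right (G.grid_le hi)) fun t ht => by
      rw [G.cutoff_of_notMem U ht.2, hF]]
  refine integral_congr_ae ?_
  filter_upwards [G.cutoff_ae_eq i U] with t ht
  rw [← ht]

/-- The cutoff solution is an admissible test function, and no term after `t_i` survives. -/
theorem dgForm_cutoff (G : GridData T σ J) (hU : MemW K n m T σ J U) {i : ℕ} (hi : i ≤ J) :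
    dgForm T σ J U g (cutoff T σ J i U)
    = (∑ j ∈ Finset.range i, ∫ t in slab T σ J j,
        inner ℝ (H01.toL2 (deriv U t)) (H01.toL2 (U t)))
      + (∑ j ∈ Finset.range i,
        inner ℝ (H01.toL2 (jump T σ J U j)) (H01.toL2 (traceR T σ J U j)))
      + ∫ t in Ioo 0 (grid T σ J i), inner ℝ (g t) (H01.dx (U t)) := by
  rw [dgForm]
  congr 1
  · congr 1
    · rw [← Finset.sum_subset (Finset.range_mono hi) fun j _ hj => ?_]
      · refine Finset.sum_congr rfl fun j hj => ?_
        refine setIntegral_congr_fun measurableSet_Ioo fun t ht => ?_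
        simp only [G.cutoff_of_mem (Finset.mem_range.1 hj) U ht]
      · refine setIntegral_eq_zero_of_forall_eq_zero fun t ht => ?_
        rw [G.cutoff_of_le (not_lt.1 fun h => hj (Finset.mem_range.2 h)) U ht, map_zero,
          inner_zero_right]
    · rw [← Finset.sum_subset (Finset.range_mono hi) fun j _ hj => ?_]
      · refine Finset.sum_congr rfl fun j hj => ?_
        have := Finset.mem_range.1 hj
        rw [traceR_cutoff_of_lt G hU this (this.trans_le hi)]
      · rw [traceR_cutoff_of_le G U (not_lt.1 fun h => hj (Finset.mem_range.2 h)), map_zero,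
          inner_zero_right]
  · exact integral_Ioo_cutoff G (fun t v => inner ℝ (g t) (H01.dx v))
      (fun t => by rw [map_zero, inner_zero_right]) hi U

/-- Causality: the value at `t` involves `w` only up to time `t`. -/
theorem marchaud_congr {E : Type*} [NormedAddCommGroup E] [NormedSpace ℝ E] {γ s : ℝ}
    {w w' : ℝ → E} (h : EqOn w w' (Ioo 0 s)) : EqOn (marchaud γ w) (marchaud γ w') (Ioo 0 s) := by
  intro t ht
  rw [marchaud, marchaud, h ht]
  congr 3
  refine setIntegral_congr_fun measurableSet_Ioo fun r hr => ?_
  rw [h ⟨sub_pos.2 hr.2, by linarith [hr.1, ht.2]⟩]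

theorem MemW.isRLDeriv_marchaud (hU : MemW K n m T σ J U) (G : GridData T σ J) {γ : ℝ}
    (h0 : 0 < γ) (h1 : γ < 1) :
    IsRLDeriv γ T (fun t => H01.dx (U t))
      (marchaud γ fun t => H01.dx (SubdiffusionDG.cutoff T σ J J U t)) := by
  refine ((hU.lipInMean_cutoff G le_rfl).dx.isRLDeriv_marchaud h0 h1 T).congr ?_
  have hae := G.cutoff_ae_eq J U
  rw [G.grid_last] at hae
  filter_upwards [hae] with t ht
  rw [← ht]

/-- By uniqueness of weak derivatives and causality, the derivative on `(0, T)` coincides on `(0,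
t_i)` with that of the function truncated at `t_i`. So the coercivity estimates apply at every grid
time. -/
theorem ae_eq_marchaud_cutoff (hU : MemW K n m T σ J U) (G : GridData T σ J) {γ : ℝ}
    (h0 : 0 < γ) (h1 : γ < 1) (hg : IsRLDeriv γ T (fun t => H01.dx (U t)) g) {i : ℕ}
    (hi : i ≤ J) :
    (fun t => inner ℝ (g t) (H01.dx (U t))) =ᵐ[volume.restrict (Ioo 0 (grid T σ J i))]
      fun t => inner ℝ (marchaud γ (fun t => H01.dx (cutoff T σ J i U t)) t)
        (H01.dx (cutoff T σ J i U t)) := by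
  have h2 : g =ᵐ[volume.restrict (Ioo 0 T)]
      marchaud γ fun t => H01.dx (cutoff T σ J J U t) :=
    IsWeakDeriv.ae_eq hg (hU.isRLDeriv_marchaud G h0 h1)
  have h3 : EqOn (marchaud γ fun t => H01.dx (cutoff T σ J J U t))
      (marchaud γ fun t => H01.dx (cutoff T σ J i U t)) (Ioo 0 (grid T σ J i)) :=
    marchaud_congr fun t ht => by simp only [G.cutoff_eq_cutoff hi U ht]
  filter_upwards [ae_restrict_of_ae_restrict_of_subset (Ioo_subset_Ioo_right (G.grid_le hi)) h2,
    G.cutoff_ae_eq i U, ae_restrict_mem measurableSet_Ioo] with t k1 k2 k3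
  rw [k1, h3 k3, ← k2]

theorem coercivity_nonneg (hU : MemW K n m T σ J U) (G : GridData T σ J) {γ : ℝ}
    (h0 : 0 < γ) (h1 : γ < 1) (hg : IsRLDeriv γ T (fun t => H01.dx (U t)) g) {i : ℕ}
    (hi1 : 1 ≤ i) (hi : i ≤ J) :
    0 ≤ ∫ t in Ioo 0 (grid T σ J i), inner ℝ (g t) (H01.dx (U t)) := by
  rw [integral_congr_ae (ae_eq_marchaud_cutoff hU G h0 h1 hg hi)]
  exact integral_marchaud_inner_nonneg h0 h1 (hU.lipInMean_cutoff G hi).dx (G.grid_pos hi1)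

theorem coercivity_weighted (hU : MemW K n m T σ J U) (G : GridData T σ J) {γ : ℝ}
    (h0 : 0 < γ) (h1 : γ < 1) (hg : IsRLDeriv γ T (fun t => H01.dx (U t)) g) {i : ℕ}
    (hi1 : 1 ≤ i) (hi : i ≤ J) :
    ∫⁻ t in Ioo 0 (grid T σ J i), ENNReal.ofReal (t ^ (-γ)) * ‖U t‖ₑ ^ 2
      ≤ ENNReal.ofReal (2 * Real.Gamma (1 - γ) *
        ∫ t in Ioo 0 (grid T σ J i), inner ℝ (g t) (H01.dx (U t))) := by
  rw [integral_congr_ae (ae_eq_marchaud_cutoff hU G h0 h1 hg hi)]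
  refine le_trans (le_of_eq ?_) (lintegral_rpow_mul_norm_sq_le h0 h1
    (hU.lipInMean_cutoff G hi).dx (G.grid_pos hi1))
  refine lintegral_congr_ae ?_
  filter_upwards [G.cutoff_ae_eq i U] with t ht
  rw [← ht, ← ofReal_norm (H01.dx _), H01.norm_dx, ofReal_norm]

theorem coercivity_fracSeminorm (hU : MemW K n m T σ J U) (G : GridData T σ J) {γ : ℝ}
    (h0 : 0 < γ) (h1 : γ < 1) (hg : IsRLDeriv γ T (fun t => H01.dx (U t)) g) {i : ℕ}
    (hi1 : 1 ≤ i) (hi : i ≤ J) {ι : Type} [Countable ι] (e : HilbertBasis ι ℝ (H01 a b)) :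
    fracSeminorm e (γ / 2) (grid T σ J i) U ^ 2
      ≤ ENNReal.ofReal ((2 * Real.pi) ^ γ * (4 / γ * Real.Gamma (1 - γ)) *
        ∫ t in Ioo 0 (grid T σ J i), inner ℝ (g t) (H01.dx (U t))) := by
  have hw := hU.lipInMean_cutoff G hi
  obtain ⟨M, hM⟩ := hw.bdd
  refine (fracSeminorm_sq_le h0 e hw.sm hM (G.indicator_ae_eq_cutoff i U)).trans ?_
  have he : translateEnergy γ (cutoff T σ J i U)
      = translateEnergy γ fun t => H01.dx (cutoff T σ J i U t) := by
    simp only [translateEnergy, ← map_sub]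
    refine lintegral_congr fun h => ?_
    congr 1
    refine lintegral_congr fun t => ?_
    rw [← ofReal_norm (H01.dx _), H01.norm_dx, ofReal_norm]
  rw [he, mul_assoc, ENNReal.ofReal_mul (by positivity),
    integral_congr_ae (ae_eq_marchaud_cutoff hU G h0 h1 hg hi)]
  refine mul_le_mul_right (translateEnergy_le h0 h1 hw.dx (G.grid_pos hi1) fun t ht => ?_) _
  rw [G.cutoff_of_notMem U ht, map_zero]

end Form

/-! ### Unique solvability -/

section Solvability

variable {a b : ℝ} {K : Partition a b} {n m : ℕ} {T σ : ℝ} {J : ℕ}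
  {α β γ κ₁ κ₂ : ℝ} {U U' V : ℝ → H01 a b} {g g' gα gβ : ℝ → L2 a b}

theorem IsRLDeriv.add_of_memW (G : GridData T σ J) (h1 : γ < 1) (hU : MemW K n m T σ J U)
    (hU' : MemW K n m T σ J U') (h : IsRLDeriv γ T (fun t => H01.dx (U t)) g)
    (h' : IsRLDeriv γ T (fun t => H01.dx (U' t)) g') :
    IsRLDeriv γ T (fun t => H01.dx ((U + U') t)) (fun t => g t + g' t) := by
  have hae : ∀ W : ℝ → H01 a b, (fun t => H01.dx (W t)) =ᵐ[volume.restrict (Ioo 0 T)]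
      fun t => H01.dx (cutoff T σ J J W t) := by
    intro W
    have := G.cutoff_ae_eq J W
    rw [G.grid_last] at this
    filter_upwards [this] with t ht
    rw [← ht]
  have := IsRLDeriv.add h1 (hae U) (hae U') (hU.lipInMean_cutoff G le_rfl).dx
    (hU'.lipInMean_cutoff G le_rfl).dx h h'
  simpa only [Pi.add_apply, map_add] using this

theorem IsRLDeriv.smul_of_memW (h : IsRLDeriv γ T (fun t => H01.dx (U t)) g) (r : ℝ) :
    IsRLDeriv γ T (fun t => H01.dx ((r • U) t)) (fun t => r • g t) := by
  have := h.const_smul r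
  simpa only [Pi.smul_apply, map_smul] using this

theorem integral_inner_combination (G : GridData T σ J) (hU : MemW K n m T σ J U)
    (hα : IntegrableOn gα (Ioo 0 T)) (hβ : IntegrableOn gβ (Ioo 0 T)) {i : ℕ} (hi : i ≤ J) :
    ∫ t in Ioo 0 (grid T σ J i), inner ℝ (κ₁ • gα t + κ₂ • gβ t) (H01.dx (U t))
      = κ₁ * (∫ t in Ioo 0 (grid T σ J i), inner ℝ (gα t) (H01.dx (U t)))
        + κ₂ * ∫ t in Ioo 0 (grid T σ J i), inner ℝ (gβ t) (H01.dx (U t)) := by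
  have hs : Ioo 0 (grid T σ J i) ⊆ Ioo 0 T := Ioo_subset_Ioo_right (G.grid_le hi)
  have i1 := ((hU.integrableOn_inner_dx G hα).mono_set hs).const_mul κ₁
  have i2 := ((hU.integrableOn_inner_dx G hβ).mono_set hs).const_mul κ₂
  rw [← integral_const_mul, ← integral_const_mul, ← integral_add i1 i2]
  simp only [inner_add_left, real_inner_smul_left]

theorem eqOn_zero_of_ae_eq_zero (hU : MemW K n m T σ J U) {j : ℕ} (hj : j < J)
    (h : ∀ᵐ t ∂volume.restrict (slab T σ J j), U t = 0) : ∀ t ∈ slab T σ J j, U t = 0 := by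
  obtain ⟨c, -, hc⟩ := hU.exists_timePoly hj
  have hae : timePoly m c =ᵐ[volume.restrict (slab T σ J j)] fun _ => 0 := by
    filter_upwards [h, ae_restrict_mem measurableSet_Ioo] with t h1 h2
    rw [← hc h2, h1]
  have := Measure.eqOn_open_of_ae_eq hae isOpen_Ioo (continuous_timePoly m c).continuousOn
    continuousOn_const
  intro t ht
  rw [hc ht, this ht]

/-- All contributions to the energy are nonnegative, so the `β`-term vanishes. The weighted norm of
`U` is then zero, and continuity of polynomials upgrades almost everywhere to everywhere on each
interval. -/
theorem eq_zero_of_dgForm_eq_zero (G : GridData T σ J) (hα0 : 0 < α) (hα1 : α < 1)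
    (hβ0 : 0 < β) (hβ1 : β < 1) (hκ₁ : 0 < κ₁) (hκ₂ : 0 < κ₂) (hU : MemW K n m T σ J U)
    (hα : IsRLDeriv α T (fun t => H01.dx (U t)) gα)
    (hβ : IsRLDeriv β T (fun t => H01.dx (U t)) gβ)
    (h : dgForm T σ J U (fun t => κ₁ • gα t + κ₂ • gβ t) (cutoff T σ J J U) = 0) :
    ∀ j < J, ∀ t ∈ slab T σ J j, U t = 0 := by
  rw [dgForm_cutoff G hU le_rfl, integral_inner_combination G hU hα.2.1 hβ.2.1 le_rfl] at h
  have hJ : 1 ≤ J := G.J_pos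
  have e1 := energy_lower_bound G hU hJ le_rfl
  have q1 := coercivity_nonneg hU G hα0 hα1 hα hJ le_rfl
  have q2 := coercivity_nonneg hU G hβ0 hβ1 hβ hJ le_rfl
  have q3 := coercivity_weighted hU G hβ0 hβ1 hβ hJ le_rfl
  have hz : ∫ t in Ioo 0 (grid T σ J J), inner ℝ (gβ t) (H01.dx (U t)) = 0 := by
    have p1 := mul_nonneg hκ₁.le q1
    have p2 : κ₂ * ∫ t in Ioo 0 (grid T σ J J), inner ℝ (gβ t) (H01.dx (U t)) ≤ 0 := by
      have : 0 ≤ 2⁻¹ * ‖H01.toL2 (traceL T σ J U J)‖ ^ 2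
        + 2⁻¹ * ‖H01.toL2 (traceR T σ J U 0)‖ ^ 2 := by positivity
      linarith
    exact le_antisymm (nonpos_of_mul_nonpos_right p2 hκ₂) q2
  rw [hz, mul_zero, ENNReal.ofReal_zero, nonpos_iff_eq_zero, lintegral_eq_zero_iff'] at q3
  · intro j hj
    refine eqOn_zero_of_ae_eq_zero hU hj ?_
    filter_upwards [ae_restrict_of_ae_restrict_of_subset (G.slab_subset hj) q3,
      ae_restrict_mem measurableSet_Ioo] with t h1 h2
    have ht : 0 < t := (G.grid_nonneg j).trans_lt h2.1
    rcases mul_eq_zero.1 h1 with h3 | h3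
    · exact absurd (ENNReal.ofReal_eq_zero.1 h3) (not_le.2 (Real.rpow_pos_of_pos ht _))
    · exact enorm_eq_zero.1 (pow_eq_zero_iff two_ne_zero |>.1 h3)
  · have hm : AEStronglyMeasurable U (volume.restrict (Ioo 0 (grid T σ J J))) :=
      (hU.lipInMean_cutoff G le_rfl).sm.aestronglyMeasurable.congr (G.cutoff_ae_eq J U).symm
    exact ((measurable_id.pow_const _).ennreal_ofReal.aemeasurable).mul (hm.enorm.pow_const 2)

variable (K n m T σ J) in
/-- The functions of the discrete space that vanish outside the open time intervals. -/
def normalizedW : Submodule ℝ (ℝ → H01 a b) where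
  carrier := {V | MemW K n m T σ J V ∧ ∀ t, (∀ j < J, t ∉ slab T σ J j) → V t = 0}
  zero_mem' := ⟨fun _ _ => ⟨0, fun _ => (Sh K n).zero_mem, fun _ _ => by simp⟩, fun _ _ => rfl⟩
  add_mem' := by
    rintro V W ⟨h1, h2⟩ ⟨h3, h4⟩
    refine ⟨h1.add h3, fun t ht => ?_⟩
    rw [Pi.add_apply, h2 t ht, h4 t ht, add_zero]
  smul_mem' := by
    rintro r V ⟨h1, h2⟩
    refine ⟨h1.const_smul r, fun t ht => ?_⟩
    rw [Pi.smul_apply, h2 t ht, smul_zero]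

variable (K n m T σ J) in
/-- The parametrization of the discrete space by coefficients. -/
def coeffMap : (Fin J → Fin (m + 1) → Sh K n) →ₗ[ℝ] (ℝ → H01 a b) :=
  LinearMap.pi fun t => ∑ j : Fin J, ∑ k : Fin (m + 1),
    (indicator (slab T σ J j) (fun t => t ^ (k : ℕ)) t) •
      ((Sh K n).subtype ∘ₗ LinearMap.proj k ∘ₗ LinearMap.proj j)

theorem normalizedW_le_range (G : GridData T σ J) :
    normalizedW K n m T σ J ≤ LinearMap.range (coeffMap K n m T σ J) := by
  rintro V ⟨hV, hV0⟩
  choose c hc hVc using hV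
  refine ⟨fun j k => ⟨c j j.2 k, hc j j.2 k⟩, funext fun t => ?_⟩
  simp only [coeffMap, LinearMap.pi_apply, LinearMap.sum_apply, LinearMap.smul_apply,
    LinearMap.comp_apply, LinearMap.proj_apply, Submodule.subtype_apply]
  by_cases ht : ∃ j < J, t ∈ slab T σ J j
  · obtain ⟨j, hj, htj⟩ := ht
    rw [hVc j hj t htj, Finset.sum_eq_single (⟨j, hj⟩ : Fin J)]
    · simp only [indicator_of_mem htj]
      rw [Finset.sum_range]
    · intro i _ hi
      refine Finset.sum_eq_zero fun k _ => ?_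
      rw [indicator_of_notMem, zero_smul]
      exact fun h => hi (Fin.ext (G.slab_disjoint h htj))
    · simp
  · push Not at ht
    rw [hV0 t ht]
    refine Finset.sum_eq_zero fun j _ => Finset.sum_eq_zero fun k _ => ?_
    rw [indicator_of_notMem (ht j j.2), zero_smul]

/-- The normalization is essential: otherwise values at grid points and outside `(0, T)` would be
free, and the space infinite dimensional. -/
theorem finiteDimensional_normalizedW (G : GridData T σ J) :
    FiniteDimensional ℝ (normalizedW K n m T σ J) :=
  Submodule.finiteDimensional_of_le (normalizedW_le_range G)

theorem cutoff_mem_normalizedW (G : GridData T σ J) (hV : MemW K n m T σ J V) :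
    cutoff T σ J J V ∈ normalizedW K n m T σ J := by
  refine ⟨hV.cutoff G J, fun t ht => Finset.sum_eq_zero fun j hj => ?_⟩
  exact indicator_of_notMem (ht j (Finset.mem_range.1 hj)) _

variable (T σ J α β κ₁ κ₂) in
/-- `(κ₁ D^α + κ₂ D^β) ∂ₓU` in Marchaud form. -/
def rlFlux (U : ℝ → H01 a b) (t : ℝ) : L2 a b :=
  κ₁ • marchaud α (fun t => H01.dx (cutoff T σ J J U t)) t
    + κ₂ • marchaud β (fun t => H01.dx (cutoff T σ J J U t)) t

theorem integrableOn_rlFlux (G : GridData T σ J) (hα1 : α < 1) (hβ1 : β < 1)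
    (hU : MemW K n m T σ J U) : IntegrableOn (rlFlux T σ J α β κ₁ κ₂ U) (Ioo 0 T) :=
  ((integrableOn_marchaud hα1 (hU.lipInMean_cutoff G le_rfl).dx T).smul κ₁).add
    ((integrableOn_marchaud hβ1 (hU.lipInMean_cutoff G le_rfl).dx T).smul κ₂)

/-- Additivity comes from uniqueness of weak derivatives and hence only almost everywhere, which
suffices inside `dgForm`. -/
theorem rlFlux_add (G : GridData T σ J) (hα0 : 0 < α) (hα1 : α < 1) (hβ0 : 0 < β) (hβ1 : β < 1)
    (hU : MemW K n m T σ J U) (hU' : MemW K n m T σ J U') :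
    rlFlux T σ J α β κ₁ κ₂ (U + U') =ᵐ[volume.restrict (Ioo 0 T)]
      fun t => rlFlux T σ J α β κ₁ κ₂ U t + rlFlux T σ J α β κ₁ κ₂ U' t := by
  have key : ∀ γ : ℝ, 0 < γ → γ < 1 →
      marchaud γ (fun t => H01.dx (cutoff T σ J J (U + U') t)) =ᵐ[volume.restrict (Ioo 0 T)]
        fun t => marchaud γ (fun t => H01.dx (cutoff T σ J J U t)) t
          + marchaud γ (fun t => H01.dx (cutoff T σ J J U' t)) t := fun γ h0 h1 =>
    IsWeakDeriv.ae_eq ((hU.add hU').isRLDeriv_marchaud G h0 h1)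
      (IsRLDeriv.add_of_memW G h1 hU hU' (hU.isRLDeriv_marchaud G h0 h1)
        (hU'.isRLDeriv_marchaud G h0 h1))
  filter_upwards [key α hα0 hα1, key β hβ0 hβ1] with t h1 h2
  rw [rlFlux, rlFlux, rlFlux, h1, h2, smul_add, smul_add]
  abel

theorem rlFlux_smul (G : GridData T σ J) (hα0 : 0 < α) (hα1 : α < 1) (hβ0 : 0 < β) (hβ1 : β < 1)
    (hU : MemW K n m T σ J U) (r : ℝ) :
    rlFlux T σ J α β κ₁ κ₂ (r • U) =ᵐ[volume.restrict (Ioo 0 T)]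
      fun t => r • rlFlux T σ J α β κ₁ κ₂ U t := by
  have key : ∀ γ : ℝ, 0 < γ → γ < 1 →
      marchaud γ (fun t => H01.dx (cutoff T σ J J (r • U) t)) =ᵐ[volume.restrict (Ioo 0 T)]
        fun t => r • marchaud γ (fun t => H01.dx (cutoff T σ J J U t)) t := fun γ h0 h1 =>
    IsWeakDeriv.ae_eq ((hU.const_smul r).isRLDeriv_marchaud G h0 h1)
      (IsRLDeriv.smul_of_memW (hU.isRLDeriv_marchaud G h0 h1) r)
  filter_upwards [key α hα0 hα1, key β hβ0 hβ1] with t h1 h2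
  rw [rlFlux, rlFlux, h1, h2, smul_add, smul_comm r κ₁, smul_comm r κ₂]

variable (K n m) in
/-- The bilinear form of the scheme on the discrete space. -/
def schemeForm (G : GridData T σ J) (hα0 : 0 < α) (hα1 : α < 1) (hβ0 : 0 < β) (hβ1 : β < 1)
    (κ₁ κ₂ : ℝ) :
    normalizedW K n m T σ J →ₗ[ℝ] normalizedW K n m T σ J →ₗ[ℝ] ℝ :=
  LinearMap.mk₂ ℝ (fun U V => dgForm T σ J (U : ℝ → H01 a b) (rlFlux T σ J α β κ₁ κ₂ U) V)
    (fun U U' V => by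
      rw [Submodule.coe_add, dgForm_congr (rlFlux_add G hα0 hα1 hβ0 hβ1 U.2.1 U'.2.1)]
      exact dgForm_add_left G U.2.1 U'.2.1 V.2.1 (integrableOn_rlFlux G hα1 hβ1 U.2.1)
        (integrableOn_rlFlux G hα1 hβ1 U'.2.1))
    (fun r U V => by
      rw [Submodule.coe_smul, dgForm_congr (rlFlux_smul G hα0 hα1 hβ0 hβ1 U.2.1 r)]
      exact dgForm_smul_left G U.2.1 r)
    (fun U V V' => dgForm_add_right G U.2.1 V.2.1 V'.2.1 (integrableOn_rlFlux G hα1 hβ1 U.2.1))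
    (fun r U V => dgForm_smul_right G V.2.1 r)

variable (K n m) in
/-- The right-hand side of the scheme on the discrete space. -/
def schemeRhs (G : GridData T σ J) (r : H01 a b) {f : ℝ → Hneg1 a b}
    (hf : IntegrableOn f (Ioo 0 T)) : normalizedW K n m T σ J →ₗ[ℝ] ℝ where
  toFun V := inner ℝ (H01.toL2 r) (H01.toL2 (traceR T σ J V 0)) + ∫ t in Ioo 0 T, f t (V.1 t)
  map_add' V V' := by
    rw [Submodule.coe_add, traceR_add G V.2.1 V'.2.1 G.J_pos, map_add, inner_add_right]
    simp only [Pi.add_apply, map_add]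
    rw [integral_add (V.2.1.integrableOn_apply G hf) (V'.2.1.integrableOn_apply G hf)]
    ring
  map_smul' c V := by
    rw [Submodule.coe_smul, traceR_smul G V.2.1 c G.J_pos, map_smul, real_inner_smul_right]
    simp only [Pi.smul_apply, map_smul, smul_eq_mul, RingHom.id_apply]
    rw [integral_const_mul]
    ring

theorem schemeForm_injective (G : GridData T σ J) (hα0 : 0 < α) (hα1 : α < 1) (hβ0 : 0 < β)
    (hβ1 : β < 1) (hκ₁ : 0 < κ₁) (hκ₂ : 0 < κ₂) :
    Function.Injective (schemeForm K n m G hα0 hα1 hβ0 hβ1 κ₁ κ₂) := by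
  rw [← LinearMap.ker_eq_bot, LinearMap.ker_eq_bot']
  intro U hU
  have h0 : dgForm T σ J (U : ℝ → H01 a b) (rlFlux T σ J α β κ₁ κ₂ U)
      (cutoff T σ J J (U : ℝ → H01 a b)) = 0 :=
    LinearMap.congr_fun hU ⟨_, cutoff_mem_normalizedW G U.2.1⟩
  have hz := eq_zero_of_dgForm_eq_zero G hα0 hα1 hβ0 hβ1 hκ₁ hκ₂ U.2.1
    (U.2.1.isRLDeriv_marchaud G hα0 hα1) (U.2.1.isRLDeriv_marchaud G hβ0 hβ1) h0
  refine Subtype.ext (funext fun t => ?_)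
  by_cases ht : ∃ j < J, t ∈ slab T σ J j
  · obtain ⟨j, hj, htj⟩ := ht
    exact hz j hj t htj
  · push Not at ht
    exact U.2.2 t ht

theorem dgForm_cutoff_right (G : GridData T σ J) (U : ℝ → H01 a b) (g : ℝ → L2 a b)
    (hV : MemW K n m T σ J V) :
    dgForm T σ J U g (cutoff T σ J J V) = dgForm T σ J U g V := by
  rw [dgForm, dgForm]
  congr 1
  · congr 1
    · refine Finset.sum_congr rfl fun j hj => ?_
      refine setIntegral_congr_fun measurableSet_Ioo fun t ht => ?_
      simp only [G.cutoff_of_mem (Finset.mem_range.1 hj) V ht]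
    · refine Finset.sum_congr rfl fun j hj => ?_
      have := Finset.mem_range.1 hj
      rw [traceR_cutoff_of_lt G hV this this]
  · rw [integral_Ioo_cutoff G (fun t v => inner ℝ (g t) (H01.dx v))
      (fun t => by rw [map_zero, inner_zero_right]) le_rfl V, G.grid_last]

/-- An injective map from a finite-dimensional space to its dual is onto. Normalized test functions
suffice, since neither side of the scheme changes when a test function is truncated to the time
intervals. -/
theorem exists_solves (G : GridData T σ J) (hα0 : 0 < α) (hα1 : α < 1) (hβ0 : 0 < β)
    (hβ1 : β < 1) (hκ₁ : 0 < κ₁) (hκ₂ : 0 < κ₂) (u₀ : H01 a b) {f : ℝ → Hneg1 a b}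
    (hf : IntegrableOn f (Ioo 0 T)) :
    ∃ U, Solves K n m T σ J α β κ₁ κ₂ u₀ f U := by
  obtain ⟨r, hr, -⟩ := exists_isRitz K n u₀
  have := finiteDimensional_normalizedW (K := K) (n := n) (m := m) G
  have hsurj : Function.Surjective (schemeForm K n m G hα0 hα1 hβ0 hβ1 κ₁ κ₂) :=
    (LinearMap.injective_iff_surjective_of_finrank_eq_finrank
      (Subspace.dual_finrank_eq (K := ℝ) (V := normalizedW K n m T σ J)).symm).1
      (schemeForm_injective G hα0 hα1 hβ0 hβ1 hκ₁ hκ₂)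
  obtain ⟨U, hU⟩ := hsurj (schemeRhs K n m G r hf)
  refine ⟨U, U.2.1, r, _, _, hr, U.2.1.isRLDeriv_marchaud G hα0 hα1,
    U.2.1.isRLDeriv_marchaud G hβ0 hβ1, fun V hV => ?_⟩
  have h := LinearMap.congr_fun hU ⟨_, cutoff_mem_normalizedW G hV⟩
  change dgForm T σ J (U : ℝ → H01 a b) (rlFlux T σ J α β κ₁ κ₂ U) (cutoff T σ J J V)
    = inner ℝ (H01.toL2 r) (H01.toL2 (traceR T σ J (cutoff T σ J J V) 0))
      + ∫ t in Ioo 0 T, f t (cutoff T σ J J V t) at h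
  rw [dgForm_cutoff_right G _ _ hV, traceR_cutoff_of_lt G hV G.J_pos G.J_pos,
    integral_Ioo_cutoff G (fun t v => f t v) (fun t => map_zero _) le_rfl V, G.grid_last] at h
  exact h

theorem Solves.eqOn (G : GridData T σ J) (hα0 : 0 < α) (hα1 : α < 1) (hβ0 : 0 < β)
    (hβ1 : β < 1) (hκ₁ : 0 < κ₁) (hκ₂ : 0 < κ₂) {u₀ : H01 a b} {f : ℝ → Hneg1 a b}
    (hU : Solves K n m T σ J α β κ₁ κ₂ u₀ f U) (hU' : Solves K n m T σ J α β κ₁ κ₂ u₀ f U') :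
    ∀ j < J, EqOn U' U (slab T σ J j) := by
  obtain ⟨hW, r, gα, gβ, hr, hα, hβ, h⟩ := hU
  obtain ⟨hW', r', gα', gβ', hr', hα', hβ', h'⟩ := hU'
  obtain rfl := hr.unique hr'
  -- The difference is written as a sum with a scalar multiple, so that only the additivity and
  -- homogeneity lemmas are needed.
  have hWd : MemW K n m T σ J (U' + (-1 : ℝ) • U) := hW'.add (hW.const_smul _)
  have dα := IsRLDeriv.add_of_memW G hα1 hW' (hW.const_smul _) hα' (hα.smul_of_memW (-1))
  have dβ := IsRLDeriv.add_of_memW G hβ1 hW' (hW.const_smul _) hβ' (hβ.smul_of_memW (-1))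
  have hi : IntegrableOn (fun t => κ₁ • gα t + κ₂ • gβ t) (Ioo 0 T) :=
    (hα.2.1.smul κ₁).add (hβ.2.1.smul κ₂)
  have hi' : IntegrableOn (fun t => κ₁ • gα' t + κ₂ • gβ' t) (Ioo 0 T) :=
    (hα'.2.1.smul κ₁).add (hβ'.2.1.smul κ₂)
  have hV := hWd.cutoff G J
  have e1 : dgForm T σ J U (fun t => κ₁ • gα t + κ₂ • gβ t)
      (cutoff T σ J J (U' + (-1 : ℝ) • U)) = _ := h _ hV
  have e2 : dgForm T σ J U' (fun t => κ₁ • gα' t + κ₂ • gβ' t)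
      (cutoff T σ J J (U' + (-1 : ℝ) • U)) = _ := h' _ hV
  have e3 := dgForm_add_left G hW' (hW.const_smul (-1)) hV hi'
    (g' := fun t => (-1 : ℝ) • (κ₁ • gα t + κ₂ • gβ t)) (hi.smul (-1 : ℝ))
  rw [dgForm_smul_left G hW (-1), e1, e2] at e3
  have hz := eq_zero_of_dgForm_eq_zero G hα0 hα1 hβ0 hβ1 hκ₁ hκ₂ hWd dα dβ (by
    rw [show (fun t => κ₁ • (gα' t + (-1 : ℝ) • gα t) + κ₂ • (gβ' t + (-1 : ℝ) • gβ t))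
      = fun t => (κ₁ • gα' t + κ₂ • gβ' t) + (-1 : ℝ) • (κ₁ • gα t + κ₂ • gβ t) from
        funext fun t => by module, e3]
    ring)
  intro j hj t ht
  have := hz j hj t ht
  rw [Pi.add_apply, Pi.smul_apply, neg_one_smul, ← sub_eq_add_neg] at this
  exact sub_eq_zero.1 this

end Solvability

/-! ### Stability -/

section Stability

variable {a b : ℝ} {K : Partition a b} {n m : ℕ} {T σ : ℝ} {J : ℕ}
  {α β κ₁ κ₂ : ℝ} {U : ℝ → H01 a b} {gβ : ℝ → L2 a b}

/-- Cauchy–Schwarz after inserting `t^(β/2) t^(-β/2) = 1`. -/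
theorem lintegral_mul_le_weighted {β s : ℝ} {X Y : Type*} [NormedAddCommGroup X]
    [NormedAddCommGroup Y] [NormedSpace ℝ X] {f : ℝ → X} {u : ℝ → Y}
    (hf : AEStronglyMeasurable f (volume.restrict (Ioo 0 s)))
    (hu : AEStronglyMeasurable u (volume.restrict (Ioo 0 s))) :
    ∫⁻ t in Ioo 0 s, ‖f t‖ₑ * ‖u t‖ₑ ≤ weightedNorm β s f *
      (∫⁻ t in Ioo 0 s, ENNReal.ofReal (t ^ (-β)) * ‖u t‖ₑ ^ 2) ^ (1 / 2 : ℝ) := by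
  set F : ℝ → ℝ≥0∞ := fun t => ENNReal.ofReal (t ^ (β / 2)) * ‖f t‖ₑ with hF
  set H : ℝ → ℝ≥0∞ := fun t => ENNReal.ofReal (t ^ (-(β / 2))) * ‖u t‖ₑ with hH
  have hpow : ∀ t ∈ Ioo 0 s, ∀ r x : ℝ, r = x + x →
      ENNReal.ofReal (t ^ x) ^ 2 = ENNReal.ofReal (t ^ r) := by
    intro t ht r x hr
    rw [← ENNReal.ofReal_pow (Real.rpow_nonneg ht.1.le _), sq, ← Real.rpow_add ht.1, hr]
  have e1 : weightedNorm β s f = (∫⁻ t in Ioo 0 s, F t ^ (2 : ℝ)) ^ (1 / 2 : ℝ) := by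
    rw [weightedNorm]
    congr 1
    refine setLIntegral_congr_fun measurableSet_Ioo fun t ht => ?_
    simp only [hF]
    rw [ENNReal.rpow_two, mul_pow, hpow t ht β (β / 2) (by ring), abs_of_pos ht.1]
  have e2 : ∫⁻ t in Ioo 0 s, ENNReal.ofReal (t ^ (-β)) * ‖u t‖ₑ ^ 2
      = ∫⁻ t in Ioo 0 s, H t ^ (2 : ℝ) := by
    refine setLIntegral_congr_fun measurableSet_Ioo fun t ht => ?_
    simp only [hH]
    rw [ENNReal.rpow_two, mul_pow, hpow t ht (-β) (-(β / 2)) (by ring)]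
  have e3 : ∫⁻ t in Ioo 0 s, ‖f t‖ₑ * ‖u t‖ₑ = ∫⁻ t in Ioo 0 s, (F * H) t := by
    refine setLIntegral_congr_fun measurableSet_Ioo fun t ht => ?_
    simp only [hF, hH, Pi.mul_apply]
    rw [mul_mul_mul_comm, ← ENNReal.ofReal_mul (Real.rpow_nonneg ht.1.le _),
      ← Real.rpow_add ht.1, add_neg_cancel, Real.rpow_zero, ENNReal.ofReal_one, one_mul]
  rw [e1, e2, e3]
  exact ENNReal.lintegral_mul_le_Lp_mul_Lq _ Real.HolderConjugate.two_two
    ((measurable_id.pow_const _).ennreal_ofReal.aemeasurable.mul hf.enorm)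
    ((measurable_id.pow_const _).ennreal_ofReal.aemeasurable.mul hu.enorm)

theorem integral_apply_le (G : GridData T σ J) (hβ0 : 0 < β) (hβ1 : β < 1)
    (hU : MemW K n m T σ J U) (hβ : IsRLDeriv β T (fun t => H01.dx (U t)) gβ)
    {f : ℝ → Hneg1 a b} (hf : IntegrableOn f (Ioo 0 T)) {i : ℕ} (hi1 : 1 ≤ i) (hi : i ≤ J)
    (hfin : weightedNorm β (grid T σ J i) f ≠ ⊤) :
    ∫ t in Ioo 0 (grid T σ J i), f t (U t)
      ≤ (weightedNorm β (grid T σ J i) f).toReal * Real.sqrt (2 * Real.Gamma (1 - β) *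
        ∫ t in Ioo 0 (grid T σ J i), inner ℝ (gβ t) (H01.dx (U t))) := by
  set N := weightedNorm β (grid T σ J i) f with hN
  set Q := 2 * Real.Gamma (1 - β) *
    ∫ t in Ioo 0 (grid T σ J i), inner ℝ (gβ t) (H01.dx (U t)) with hQ
  have hm : AEStronglyMeasurable U (volume.restrict (Ioo 0 (grid T σ J i))) :=
    (hU.lipInMean_cutoff G hi).sm.aestronglyMeasurable.congr (G.cutoff_ae_eq i U).symm
  have hfm : AEStronglyMeasurable f (volume.restrict (Ioo 0 (grid T σ J i))) :=
    (hf.mono_set (Ioo_subset_Ioo_right (G.grid_le hi))).1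
  have hnn : 0 ≤ N.toReal * Real.sqrt Q := by positivity
  rw [← ENNReal.ofReal_le_ofReal_iff hnn]
  calc ENNReal.ofReal (∫ t in Ioo 0 (grid T σ J i), f t (U t))
      ≤ ‖∫ t in Ioo 0 (grid T σ J i), f t (U t)‖ₑ := Real.ofReal_le_enorm _
    _ ≤ ∫⁻ t in Ioo 0 (grid T σ J i), ‖f t (U t)‖ₑ := enorm_integral_le_lintegral_enorm _
    _ ≤ ∫⁻ t in Ioo 0 (grid T σ J i), ‖f t‖ₑ * ‖U t‖ₑ :=
        lintegral_mono fun t => (f t).le_opENorm _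
    _ ≤ N * (∫⁻ t in Ioo 0 (grid T σ J i), ENNReal.ofReal (t ^ (-β)) * ‖U t‖ₑ ^ 2) ^
          (1 / 2 : ℝ) := lintegral_mul_le_weighted hfm hm
    _ ≤ N * ENNReal.ofReal Q ^ (1 / 2 : ℝ) :=
        mul_le_mul_right (ENNReal.rpow_le_rpow (coercivity_weighted hU G hβ0 hβ1 hβ hi1 hi)
          (by norm_num)) _
    _ = ENNReal.ofReal (N.toReal * Real.sqrt Q) := by
        have hQ0 : 0 ≤ Q := mul_nonneg
          (mul_nonneg zero_le_two (Real.Gamma_pos_of_pos (by linarith)).le)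
          (coercivity_nonneg hU G hβ0 hβ1 hβ hi1 hi)
        rw [ENNReal.ofReal_mul ENNReal.toReal_nonneg, ENNReal.ofReal_toReal hfin,
          Real.sqrt_eq_rpow, ENNReal.ofReal_rpow_of_nonneg hQ0 (by norm_num)]

/-- The initial term is split by Young so that its half of `‖U_0⁺‖²` cancels against the jump at
`0`; Poincaré and the contraction property of the Ritz projection bound the rest. The load costs
half of the `β`-energy, which explains the factor `2⁻¹` in front of `κ₂`. -/
theorem Solves.energy_estimate (hab : a ≤ b) (G : GridData T σ J)
    (hβ0 : 0 < β) (hβ1 : β < 1) (hκ₂ : 0 < κ₂) {u₀ : H01 a b}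
    {f : ℝ → Hneg1 a b} (hf : IntegrableOn f (Ioo 0 T))
    (hU : Solves K n m T σ J α β κ₁ κ₂ u₀ f U) {i : ℕ} (hi1 : 1 ≤ i) (hi : i ≤ J)
    (hfin : weightedNorm β (grid T σ J i) f ≠ ⊤) :
    ∃ gα gβ : ℝ → L2 a b, IsRLDeriv α T (fun t => H01.dx (U t)) gα ∧
      IsRLDeriv β T (fun t => H01.dx (U t)) gβ ∧
      2⁻¹ * ‖H01.toL2 (traceL T σ J U i)‖ ^ 2
        + κ₁ * (∫ t in Ioo 0 (grid T σ J i), inner ℝ (gα t) (H01.dx (U t)))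
        + 2⁻¹ * (κ₂ * ∫ t in Ioo 0 (grid T σ J i), inner ℝ (gβ t) (H01.dx (U t)))
      ≤ 2⁻¹ * ((b - a) * ‖u₀‖) ^ 2 + Real.Gamma (1 - β) *
        ((1 / Real.sqrt κ₂) * (weightedNorm β (grid T σ J i) f).toReal) ^ 2 := by
  obtain ⟨hW, r, gα, gβ, hr, hα, hβ, h⟩ := hU
  refine ⟨gα, gβ, hα, hβ, ?_⟩
  have hform : dgForm T σ J U (fun t => κ₁ • gα t + κ₂ • gβ t) (cutoff T σ J i U) = _ :=
    h _ (hW.cutoff G i)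
  rw [dgForm_cutoff G hW hi, integral_inner_combination G hW hα.2.1 hβ.2.1 hi,
    traceR_cutoff_of_lt G hW hi1 G.J_pos,
    integral_Ioo_cutoff G (fun t v => f t v) (fun t => map_zero _) hi U] at hform
  have e1 := energy_lower_bound G hW hi1 hi
  have e2 := integral_apply_le G hβ0 hβ1 hW hβ hf hi1 hi hfin
  have q2 := coercivity_nonneg hW G hβ0 hβ1 hβ hi1 hi
  set N := (weightedNorm β (grid T σ J i) f).toReal with hN
  set Q := ∫ t in Ioo 0 (grid T σ J i), inner ℝ (gβ t) (H01.dx (U t)) with hQ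
  have hΓ : 0 < Real.Gamma (1 - β) := Real.Gamma_pos_of_pos (by linarith)
  have e3 : inner ℝ (H01.toL2 r) (H01.toL2 (traceR T σ J U 0))
      ≤ 2⁻¹ * ((b - a) * ‖u₀‖) ^ 2 + 2⁻¹ * ‖H01.toL2 (traceR T σ J U 0)‖ ^ 2 := by
    obtain ⟨r', hr', hle⟩ := exists_isRitz K n u₀
    obtain rfl := hr.unique hr'
    have h1 : ‖H01.toL2 r‖ ≤ (b - a) * ‖u₀‖ :=
      (H01.norm_toL2_le hab r).trans (mul_le_mul_of_nonneg_left hle (by linarith))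
    have h2 := (real_inner_le_norm (H01.toL2 r) (H01.toL2 (traceR T σ J U 0))).trans
      (mul_le_mul_of_nonneg_right h1 (norm_nonneg _))
    nlinarith [sq_nonneg ((b - a) * ‖u₀‖ - ‖H01.toL2 (traceR T σ J U 0)‖)]
  have e4 : N * Real.sqrt (2 * Real.Gamma (1 - β) * Q)
      ≤ Real.Gamma (1 - β) * ((1 / Real.sqrt κ₂) * N) ^ 2 + 2⁻¹ * (κ₂ * Q) := by
    set x := Real.sqrt (2 * Real.Gamma (1 - β) * Q) with hx
    have hx2 : x ^ 2 = 2 * Real.Gamma (1 - β) * Q := Real.sq_sqrt (by positivity)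
    have hQx : Q = x ^ 2 / (2 * Real.Gamma (1 - β)) := by
      rw [hx2]; field_simp
    have hk : (1 / Real.sqrt κ₂ * N) ^ 2 = N ^ 2 / κ₂ := by
      rw [mul_pow, div_pow, Real.sq_sqrt hκ₂.le]; ring
    rw [hk, hQx]
    -- Young's inequality for `N * x` with weights chosen so that exactly `½ κ₂ Q` appears,
    -- displayed as a perfect square.
    have : 0 ≤ (2 * Real.Gamma (1 - β) * N - κ₂ * x) ^ 2 / (4 * Real.Gamma (1 - β) * κ₂) := by
      positivity
    have e : (2 * Real.Gamma (1 - β) * N - κ₂ * x) ^ 2 / (4 * Real.Gamma (1 - β) * κ₂)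
        = Real.Gamma (1 - β) * (N ^ 2 / κ₂)
          + 2⁻¹ * (κ₂ * (x ^ 2 / (2 * Real.Gamma (1 - β)))) - N * x := by
      field_simp
      ring
    linarith
  linarith

theorem le_ofReal_sqrt_of_sq_le {x : ℝ≥0∞} {y : ℝ} (h : x ^ 2 ≤ ENNReal.ofReal y) :
    x ≤ ENNReal.ofReal (Real.sqrt y) := by
  have h2 : x ≤ ENNReal.ofReal y ^ (1 / 2 : ℝ) := by
    have := ENNReal.rpow_le_rpow h (z := 1 / 2) (by norm_num)
    rw [← ENNReal.rpow_natCast, ← ENNReal.rpow_mul] at this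
    norm_num at this
    simpa using this
  rcases le_or_gt 0 y with hy | hy
  · rwa [Real.sqrt_eq_rpow, ← ENNReal.ofReal_rpow_of_nonneg hy (by norm_num)]
  · rw [ENNReal.ofReal_of_nonpos hy.le, ENNReal.zero_rpow_of_pos (by norm_num)] at h2
    exact h2.trans zero_le

theorem ofReal_sqrt_mul_le {x : ℝ≥0∞} {κ C Q M D : ℝ} (hC : 0 ≤ C) (hM : 0 ≤ M)
    (hD : 0 ≤ D) (hx : x ^ 2 ≤ ENNReal.ofReal (C * Q)) (hQ : κ * Q ≤ M * D ^ 2) (hκ : 0 ≤ κ) :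
    ENNReal.ofReal (Real.sqrt κ) * x ≤ ENNReal.ofReal (Real.sqrt (C * M) * D) := by
  refine (mul_le_mul_right (le_ofReal_sqrt_of_sq_le hx) _).trans ?_
  rw [← ENNReal.ofReal_mul (Real.sqrt_nonneg _), ← Real.sqrt_mul hκ]
  apply ENNReal.ofReal_le_ofReal
  calc Real.sqrt (κ * (C * Q)) ≤ Real.sqrt (C * M * D ^ 2) := by
        apply Real.sqrt_le_sqrt
        calc κ * (C * Q) = C * (κ * Q) := by ring
          _ ≤ C * (M * D ^ 2) := mul_le_mul_of_nonneg_left hQ hC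
          _ = C * M * D ^ 2 := by ring
    _ = Real.sqrt (C * M) * D := by
        rw [Real.sqrt_mul (by positivity), Real.sqrt_sq hD]

end Stability

end SubdiffusionDG

end

/-! ### The main theorem -/

open SubdiffusionDG in
theorem theorem3p1 (α β : ℝ) (hα : 0 < α) (hαβ : α < β) (hβ : β < 1)
    (m n : ℕ) (hn : 0 < n) :
    ∃ C : ℝ, 0 < C ∧
      ∀ (a b : ℝ), a < b → ∀ (K : SubdiffusionDG.Partition a b) (T σ : ℝ), 0 < T → 1 ≤ σ →
      ∀ (J : ℕ), 0 < J → ∀ (κ₁ κ₂ : ℝ), 0 < κ₁ → 0 < κ₂ →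
      ∀ (u₀ : SubdiffusionDG.H01 a b) (f : ℝ → SubdiffusionDG.Hneg1 a b),
      IntegrableOn f (Ioo 0 T) →
      ∃ U : ℝ → SubdiffusionDG.H01 a b,
        SubdiffusionDG.Solves K n m T σ J α β κ₁ κ₂ u₀ f U ∧
        (∀ U' : ℝ → SubdiffusionDG.H01 a b,
          SubdiffusionDG.Solves K n m T σ J α β κ₁ κ₂ u₀ f U' →
          ∀ j < J, EqOn U' U
            (Ioo (SubdiffusionDG.grid T σ J j) (SubdiffusionDG.grid T σ J (j + 1)))) ∧
        (SubdiffusionDG.MemWeighted β T f →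
          ∀ j : ℕ, 1 ≤ j → j ≤ J →
          ∀ {ι : Type} [Countable ι] (e : HilbertBasis ι ℝ (SubdiffusionDG.H01 a b)),
          ‖SubdiffusionDG.H01.toL2 (SubdiffusionDG.traceL T σ J U j)‖ₑ
            + ENNReal.ofReal (Real.sqrt κ₁) *
              SubdiffusionDG.fracSeminorm e (α / 2) (SubdiffusionDG.grid T σ J j) U
            + ENNReal.ofReal (Real.sqrt κ₂) *
              SubdiffusionDG.fracSeminorm e (β / 2) (SubdiffusionDG.grid T σ J j) U
          ≤ ENNReal.ofReal C * (ENNReal.ofReal (max 1 (b - a)) * ‖u₀‖ₑ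
            + ENNReal.ofReal (1 / Real.sqrt κ₂) *
              SubdiffusionDG.weightedNorm β (SubdiffusionDG.grid T σ J j) f)) := by
  have hα1 : α < 1 := hαβ.trans hβ
  have hβ0 : 0 < β := hα.trans hαβ
  have hΓα : 0 < Real.Gamma (1 - α) := Real.Gamma_pos_of_pos (by linarith)
  have hΓβ : 0 < Real.Gamma (1 - β) := Real.Gamma_pos_of_pos (by linarith)
  -- `M * D ^ 2` bounds the right-hand side of the energy estimate, `D` being the bracket in the
  -- claim.
  set M : ℝ := 2⁻¹ + Real.Gamma (1 - β) with hM
  have hM0 : 0 < M := by positivity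
  set cα : ℝ := (2 * Real.pi) ^ α * (4 / α * Real.Gamma (1 - α)) with hcα
  set cβ : ℝ := (2 * Real.pi) ^ β * (4 / β * Real.Gamma (1 - β)) with hcβ
  have hcα0 : 0 ≤ cα := by positivity
  have hcβ0 : 0 ≤ cβ := by positivity
  -- One summand per term on the left. The `L²` trace and the `β`-energy enter the energy estimate
  -- with coefficient `2⁻¹`, hence `2 * M`; the `α`-energy enters with coefficient one.
  refine ⟨Real.sqrt (2 * M) + Real.sqrt (cα * M) + Real.sqrt (cβ * (2 * M)), by positivity, ?_⟩
  intro a b hab K T σ hT hσ J hJ κ₁ κ₂ hκ₁ hκ₂ u₀ f hf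
  have G : GridData T σ J := ⟨hT, hσ, hJ⟩
  obtain ⟨U, hU⟩ := exists_solves (K := K) (n := n) (m := m) G hα hα1 hβ0 hβ hκ₁ hκ₂ u₀ hf
  refine ⟨U, hU, fun U' hU' => hU.eqOn G hα hα1 hβ0 hβ hκ₁ hκ₂ hU', ?_⟩
  intro hfw i hi1 hi ι _ e
  have hfin : weightedNorm β (grid T σ J i) f ≠ ⊤ := by
    refine ne_top_of_le_ne_top hfw.2.ne (ENNReal.rpow_le_rpow ?_ (by norm_num))
    exact lintegral_mono_set (Ioo_subset_Ioo_right (G.grid_le hi))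
  obtain ⟨gα, gβ, dα, dβ, hE⟩ :=
    hU.energy_estimate hab.le G hβ0 hβ hκ₂ hf hi1 hi hfin
  have qα := coercivity_nonneg hU.1 G hα hα1 dα hi1 hi
  have qβ := coercivity_nonneg hU.1 G hβ0 hβ dβ hi1 hi
  have sα := coercivity_fracSeminorm hU.1 G hα hα1 dα hi1 hi e
  have sβ := coercivity_fracSeminorm hU.1 G hβ0 hβ dβ hi1 hi e
  set N := (weightedNorm β (grid T σ J i) f).toReal with hN
  set Qα := ∫ t in Ioo 0 (grid T σ J i), inner ℝ (gα t) (H01.dx (U t)) with hQα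
  set Qβ := ∫ t in Ioo 0 (grid T σ J i), inner ℝ (gβ t) (H01.dx (U t)) with hQβ
  set D : ℝ := max 1 (b - a) * ‖u₀‖ + 1 / Real.sqrt κ₂ * N with hD
  have hN0 : 0 ≤ 1 / Real.sqrt κ₂ * N := by positivity
  have hu0 : 0 ≤ max 1 (b - a) * ‖u₀‖ := by positivity
  have hD0 : 0 ≤ D := add_nonneg hu0 hN0
  have hDe : ENNReal.ofReal (max 1 (b - a)) * ‖u₀‖ₑ
      + ENNReal.ofReal (1 / Real.sqrt κ₂) * weightedNorm β (grid T σ J i) f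
      = ENNReal.ofReal D := by
    rw [hD, ENNReal.ofReal_add hu0 hN0, ENNReal.ofReal_mul (by positivity),
      ENNReal.ofReal_mul (by positivity), ofReal_norm, hN, ENNReal.ofReal_toReal hfin]
  have hbound : 2⁻¹ * ((b - a) * ‖u₀‖) ^ 2
      + Real.Gamma (1 - β) * ((1 / Real.sqrt κ₂) * N) ^ 2 ≤ M * D ^ 2 := by
    have h1 : ((b - a) * ‖u₀‖) ^ 2 ≤ D ^ 2 := by
      refine pow_le_pow_left₀ (mul_nonneg (by linarith) (norm_nonneg _)) ?_ 2
      have := mul_le_mul_of_nonneg_right (le_max_right 1 (b - a)) (norm_nonneg u₀)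
      linarith
    have h2 : ((1 / Real.sqrt κ₂) * N) ^ 2 ≤ D ^ 2 := pow_le_pow_left₀ hN0 (by linarith) 2
    rw [hM, add_mul]
    gcongr
  have hκα := mul_nonneg hκ₁.le qα
  have hκβ := mul_nonneg hκ₂.le qβ
  have hL2 := sq_nonneg ‖H01.toL2 (traceL T σ J U i)‖
  have bL : ‖H01.toL2 (traceL T σ J U i)‖ₑ ≤ ENNReal.ofReal (Real.sqrt (2 * M) * D) := by
    rw [← ofReal_norm]
    apply ENNReal.ofReal_le_ofReal
    rw [← Real.sqrt_sq hD0, ← Real.sqrt_mul (by positivity)]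
    apply Real.le_sqrt_of_sq_le
    linarith
  have bα := ofReal_sqrt_mul_le (M := M) hcα0 hM0.le hD0 sα (by linarith) hκ₁.le
  have bβ := ofReal_sqrt_mul_le (M := 2 * M) hcβ0 (by positivity) hD0 sβ (by linarith) hκ₂.le
  rw [hDe, ← ENNReal.ofReal_mul (by positivity), add_mul, add_mul,
    ENNReal.ofReal_add (by positivity) (by positivity),
    ENNReal.ofReal_add (by positivity) (by positivity)]
  exact add_le_add (add_le_add bL bα) bβ
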